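/- Let $R$ be a commutative ring. All categories are small in a fixed universe (which also contains $R$). A non-unital $A_\infty$-category $\mathscr A$ is a graded $R$-linear quiver with multilinear operations $m^n$ ($n\ge 1$) of degree $2-n$ such that, for all composable homogeneous $f_1,\dots,f_n$, $$\sum_{m=1}^{n}\sum_{d=0}^{n-m}(-1)^{\deg f_1+\dots+\deg f_d-d}\,m^{n-m+1}\big(f_n,\dots,f_{d+m+1},m^m(f_{d+m},\dots,f_{d+1}),f_d,\dots,f_1\big)=0 .$$ A non-unital DG category is a non-unital $A_\infty$-category with $m^n=0$ for $n\ge 3$. A strict functor $F$ is a map on objects together with degree $0$ linear maps on morphisms commuting with all $m^n$; it is surjective on morphisms if all maps $\mathrm{Hom}(x,y)\to\mathrm{Hom}(Fx,Fy)$ are surjective, and a quasi-equivalence if all these maps are quasi-isomorphisms and $H^0(F)$ is essentially surjective. $\mathscr A$ is cohomologically unital if its graded cohomology category, with composition $[g]\cdot[f]=(-1)^{\deg f}[m^2(g,f)]$, has identities; it is unital if moreover every object $x$ has a representative $1_x$ of its cohomological identity such that the chain maps $f\mapsto m^2(f,1_x)$ and $f\mapsto(-1)^{\deg f}m^2(1_x,f)$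 are homotopic to the identity on all morphism complexes from, respectively to, $x$. A strict functor between cohomologically unital categories is cohomologically unital if it preserves the identities of the cohomology categories. $\mathscr A$ has cofibrant morphisms if every complex $(\mathrm{Hom}_{\mathscr A}(x,y),m^1)$ is cofibrant in the projective model structure on unbounded complexes of $R$-modules, i.e. h-projective and degreewise projective. Let $\mathcal C$ be either the category of non-unital $A_\infty$-categories or the category of non-unital DG categories, with strict functors as morphisms. **Theorem B'.** There are a functor $(-)^{\mathrm{cm}}:\mathcal C\to\mathcal C$ and a natural transformation $\Psi:(-)^{\mathrm{cm}}\to\mathrm{Id}_{\mathcal C}$ with the following properties. 1. For every $\mathscr A$ in $\mathcal C$, the category $\mathscr A^{\mathrm{cm}}$ has the same objects as $\mathscr A$ and has cofibrant morphisms, and $\Psi_{\mathscr A}:\mathscr A^{\mathrm{cm}}\to\mathscr A$ is the identity on objects, surjective on morphisms, and a quasi-equivalence. 2. If $\mathscr A$ is cohomologically unital (resp. unital), then so is $\mathscr A^{\mathrm{cm}}$, and $\Psi_{\mathscr A}$ is cohomologically unital. If $F:\mathscr A\to\mathscr B$ is a cohomologically unital strict functor between cohomologically unital categories, then $F^{\mathrm{cm}}:\mathscr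 A^{\mathrm{cm}}\to\mathscr B^{\mathrm{cm}}$ is cohomologically unital. 3. (Lifting property.) Let $\mathscr A,\mathscr B,\mathscr C$ be in $\mathcal C$, and let $F:\mathscr A^{\mathrm{cm}}\to\mathscr B$ and $G:\mathscr C\to\mathscr B$ be strict functors such that $G$ is a quasi-equivalence surjective on morphisms and every object $F(x)$ is of the form $G(c)$ (for example, $G$ is surjective on objects). Then there is a (not necessarily unique) strict functor $\tilde F:\mathscr A^{\mathrm{cm}}\to\mathscr C$ with $G\circ\tilde F=F$. -/

import Mathlib

open CategoryTheory

universe u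

/-- Composable strings of edges `x ⟶ ⋯ ⟶ y` in a quiver with edges `E`: `nil x` is the empty string
at `x`, and `p.cons f` is the string `p` followed by the edge `f`. In the usual right-to-left
notation, `((nil.cons f₁).cons f₂) ⋯ .cons fₙ` is the string `(fₙ, …, f₂, f₁)`. -/
inductive Chain {Ob : Type u} (E : Ob → Ob → Type u) : Ob → Ob → Type u
  | nil (x : Ob) : Chain E x x
  | cons {x y z : Ob} (p : Chain E x y) (f : E y z) : Chain E x z

namespace Chain

variable {Ob Ob' Ob'' : Type u} {E : Ob → Ob → Type u} {E' : Ob' → Ob' → Type u}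
  {E'' : Ob'' → Ob'' → Type u}

/-- The number of edges of a string. -/
def length {x y : Ob} : Chain E x y → ℕ
  | nil _ => 0
  | cons p _ => p.length + 1

/-- The string `p` followed by the string `q`. -/
def append {x y z : Ob} (p : Chain E x y) : Chain E y z → Chain E x z
  | nil _ => p
  | cons q f => (append p q).cons f

/-- The string consisting of one edge. -/
def single {x y : Ob} (f : E x y) : Chain E x y := (nil x).cons f

/-- All the ways `w = p.append q` of cutting a string `w` into an initial part `p` and a final
part `q` (either of which may be empty), each listed once. -/
def splits {x y : Ob} : Chain E x y → List (Σ z : Ob, Chain E x z × Chain E z y)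
  | nil x => [⟨x, nil x, nil x⟩]
  | cons p f =>
      (splits p).map (fun s => ⟨s.1, s.2.1, s.2.2.cons f⟩) ++ [⟨_, p.cons f, nil _⟩]

/-- The image of a string under a morphism of quivers. -/
def map (obj : Ob → Ob') (φ : ∀ x y, E x y → E' (obj x) (obj y)) {x y : Ob} :
    Chain E x y → Chain E' (obj x) (obj y)
  | nil x => nil (obj x)
  | cons p f => (map obj φ p).cons (φ _ _ f)

theorem map_id {x y : Ob} (w : Chain E x y) :
    w.map (E' := E) (fun x => x) (fun _ _ f => f) = w := by
  induction w with
  | nil => rfl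
  | cons p f ih => simp only [map, ih]

theorem map_map (obj : Ob → Ob') (φ : ∀ x y, E x y → E' (obj x) (obj y))
    (obj' : Ob' → Ob'') (φ' : ∀ x y, E' x y → E'' (obj' x) (obj' y)) {x y : Ob}
    (w : Chain E x y) :
    (w.map obj φ).map obj' φ' =
      w.map (fun x => obj' (obj x)) (fun x y f => φ' _ _ (φ x y f)) := by
  induction w with
  | nil => rfl
  | cons p f ih => simp only [map, ih]

end Chain

/-- The homogeneous edges of a graded quiver: pairs of a degree and an edge of that degree. -/
abbrev GradedEdge {Ob : Type u} (Hom : Ob → Ob → ℤ → Type u) (x y : Ob) : Type u :=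
  Σ d : ℤ, Hom x y d

/-- The total degree `deg f₁ + ⋯ + deg fₙ` of a string of homogeneous edges. -/
def Chain.deg {Ob : Type u} {Hom : Ob → Ob → ℤ → Type u} {x y : Ob} :
    Chain (GradedEdge Hom) x y → ℤ
  | .nil _ => 0
  | .cons p f => p.deg + f.1

/-- A (small) non-unital `A∞`-category over the commutative ring `R`: a graded `R`-linear quiver
(`Hom x y d` is the degree `d` part of the graded module of morphisms from `x` to `y`) with
multilinear operations `mⁿ`, `n ≥ 1`, of degree `2 - n` satisfying the `A∞`-relations. -/
structure AInfCat (R : Type u) [CommRing R] where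
  /-- The objects. -/
  Obj : Type u
  /-- The homogeneous morphisms of a given degree. -/
  Hom : Obj → Obj → ℤ → Type u
  [addCommGroup : ∀ x y d, AddCommGroup (Hom x y d)]
  [module : ∀ x y d, Module R (Hom x y d)]
  /-- `m w e` is the component of degree `e` of `mⁿ(fₙ, …, f₁)`, where `w = (fₙ, …, f₁)` is a
  string of `n` homogeneous morphisms. -/
  m : ∀ {x y : Obj}, Chain (GradedEdge Hom) x y → ∀ e : ℤ, Hom x y e
  /-- There is no operation `m⁰`. -/
  m_nil : ∀ (x : Obj) (e : ℤ), m (Chain.nil x) e = 0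
  /-- `mⁿ` has degree `2 - n`. -/
  m_deg : ∀ {x y : Obj} (w : Chain (GradedEdge Hom) x y) (e : ℤ),
    e ≠ w.deg + 2 - w.length → m w e = 0
  /-- `mⁿ` is additive in every variable. -/
  m_add : ∀ {x a b y : Obj} (p : Chain (GradedEdge Hom) x a) (d : ℤ) (f g : Hom a b d)
    (q : Chain (GradedEdge Hom) b y) (e : ℤ),
    m ((p.cons ⟨d, f + g⟩).append q) e =
      m ((p.cons ⟨d, f⟩).append q) e + m ((p.cons ⟨d, g⟩).append q) e
  /-- `mⁿ` is homogeneous in every variable. -/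
  m_smul : ∀ {x a b y : Obj} (p : Chain (GradedEdge Hom) x a) (d : ℤ) (c : R) (f : Hom a b d)
    (q : Chain (GradedEdge Hom) b y) (e : ℤ),
    m ((p.cons ⟨d, c • f⟩).append q) e = c • m ((p.cons ⟨d, f⟩).append q) e
  /-- The `A∞`-relations: for every string `w = (fₙ, …, f₁)`, the sum of
  `(-1)^(deg p - length p) m(q, m(r), p)` over all ways of cutting `w` into three consecutive
  strings `w = (q, r, p)` vanishes. (The cuts with `r` empty contribute `0`.) -/
  rel : ∀ {x y : Obj} (w : Chain (GradedEdge Hom) x y) (e : ℤ),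
    (w.splits.map fun s => (s.2.1.splits.map fun t =>
      Int.negOnePow (t.2.1.deg - t.2.1.length) •
        m ((t.2.1.cons ⟨t.2.2.deg + 2 - t.2.2.length, m t.2.2 _⟩).append s.2.2) e).sum).sum = 0

attribute [instance] AInfCat.addCommGroup AInfCat.module

namespace AInfCat

variable {R : Type u} [CommRing R] (A : AInfCat R)

/-- The differential `m¹`. -/
def d (x y : A.Obj) (i j : ℤ) : A.Hom x y i →ₗ[R] A.Hom x y j where
  toFun f := A.m (Chain.single ⟨i, f⟩) j
  map_add' f g := A.m_add (Chain.nil x) i f g (Chain.nil y) j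
  map_smul' c f := A.m_smul (Chain.nil x) i c f (Chain.nil y) j

/-- The component of degree `k` of `m²(g, f)`. -/
def m₂ {x y z : A.Obj} {i j : ℤ} (g : A.Hom y z j) (f : A.Hom x y i) (k : ℤ) : A.Hom x z k :=
  A.m ((Chain.single ⟨i, f⟩).cons ⟨j, g⟩) k

theorem m_zero {x a b y : A.Obj} (p : Chain (GradedEdge A.Hom) x a) (d : ℤ)
    (q : Chain (GradedEdge A.Hom) b y) (e : ℤ) :
    A.m ((p.cons ⟨d, (0 : A.Hom a b d)⟩).append q) e = 0 := by
  have h := A.m_smul p d 0 (0 : A.Hom a b d) q e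
  simpa using h

theorem d_eq_zero (x y : A.Obj) (i j : ℤ) (h : j ≠ i + 1) : A.d x y i j = 0 := by
  ext f
  refine A.m_deg _ _ ?_
  simp only [Chain.single, Chain.deg, Chain.length]
  push_cast
  intro h'
  exact h (by linarith)

theorem d_comp_d (x y : A.Obj) (i j k : ℤ) (f : A.Hom x y i) :
    A.d x y j k (A.d x y i j f) = 0 := by
  by_cases hj : j = i + 1
  · have h := A.rel (Chain.single ⟨i, f⟩) k
    have h0 := A.m_zero (Chain.nil x) 2 (Chain.single ⟨i, f⟩) k
    have h1 := A.m_zero (Chain.single ⟨i, f⟩) 2 (Chain.nil y) k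
    simp only [Chain.single, Chain.append] at h0 h1
    simp [Chain.single, Chain.splits, Chain.append, A.m_nil, Chain.deg, Chain.length, h0, h1] at h
    have e : 0 + i + 2 - 1 = j := by omega
    rw [e] at h
    exact h
  · rw [A.d_eq_zero x y i j hj]
    simp

/-- The complex of morphisms from `x` to `y`, with differential `m¹`. -/
def homComplex (x y : A.Obj) : CochainComplex (ModuleCat.{u} R) ℤ where
  X i := ModuleCat.of R (A.Hom x y i)
  d i j := ModuleCat.ofHom (A.d x y i j)
  shape i j h := by
    rw [A.d_eq_zero x y i j (fun h' => h h'.symm)]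
    rfl
  d_comp_d' i j k _ _ := by
    ext f
    exact A.d_comp_d x y i j k f

/-- All complexes of morphisms are cofibrant in the projective model structure on the category of
unbounded complexes of `R`-modules, i.e. they are h-projective and degreewise projective. -/
def HasCofibrantMorphisms : Prop :=
  ∀ x y : A.Obj, (A.homComplex x y).IsKProjective ∧ ∀ i : ℤ, Module.Projective R (A.Hom x y i)

/-- `e` is closed of degree `0` and represents an identity of `x` in the graded cohomology category.
With the signs of the `A∞`-relations used here, the associative composition of cohomology classes is
`[g] ⬝ [f] = (-1)^(deg f) [m²(g, f)]`, whence the sign in the last clause. -/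
def IsCohUnit {x : A.Obj} (e : A.Hom x x 0) : Prop :=
  A.d x x 0 1 e = 0 ∧
  (∀ (y : A.Obj) (k : ℤ) (f : A.Hom x y k), A.d x y k (k + 1) f = 0 →
    ∃ h : A.Hom x y (k - 1), f - A.m₂ f e k = A.d x y (k - 1) k h) ∧
  (∀ (y : A.Obj) (k : ℤ) (f : A.Hom y x k), A.d y x k (k + 1) f = 0 →
    ∃ h : A.Hom y x (k - 1), f - k.negOnePow • A.m₂ e f k = A.d y x (k - 1) k h)

/-- `A` is cohomologically unital: its graded cohomology category has identities. -/
def IsCohUnital : Prop := ∀ x : A.Obj, ∃ e : A.Hom x x 0, A.IsCohUnit e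

/-- `A` is unital: every object `x` has a representative `e` of its cohomological identity such that
the chain maps `m²(-, e)` and `± m²(e, -)` are homotopic to the identity. -/
def IsUnital : Prop :=
  ∀ x : A.Obj, ∃ e : A.Hom x x 0, A.IsCohUnit e ∧
    (∀ y : A.Obj, ∃ H : ∀ i j : ℤ, A.Hom x y i →ₗ[R] A.Hom x y j,
      ∀ (k : ℤ) (f : A.Hom x y k), f - A.m₂ f e k =
        A.d x y (k - 1) k (H k (k - 1) f) + H (k + 1) k (A.d x y k (k + 1) f)) ∧
    (∀ y : A.Obj, ∃ H : ∀ i j : ℤ, A.Hom y x i →ₗ[R] A.Hom y x j,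
      ∀ (k : ℤ) (f : A.Hom y x k), f - k.negOnePow • A.m₂ e f k =
        A.d y x (k - 1) k (H k (k - 1) f) + H (k + 1) k (A.d y x k (k + 1) f))

/-- `x` and `y` are isomorphic in the degree zero cohomology category `H⁰(A)`: they are equal (there
may be no identities in the non-unital case), or there are mutually inverse classes between them. -/
def IsoH0 (x y : A.Obj) : Prop :=
  x = y ∨ ∃ (f : A.Hom x y 0) (g : A.Hom y x 0), A.d x y 0 1 f = 0 ∧ A.d y x 0 1 g = 0 ∧
    A.IsCohUnit (A.m₂ g f 0) ∧ A.IsCohUnit (A.m₂ f g 0)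

/-- A strict non-unital `A∞`-functor: a degree `0` linear morphism of graded quivers that commutes
with all the operations `mⁿ`. -/
@[ext]
structure StrictFunctor (A B : AInfCat R) where
  /-- The map on objects. -/
  obj : A.Obj → B.Obj
  /-- The map on morphisms of degree `i`. -/
  map : ∀ (x y : A.Obj) (i : ℤ), A.Hom x y i →ₗ[R] B.Hom (obj x) (obj y) i
  map_m : ∀ {x y : A.Obj} (w : Chain (GradedEdge A.Hom) x y) (e : ℤ),
    map x y e (A.m w e) =
      B.m (w.map (E' := GradedEdge B.Hom) obj (fun x y f => ⟨f.1, map x y f.1 f.2⟩)) e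

/-- Non-unital `A∞`-categories and strict non-unital `A∞`-functors form a category. -/
instance : Category (AInfCat.{u} R) where
  Hom A B := StrictFunctor A B
  id A :=
    { obj := fun x => x
      map := fun _ _ _ => LinearMap.id
      map_m := fun w e => congrArg (fun w => A.m w e) (Chain.map_id w).symm }
  comp F G :=
    { obj := fun x => G.obj (F.obj x)
      map := fun x y i => (G.map (F.obj x) (F.obj y) i).comp (F.map x y i)
      map_m := fun w e => by
        rw [LinearMap.comp_apply, F.map_m, G.map_m, Chain.map_map]
        rfl }

/-- A non-unital DG category: `mⁿ = 0` for `n ≥ 3`. -/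
def IsDG : ObjectProperty (AInfCat.{u} R) := fun A =>
  ∀ (x y : A.Obj) (w : Chain (GradedEdge A.Hom) x y) (e : ℤ), 3 ≤ w.length → A.m w e = 0

namespace StrictFunctor

variable {A} {B : AInfCat R} (F : StrictFunctor A B)

theorem map_d (x y : A.Obj) (i j : ℤ) (f : A.Hom x y i) :
    F.map x y j (A.d x y i j f) = B.d (F.obj x) (F.obj y) i j (F.map x y i f) :=
  F.map_m (Chain.single ⟨i, f⟩) j

/-- The induced map on complexes of morphisms. -/
def homMap (x y : A.Obj) : A.homComplex x y ⟶ B.homComplex (F.obj x) (F.obj y) where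
  f i := ModuleCat.ofHom (F.map x y i)
  comm' i j _ := by
    ext f
    exact (F.map_d x y i j f).symm

/-- `F` is a quasi-equivalence: it induces quasi-isomorphisms on the complexes of morphisms, and
`H⁰(F)` is essentially surjective. -/
def IsQuasiEquivalence : Prop :=
  (∀ x y : A.Obj, QuasiIso (F.homMap x y)) ∧ ∀ b : B.Obj, ∃ a : A.Obj, B.IsoH0 (F.obj a) b

/-- `F` is surjective on morphisms: all the maps `Hom(x, y) → Hom(F x, F y)` are surjective. -/
def SurjectiveOnMorphisms : Prop :=
  ∀ (x y : A.Obj) (i : ℤ), Function.Surjective (F.map x y i)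

/-- `F` is cohomologically unital: it maps cohomological identities to such. -/
def IsCohUnital : Prop :=
  ∀ (x : A.Obj) (e : A.Hom x x 0), A.IsCohUnit e → B.IsCohUnit (F.map x x 0 e)

end StrictFunctor

end AInfCat

-- The resolution is free on cells, and enough cells are attached for the lifting property of its
-- projection to hold by construction. For every morphism `a` of `A` and every cycle `z` of the
-- resolution lying over the boundary of `a`, there is one cell over `a` with boundary `z`. To these
-- cells the operations are applied freely: all `mⁿ` with `n ≥ 2` in the `A∞` case, associative
-- products of cells in the DG case. Since `z` may involve earlier cells and operations, the basis
-- is an inductive type of trees (`CellTree`). Operations and differential are defined on all raw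
-- trees by structural recursion, and the trees whose cells really are attached along such cycles
-- (`Valid`) are selected afterwards. No choice is made, so sending the cell of `(a, z)` to the cell
-- of `(F a, F z)` is strictly functorial.
--
-- After a shift of degrees by one, the operations form an odd coderivation of the tensor coalgebra,
-- and the `A∞`-relations say that it squares to zero. The differential of a grafted string is
-- defined by solving the relation of that string for it. In the DG case the relations with at least
-- two arguments are then the Leibniz rule (`diff_mul`) and associativity (`mul_assoc_single`). What
-- remains is that the differential squares to zero. This goes by induction on trees: the square of
-- a coderivation vanishes on a string if its corestriction vanishes on all substrings
-- (`coder_coder`), and this corestriction is the square of the differential on single letters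
-- (`ops_coder`).
--
-- A strict functor out of the resolution is the same as a choice of values on cells compatible with
-- boundaries (`evalL_diff`, `map_basis_eq_eval`). Sending each cell to the morphism under it gives
-- the projection. The property `LiftsBoundaries` (given a cycle `z` and `a` with `G z = d a`, some
-- `l` satisfies `d l = z` and `G l = a`) says that a functor is surjective and a quasi-isomorphism
-- on morphisms. The projection has it because of its cells, and for any other `G` with this
-- property functors lift along `G` cell by cell (`exists_cm_lift`).
--
-- The differential strictly lowers a weight on trees. Hence homotopies out of the morphism
-- complexes can be constructed, and lifted along surjective quasi-isomorphisms, by recursion on the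
-- weight (`exists_homotopy`). With zero base this gives h-projectivity; with the projection as base
-- it lifts the homotopies in the definition of a unital category. Cohomological identities are
-- transported in both directions by `LiftsBoundaries`.

-- Linear maps on free modules, one basis element at a time

theorem Finsupp.linearMap_mem_of_mem_supported {α R N : Type*} [CommRing R] [AddCommGroup N]
    [Module R N] (f : (α →₀ R) →ₗ[R] N) (M : Submodule R N) (s : Set α)
    (h : ∀ a ∈ s, f (Finsupp.single a 1) ∈ M) (v : α →₀ R) (hv : v ∈ Finsupp.supported R R s) :
    f v ∈ M := by
  have : Finsupp.supported R R s ≤ M.comap f := by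
    rw [Finsupp.supported_eq_span_single, Submodule.span_le]
    rintro _ ⟨a, ha, rfl⟩
    exact h a ha
  exact this hv

theorem Finsupp.linearMap_ext_single {α R N : Type*} [CommRing R] [AddCommGroup N]
    [Module R N] {f g : (α →₀ R) →ₗ[R] N}
    (h : ∀ a, f (Finsupp.single a 1) = g (Finsupp.single a 1)) : f = g :=
  Finsupp.lhom_ext' fun a => LinearMap.ext_ring (h a)

theorem Finsupp.linearMap_mem_of_single {α R N : Type*} [CommRing R] [AddCommGroup N]
    [Module R N] (f : (α →₀ R) →ₗ[R] N) (M : Submodule R N) (v : α →₀ R)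
    (h : ∀ a ∈ v.support, f (Finsupp.single a 1) ∈ M) : f v ∈ M :=
  Finsupp.linearMap_mem_of_mem_supported f M v.support h v
    ((Finsupp.mem_supported R v).2 subset_rfl)

/-- Restricting to the support lets degree conditions, known only for the terms that occur, be used
term by term. -/
theorem Finsupp.linearMap_eq_of_single {α R N : Type*} [CommRing R] [AddCommGroup N]
    [Module R N] (f g : (α →₀ R) →ₗ[R] N) (v : α →₀ R)
    (h : ∀ a ∈ v.support, f (Finsupp.single a 1) = g (Finsupp.single a 1)) : f v = g v := by
  have := Finsupp.linearMap_mem_of_single (f - g) ⊥ v (fun a ha => by simp [h a ha])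
  simpa [sub_eq_zero] using this

theorem Int.map_negOnePow_smul {R M N : Type*} [Ring R] [AddCommGroup M] [AddCommGroup N]
    [Module R M] [Module R N] (f : M →ₗ[R] N) (n : ℤ) (v : M) :
    f (n.negOnePow • v) = n.negOnePow • f v := by
  rw [Units.smul_def, Units.smul_def, map_zsmul]

theorem Int.negOnePow_add_one (n : ℤ) : (n + 1).negOnePow = -n.negOnePow := by
  rw [Int.negOnePow_succ]

-- The tensor coalgebra of a quiver: concatenation and cuts of strings

namespace Chain

variable {R : Type u} [CommRing R] {Ob : Type u} {E : Ob → Ob → Type u}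

theorem append_assoc {x y z w : Ob} (p : Chain E x y) (q : Chain E y z) (r : Chain E z w) :
    (p.append q).append r = p.append (q.append r) := by
  induction r with
  | nil => rfl
  | cons r f ih => simp only [append, ih]

theorem nil_append {x y : Ob} (p : Chain E x y) : (nil x).append p = p := by
  induction p with
  | nil => rfl
  | cons r f ih => simp only [append, ih]

theorem length_append {x y z : Ob} (p : Chain E x y) (q : Chain E y z) :
    (p.append q).length = p.length + q.length := by
  induction q with
  | nil => rfl
  | cons r f ih => simp only [append, length, ih]; omega

theorem append_of_mem_splits {x y : Ob} (w : Chain E x y) (s : Σ z : Ob, Chain E x z × Chain E z y)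
    (hs : s ∈ w.splits) : s.2.1.append s.2.2 = w := by
  induction w with
  | nil =>
    simp only [splits, List.mem_singleton] at hs
    subst hs; rfl
  | cons p f ih =>
    simp only [splits, List.mem_append, List.mem_map, List.mem_singleton] at hs
    obtain ⟨s', hs', rfl⟩ | rfl := hs
    · simp only [append, ih s' hs']
    · rfl

/-- The bilinear extension of the concatenation of strings. -/
noncomputable def conc {x y z : Ob} :
    (Chain E x y →₀ R) →ₗ[R] (Chain E y z →₀ R) →ₗ[R] (Chain E x z →₀ R) :=
  Finsupp.linearCombination R fun p => Finsupp.lmapDomain R R p.append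

theorem conc_single {x y z : Ob} (p : Chain E x y) (q : Chain E y z) :
    conc (Finsupp.single p (1 : R)) (Finsupp.single q 1) = Finsupp.single (p.append q) 1 := by
  simp [conc]

variable (R E) in
/-- The empty string. -/
noncomputable def one (x : Ob) : Chain E x x →₀ R := Finsupp.single (nil x) 1

theorem conc_one {x y : Ob} (u : Chain E x y →₀ R) : conc u (one R E y) = u := by
  refine LinearMap.congr_fun (f := conc.flip (one R E y)) (g := LinearMap.id)
    (Finsupp.linearMap_ext_single fun p => ?_) u
  simp [one, conc_single, append]

theorem one_conc {x y : Ob} (u : Chain E x y →₀ R) : conc (one R E x) u = u := by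
  refine LinearMap.congr_fun (f := conc (one R E x)) (g := LinearMap.id)
    (Finsupp.linearMap_ext_single fun p => ?_) u
  simp [one, conc_single, nil_append]

theorem conc_assoc {x y z w : Ob} (a : Chain E x y →₀ R) (b : Chain E y z →₀ R)
    (c : Chain E z w →₀ R) : conc (conc a b) c = conc a (conc b c) := by
  induction a using Finsupp.induction_linear with
  | zero => simp
  | add a a' h h' => simp [h, h']
  | single p r =>
  induction b using Finsupp.induction_linear with
  | zero => simp
  | add a a' h h' => simp [h, h']
  | single q r' =>
  induction c using Finsupp.induction_linear with
  | zero => simp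
  | add a a' h h' => simp [h, h']
  | single s r'' =>
    simp only [conc, Finsupp.linearCombination_single, Finsupp.lmapDomain_apply,
      LinearMap.smul_apply, Finsupp.mapDomain_single, Finsupp.smul_single, append_assoc,
      smul_eq_mul, mul_assoc]

/-- The linear extension of the inclusion of strings with one edge. -/
noncomputable def ι {x y : Ob} : (E x y →₀ R) →ₗ[R] (Chain E x y →₀ R) :=
  Finsupp.lmapDomain R R single

theorem ι_single {x y : Ob} (f : E x y) :
    ι (Finsupp.single f (1 : R)) = Finsupp.single (single f) 1 := by
  simp [ι]

theorem conc_ι_single {x y z : Ob} (p : Chain E x y) (f : E y z) :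
    conc (Finsupp.single p (1 : R)) (ι (Finsupp.single f 1)) = Finsupp.single (p.cons f) 1 := by
  rw [ι_single, conc_single]; rfl

variable (R) in
/-- The component on strings of one edge, on the basis of strings. -/
noncomputable def edge : ∀ {x y : Ob}, Chain E x y → (E x y →₀ R)
  | _, _, nil _ => 0
  | _, _, cons (nil _) f => Finsupp.single f 1
  | _, _, cons (cons _ _) _ => 0

/-- The projection to strings of one edge. -/
noncomputable def π {x y : Ob} : (Chain E x y →₀ R) →ₗ[R] (E x y →₀ R) :=
  Finsupp.linearCombination R (edge R)

theorem π_single {x y : Ob} (w : Chain E x y) : π (Finsupp.single w (1 : R)) = edge R w := by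
  simp [π]

theorem edge_eq_zero {x y : Ob} (w : Chain E x y) (h : w.length ≠ 1) : edge R w = 0 := by
  match w with
  | nil _ => rfl
  | cons (nil _) f => simp [length] at h
  | cons (cons _ _) _ => rfl

theorem π_ι {x y : Ob} (v : E x y →₀ R) : π (ι v) = v := by
  refine LinearMap.congr_fun (f := π.comp ι) (g := LinearMap.id)
    (Finsupp.linearMap_ext_single fun p => ?_) v
  simp [ι_single, π_single, single, edge]

section Splits

variable {N : Type u} [AddCommGroup N] [Module R N] {x : Ob}

/-- The linear extension of the sum of `Φ p q` over all the ways of cutting a string into `p`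
and `q`. -/
noncomputable def cut {y : Ob} (Φ : ∀ z, (Chain E x z →₀ R) →ₗ[R] (Chain E z y →₀ R) →ₗ[R] N) :
    (Chain E x y →₀ R) →ₗ[R] N :=
  Finsupp.linearCombination R fun w =>
    (w.splits.map fun s => Φ s.1 (Finsupp.single s.2.1 1) (Finsupp.single s.2.2 1)).sum

theorem cut_single {y : Ob} (Φ : ∀ z, (Chain E x z →₀ R) →ₗ[R] (Chain E z y →₀ R) →ₗ[R] N)
    (w : Chain E x y) : cut Φ (Finsupp.single w 1) =
      (w.splits.map fun s => Φ s.1 (Finsupp.single s.2.1 1) (Finsupp.single s.2.2 1)).sum := by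
  simp [cut]

theorem cut_one (Φ : ∀ z, (Chain E x z →₀ R) →ₗ[R] (Chain E z x →₀ R) →ₗ[R] N) :
    cut Φ (one R E x) = Φ x (one R E x) (one R E x) := by
  simp [one, cut_single, splits]

theorem cut_ext {y : Ob} {Φ Φ' : ∀ z, (Chain E x z →₀ R) →ₗ[R] (Chain E z y →₀ R) →ₗ[R] N}
    (h : ∀ z p q, Φ z p q = Φ' z p q) : cut Φ = cut Φ' := by
  congr
  ext z : 1
  exact LinearMap.ext₂ (h z)

theorem cut_add {y : Ob} (Φ Φ' : ∀ z, (Chain E x z →₀ R) →ₗ[R] (Chain E z y →₀ R) →ₗ[R] N) :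
    cut (fun z => Φ z + Φ' z) = cut Φ + cut Φ' := by
  refine Finsupp.linearMap_ext_single fun p => ?_
  simp [cut_single]

theorem cut_smul {y : Ob} (r : R)
    (Φ : ∀ z, (Chain E x z →₀ R) →ₗ[R] (Chain E z y →₀ R) →ₗ[R] N) :
    cut (fun z => r • Φ z) = r • cut Φ := by
  refine Finsupp.linearMap_ext_single fun p => ?_
  simp [cut_single, List.smul_sum, Function.comp_def]

theorem cut_zero {y : Ob} :
    cut (fun z => (0 : (Chain E x z →₀ R) →ₗ[R] (Chain E z y →₀ R) →ₗ[R] N)) = 0 := by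
  refine Finsupp.linearMap_ext_single fun p => ?_
  simp [cut_single]

theorem cut_conc_single {y z : Ob} (Φ : ∀ a, (Chain E x a →₀ R) →ₗ[R] (Chain E a z →₀ R) →ₗ[R] N)
    (u : Chain E x y →₀ R) (f : E y z) :
    cut Φ (conc u (ι (Finsupp.single f 1))) =
      cut (fun a => (Φ a).compl₂ (conc.flip (ι (Finsupp.single f 1)))) u +
        Φ z (conc u (ι (Finsupp.single f 1))) (one R E z) := by
  refine LinearMap.congr_fun (f := (cut Φ).comp (conc.flip (ι (Finsupp.single f 1))))
    (g := cut (fun a => (Φ a).compl₂ (conc.flip (ι (Finsupp.single f 1)))) +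
      ((Φ z).flip (one R E z)).comp (conc.flip (ι (Finsupp.single f 1))))
    (Finsupp.linearMap_ext_single fun p => ?_) u
  simp [cut_single, conc_ι_single, splits, one, Function.comp_def]

/-- A cut of a string ending in `f` either has `f` in its second part or has an empty second part.
This recursion in the last letter drives the inductions about coderivations. -/
theorem cut_conc {y z : Ob} (Φ : ∀ a, (Chain E x a →₀ R) →ₗ[R] (Chain E a z →₀ R) →ₗ[R] N)
    (u : Chain E x y →₀ R) (f : E y z →₀ R) :
    cut Φ (conc u (ι f)) =
      cut (fun a => (Φ a).compl₂ (conc.flip (ι f))) u + Φ z (conc u (ι f)) (one R E z) := by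
  induction f using Finsupp.induction_linear with
  | zero =>
    have : cut (fun a => (Φ a).compl₂ (conc.flip (ι (0 : E y z →₀ R)))) = 0 :=
      (cut_ext (fun z p q => by simp)).trans cut_zero
    rw [this]
    simp only [map_zero, LinearMap.zero_apply, add_zero]
  | add f g hf hg =>
    rw [cut_ext (Φ' := fun a => (Φ a).compl₂ (conc.flip (ι f)) + (Φ a).compl₂ (conc.flip (ι g)))
      (fun z p q => by simp), cut_add, map_add, map_add, map_add, hf, hg]
    simp only [map_add, LinearMap.add_apply]
    abel
  | single f r =>
    have hr : Finsupp.single f r = r • Finsupp.single f (1 : R) := by simp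
    rw [hr, cut_ext (Φ' := fun a => r • (Φ a).compl₂ (conc.flip (ι (Finsupp.single f 1))))
      (fun z p q => by simp only [map_smul, LinearMap.compl₂_apply, LinearMap.smul_apply,
        LinearMap.flip_apply]), cut_smul]
    simp only [map_smul, cut_conc_single, LinearMap.smul_apply, smul_add]

theorem cut_cons {y z : Ob} (Φ : ∀ a, (Chain E x a →₀ R) →ₗ[R] (Chain E a z →₀ R) →ₗ[R] N)
    (w : Chain E x y) (f : E y z) :
    cut Φ (Finsupp.single (w.cons f) 1) =
      cut (fun a => (Φ a).compl₂ (conc.flip (ι (Finsupp.single f 1)))) (Finsupp.single w 1) +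
        Φ z (Finsupp.single (w.cons f) 1) (one R E z) := by
  rw [← conc_ι_single, cut_conc]

theorem cut_mem {y : Ob} (Φ : ∀ z, (Chain E x z →₀ R) →ₗ[R] (Chain E z y →₀ R) →ₗ[R] N)
    (w : Chain E x y) (M : Submodule R N)
    (h : ∀ z (p : Chain E x z) (q : Chain E z y), p.append q = w →
      Φ z (Finsupp.single p 1) (Finsupp.single q 1) ∈ M) :
    cut Φ (Finsupp.single w 1) ∈ M := by
  rw [cut_single]
  refine list_sum_mem fun n hn => ?_
  obtain ⟨s, hs, rfl⟩ := List.mem_map.1 hn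
  exact h _ _ _ (append_of_mem_splits w s hs)

theorem cut_congr {y : Ob} (Φ Φ' : ∀ z, (Chain E x z →₀ R) →ₗ[R] (Chain E z y →₀ R) →ₗ[R] N)
    (w : Chain E x y)
    (h : ∀ z (p : Chain E x z) (q : Chain E z y), p.append q = w →
      Φ z (Finsupp.single p 1) (Finsupp.single q 1) =
        Φ' z (Finsupp.single p 1) (Finsupp.single q 1)) :
    cut Φ (Finsupp.single w 1) = cut Φ' (Finsupp.single w 1) := by
  rw [cut_single, cut_single]
  refine congrArg List.sum (List.map_congr_left fun s hs => ?_)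
  exact h _ _ _ (append_of_mem_splits w s hs)

theorem comp_cut {y : Ob} {N' : Type u} [AddCommGroup N'] [Module R N'] (g : N →ₗ[R] N')
    (Φ : ∀ z, (Chain E x z →₀ R) →ₗ[R] (Chain E z y →₀ R) →ₗ[R] N) (w : Chain E x y →₀ R) :
    g (cut Φ w) = cut (fun z => (Φ z).compr₂ g) w := by
  refine LinearMap.congr_fun (f := g.comp (cut Φ)) (Finsupp.linearMap_ext_single fun p => ?_) w
  simp only [LinearMap.comp_apply, cut_single, map_list_sum, List.map_map, Function.comp_def,
    LinearMap.compr₂_apply]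

end Splits

end Chain

-- Odd coderivations of the tensor coalgebra and their squares

namespace Chain

variable {R : Type u} [CommRing R] {Ob : Type u} {E : Ob → Ob → Type u}

/-- The sum over all cuts into three parts does not depend on which cut is made first. -/
theorem splits_coassoc {N : Type u} [AddCommGroup N] {x y : Ob} (w : Chain E x y)
    (Ω : ∀ a b, Chain E x a → Chain E a b → Chain E b y → N) :
    (w.splits.map fun s => (s.2.1.splits.map fun t => Ω t.1 s.1 t.2.1 t.2.2 s.2.2).sum).sum =
      (w.splits.map fun s => (s.2.2.splits.map fun t => Ω s.1 t.1 s.2.1 t.2.1 t.2.2).sum).sum := by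
  induction w with
  | nil => rfl
  | cons p f ih =>
    simp only [splits, List.map_append, List.map_map, List.sum_append, List.map_cons, List.map_nil,
      List.sum_cons, List.sum_nil, add_zero, Function.comp_def, List.sum_map_add,
      ih (fun a b p q r => Ω a b p q (r.cons f)), List.sum_map_add]
    abel

section Sign

variable (sd : ∀ x y : Ob, E x y → ℤ)

/-- The sum of the degrees of the edges of a string. -/
def sumDeg : ∀ {x y : Ob}, Chain E x y → ℤ
  | _, _, nil _ => 0
  | _, _, cons p f => sumDeg p + sd _ _ f

theorem sumDeg_append {x y z : Ob} (p : Chain E x y) (q : Chain E y z) :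
    sumDeg sd (p.append q) = sumDeg sd p + sumDeg sd q := by
  induction q with
  | nil => simp [append, sumDeg]
  | cons q f ih => simp only [append, sumDeg, ih, add_assoc]

/-- The sign operator of the grading. -/
noncomputable def sgn {x y : Ob} : (Chain E x y →₀ R) →ₗ[R] (Chain E x y →₀ R) :=
  Finsupp.linearCombination R fun w => (sumDeg sd w).negOnePow • Finsupp.single w 1

theorem sgn_single {x y : Ob} (w : Chain E x y) :
    sgn sd (Finsupp.single w (1 : R)) = (sumDeg sd w).negOnePow • Finsupp.single w 1 := by
  simp [sgn]

theorem sgn_sgn {x y : Ob} (u : Chain E x y →₀ R) : sgn sd (sgn sd u) = u := by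
  refine LinearMap.congr_fun (f := (sgn sd).comp (sgn sd)) (g := LinearMap.id)
    (Finsupp.linearMap_ext_single fun p => ?_) u
  rw [LinearMap.comp_apply, sgn_single, Int.map_negOnePow_smul, sgn_single, smul_smul,
    ← Int.negOnePow_add, Int.negOnePow_even _ (by simp), one_smul, LinearMap.id_apply]

theorem sgn_one {x : Ob} : sgn sd (one R E x) = one R E x := by
  rw [one, sgn_single]
  simp [sumDeg]

theorem sgn_conc {x y z : Ob} (u : Chain E x y →₀ R) (v : Chain E y z →₀ R) :
    sgn sd (conc u v) = conc (sgn sd u) (sgn sd v) := by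
  refine LinearMap.congr_fun₂ (f := conc.compr₂ (sgn sd)) (g := conc.compl₁₂ (sgn sd) (sgn sd))
    (Finsupp.linearMap_ext_single fun p => Finsupp.linearMap_ext_single fun q => ?_) u v
  simp only [LinearMap.compr₂_apply, LinearMap.compl₁₂_apply, conc_single, sgn_single,
    Int.map_negOnePow_smul, sumDeg_append, Int.negOnePow_add, mul_smul]
  simp only [Units.smul_def, map_zsmul, LinearMap.smul_apply, conc_single]
  rw [smul_comm]

theorem cut_sgn {N : Type u} [AddCommGroup N] [Module R N] {x y : Ob}
    (Φ : ∀ z, (Chain E x z →₀ R) →ₗ[R] (Chain E z y →₀ R) →ₗ[R] N) (u : Chain E x y →₀ R) :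
    cut Φ (sgn sd u) = cut (fun z => (Φ z).compl₁₂ (sgn sd) (sgn sd)) u := by
  refine LinearMap.congr_fun (f := (cut Φ).comp (sgn sd))
    (Finsupp.linearMap_ext_single fun p => ?_) u
  rw [LinearMap.comp_apply, sgn_single, Int.map_negOnePow_smul, cut_single, cut_single,
    List.smul_sum, List.map_map]
  refine congrArg List.sum (List.map_congr_left fun s hs => ?_)
  rw [Function.comp_apply, LinearMap.compl₁₂_apply, sgn_single, sgn_single,
    ← append_of_mem_splits p s hs, sumDeg_append, Int.negOnePow_add, mul_smul,
    Int.map_negOnePow_smul, Units.smul_def, Units.smul_def, Units.smul_def, Units.smul_def,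
    map_zsmul, LinearMap.smul_apply, smul_comm]

variable (φ : ∀ x y : Ob, Chain E x y → (E x y →₀ R))

/-- The sum of `± p · φ(q)` over all the ways of cutting a string into `p` and `q`. -/
noncomputable def coderTail {x y : Ob} : (Chain E x y →₀ R) →ₗ[R] (Chain E x y →₀ R) :=
  cut fun _ => conc.compl₁₂ (sgn sd) (ι.comp (Finsupp.linearCombination R (φ _ _)))

/-- The sum of `± p · φ(r) · q` over all the ways of cutting a string into `p`, `r` and `q`: the
odd coderivation of the tensor coalgebra with corestriction `φ`. -/
noncomputable def coder {x y : Ob} : (Chain E x y →₀ R) →ₗ[R] (Chain E x y →₀ R) :=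
  cut fun _ => conc.comp (coderTail sd φ)

/-- In a term `p · φ(r) · q`, either `q` is nonempty and keeps the last letter, or `q` is empty; the
latter terms form `coderTail`. -/
theorem coder_conc {x y z : Ob} (u : Chain E x y →₀ R) (f : E y z →₀ R) :
    coder sd φ (conc u (ι f)) =
      conc (coder sd φ u) (ι f) + coderTail sd φ (conc u (ι f)) := by
  rw [coder, cut_conc, LinearMap.comp_apply, conc_one]
  congr 1
  refine Eq.trans ?_ (comp_cut (conc.flip (ι f)) _ u).symm
  exact LinearMap.congr_fun (cut_ext fun z p q => by simp [conc_assoc]) u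

theorem coder_cons {x y z : Ob} (w : Chain E x y) (f : E y z) :
    coder sd φ (Finsupp.single (w.cons f) 1) =
      conc (coder sd φ (Finsupp.single w 1)) (ι (Finsupp.single f 1)) +
        coderTail sd φ (Finsupp.single (w.cons f) 1) := by
  rw [← conc_ι_single, coder_conc]

/-- Induction principle for the terms of a coderivation. -/
theorem coder_mem {N : Type u} [AddCommGroup N] [Module R N] {x y : Ob} (w : Chain E x y)
    (g : (Chain E x y →₀ R) →ₗ[R] N) (M : Submodule R N)
    (h : ∀ a b (p : Chain E x a) (r : Chain E a b) (q : Chain E b y), (p.append r).append q = w →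
      ∀ t ∈ (φ _ _ r).support, g (Finsupp.single ((p.cons t).append q) 1) ∈ M) :
    g (coder sd φ (Finsupp.single w 1)) ∈ M := by
  rw [coder, comp_cut]
  refine cut_mem _ _ _ fun b p' q hw => ?_
  rw [LinearMap.compr₂_apply, LinearMap.comp_apply, coderTail]
  refine (comp_cut (g.comp (conc.flip (Finsupp.single q 1))) _ _).symm ▸
    cut_mem _ _ M fun a p r hp => ?_
  rw [LinearMap.compr₂_apply, LinearMap.compl₁₂_apply, sgn_single, Units.smul_def, map_zsmul,
    LinearMap.smul_apply, map_zsmul]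
  refine zsmul_mem ?_ _
  refine Finsupp.linearMap_mem_of_single (((g.comp (conc.flip (Finsupp.single q 1))).comp
    (conc (Finsupp.single p 1))).comp ι) M
    (Finsupp.linearCombination R (φ _ _) (Finsupp.single r 1)) ?_
  intro t ht
  simp only [LinearMap.comp_apply, LinearMap.flip_apply, conc_ι_single, conc_single]
  exact h a b p r q (hp ▸ hw) t (by simpa using ht)

variable (h0 : ∀ x, φ x x (nil x) = 0)
include h0

theorem coderTail_one {x : Ob} : coderTail sd φ (one R E x) = 0 := by
  rw [coderTail, cut_one, LinearMap.compl₁₂_apply, one, LinearMap.comp_apply]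
  simp [h0]

theorem coder_one {x : Ob} : coder sd φ (one R E x) = 0 := by
  rw [coder, cut_one, LinearMap.comp_apply, conc_one, coderTail_one sd φ h0]

omit h0 in
-- The letter `φ(r)` comes last in `p · φ(r)`, so it lies in the second part of a cut unless that
-- part is empty. The cuts of `p` become cuts of the whole string by coassociativity.
theorem cut_coderTail {N : Type u} [AddCommGroup N] [Module R N] {x y : Ob}
    (Φ : ∀ z, (Chain E x z →₀ R) →ₗ[R] (Chain E z y →₀ R) →ₗ[R] N) (u : Chain E x y →₀ R) :
    cut Φ (coderTail sd φ u) = cut (fun z => (Φ z).compl₁₂ (sgn sd) (coderTail sd φ)) u +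
      Φ y (coderTail sd φ u) (one R E y) := by
  refine LinearMap.congr_fun (f := (cut Φ).comp (coderTail sd φ))
    (g := cut (fun z => (Φ z).compl₁₂ (sgn sd) (coderTail sd φ)) +
      ((Φ y).flip (one R E y)).comp (coderTail sd φ))
    (Finsupp.linearMap_ext_single fun w => ?_) u
  have h1 : ∀ s : (Σ z : Ob, Chain E x z × Chain E z y),
      cut Φ (conc (sgn sd (Finsupp.single s.2.1 1)) (ι (φ _ _ s.2.2))) =
        (s.2.1.splits.map fun t => Φ t.1 (sgn sd (Finsupp.single t.2.1 1))
          (conc (sgn sd (Finsupp.single t.2.2 1)) (ι (φ _ _ s.2.2)))).sum +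
        Φ y (conc (sgn sd (Finsupp.single s.2.1 1)) (ι (φ _ _ s.2.2))) (one R E y) := by
    intro s
    rw [cut_conc, cut_sgn, cut_single]
    rfl
  rw [LinearMap.add_apply, LinearMap.comp_apply, LinearMap.comp_apply, LinearMap.flip_apply]
  have h2 : coderTail sd φ (Finsupp.single w 1) = (w.splits.map fun s =>
      conc (sgn sd (Finsupp.single s.2.1 1)) (ι (φ _ _ s.2.2))).sum := by
    simp [coderTail, cut_single]
  have h3 := splits_coassoc w fun a b p q r => Φ a (sgn sd (Finsupp.single p 1))
          (conc (sgn sd (Finsupp.single q 1)) (ι (φ _ _ r)))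
  have h4 : Φ y (coderTail sd φ (Finsupp.single w 1)) (one R E y) =
      (w.splits.map fun s =>
        Φ y (conc (sgn sd (Finsupp.single s.2.1 1)) (ι (φ _ _ s.2.2))) (one R E y)).sum := by
    rw [h2, ← LinearMap.flip_apply, map_list_sum, List.map_map]
    rfl
  rw [h4, h2, map_list_sum, List.map_map, Function.comp_def]
  simp only [h1, List.sum_map_add, h3]
  congr 1
  rw [cut_single]
  refine congrArg List.sum (List.map_congr_left fun s hs => ?_)
  rw [LinearMap.compl₁₂_apply, coderTail, cut_single, map_list_sum, List.map_map]
  simp [Function.comp_def]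

/-- A coderivation is compatible with the coproduct given by the cuts of strings. -/
theorem cut_coder {N : Type u} [AddCommGroup N] [Module R N] {x y : Ob}
    (Φ : ∀ z, (Chain E x z →₀ R) →ₗ[R] (Chain E z y →₀ R) →ₗ[R] N) (u : Chain E x y →₀ R) :
    cut Φ (coder sd φ u) = cut (fun z => (Φ z).comp (coder sd φ)) u +
      cut (fun z => (Φ z).compl₁₂ (sgn sd) (coder sd φ)) u := by
  refine LinearMap.congr_fun (f := (cut Φ).comp (coder sd φ))
    (g := cut (fun z => (Φ z).comp (coder sd φ)) +
      cut (fun z => (Φ z).compl₁₂ (sgn sd) (coder sd φ)))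
    (Finsupp.linearMap_ext_single fun w => ?_) u
  rw [LinearMap.add_apply, LinearMap.comp_apply]
  induction w with
  | nil =>
    have := coder_one sd φ h0 (x := x)
    rw [← one, this, cut_one, cut_one]
    simp [this]
  | cons w f ih =>
    rw [coder_cons, map_add, cut_conc, ih _ (Finsupp.single w 1), cut_coderTail, cut_cons,
      cut_cons, cut_cons]
    have e : cut (fun a => ((Φ a).compl₁₂ (sgn sd) (coder sd φ)).compl₂
          (conc.flip (ι (Finsupp.single f 1)))) (Finsupp.single w 1) =
        cut (fun z => ((Φ z).compl₂ (conc.flip (ι (Finsupp.single f 1)))).compl₁₂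
          (sgn sd) (coder sd φ)) (Finsupp.single w 1) +
        cut (fun a => ((Φ a).compl₁₂ (sgn sd) (coderTail sd φ)).compl₂
          (conc.flip (ι (Finsupp.single f 1)))) (Finsupp.single w 1) := by
      rw [← LinearMap.add_apply, ← cut_add]
      exact LinearMap.congr_fun (cut_ext fun z p q => by simp [coder_conc]) _
    rw [e]
    simp only [LinearMap.compl₁₂_apply, coder_one sd φ h0, coderTail_one sd φ h0,
      LinearMap.comp_apply, coder_cons, map_add, map_zero, add_zero, LinearMap.add_apply]
    have e2 : cut (fun a => (Φ a ∘ₗ coder sd φ).compl₂ (conc.flip (ι (Finsupp.single f 1)))) =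
        cut (fun a => ((Φ a).compl₂ (conc.flip (ι (Finsupp.single f 1)))) ∘ₗ coder sd φ) :=
      cut_ext fun z p q => by simp
    rw [e2]
    abel

variable (hφ : ∀ (x y : Ob) (w : Chain E x y), ∀ t ∈ (φ x y w).support, sd x y t = sumDeg sd w + 1)
include hφ

omit h0 in
-- By `hφ` the map `φ` is odd, so it anticommutes with the sign operator.
theorem sgn_ι_linearCombination {x y : Ob} (u : Chain E x y →₀ R) :
    sgn sd (ι (Finsupp.linearCombination R (φ _ _) u)) =
      -ι (Finsupp.linearCombination R (φ _ _) (sgn sd u)) := by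
  refine LinearMap.congr_fun
    (f := (sgn sd).comp (ι.comp (Finsupp.linearCombination R (φ _ _))))
    (g := -(ι.comp ((Finsupp.linearCombination R (φ _ _)).comp (sgn sd))))
    (Finsupp.linearMap_ext_single fun w => ?_) u
  simp only [LinearMap.comp_apply, LinearMap.neg_apply, sgn_single, Int.map_negOnePow_smul,
    Finsupp.linearCombination_single, one_smul]
  have := Finsupp.linearMap_eq_of_single ((sgn sd).comp ι)
    ((-(sumDeg sd w).negOnePow.val) • ι) (φ _ _ w) (fun t ht => by
      rw [LinearMap.comp_apply, ι_single, sgn_single, LinearMap.smul_apply, ι_single,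
        single, sumDeg, sumDeg, zero_add, hφ _ _ w t ht, Int.negOnePow_succ, Units.smul_def]
      rfl)
  rw [LinearMap.comp_apply] at this
  rw [this, LinearMap.smul_apply, neg_smul, Units.smul_def]

omit h0 in
theorem sgn_coderTail {x y : Ob} (u : Chain E x y →₀ R) :
    sgn sd (coderTail sd φ u) = -coderTail sd φ (sgn sd u) := by
  rw [coderTail, cut_sgn, comp_cut, ← LinearMap.neg_apply, ← neg_one_smul R (cut _), ← cut_smul]
  refine LinearMap.congr_fun (cut_ext fun z p q => ?_) u
  simp only [LinearMap.compr₂_apply, LinearMap.compl₁₂_apply, LinearMap.comp_apply, sgn_conc,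
    sgn_ι_linearCombination sd φ hφ, LinearMap.smul_apply, map_neg, neg_smul, one_smul]

omit h0 in
theorem sgn_coder {x y : Ob} (u : Chain E x y →₀ R) :
    sgn sd (coder sd φ u) = -coder sd φ (sgn sd u) := by
  rw [coder, cut_sgn, comp_cut, ← LinearMap.neg_apply, ← neg_one_smul R (cut _), ← cut_smul]
  refine LinearMap.congr_fun (cut_ext fun z p q => ?_) u
  simp only [LinearMap.compr₂_apply, LinearMap.compl₁₂_apply, LinearMap.comp_apply, sgn_conc,
    sgn_coderTail sd φ hφ, LinearMap.smul_apply, map_neg, neg_smul, one_smul, LinearMap.neg_apply]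

variable (R) in
omit hφ h0 in
theorem linearCombination_one (x : Ob) (h0 : φ x x (nil x) = 0) :
    Finsupp.linearCombination R (φ x x) (one R E x) = 0 := by
  simp [one, h0]

omit hφ in
theorem coderTail_coderTail {x y : Ob} (u : Chain E x y →₀ R) :
    coderTail sd φ (coderTail sd φ u) =
      cut (fun _ => conc.compl₂ ((ι.comp (Finsupp.linearCombination R (φ _ _))).comp
        (coderTail sd φ))) u := by
  refine (cut_coderTail sd φ _ u).trans ?_
  rw [LinearMap.compl₁₂_apply, LinearMap.comp_apply, linearCombination_one R φ _ (h0 _), map_zero,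
    map_zero, add_zero]
  exact LinearMap.congr_fun (cut_ext fun z p q => by simp [sgn_sgn]) _

omit h0 hφ in
theorem coder_coderTail {x y : Ob} (u : Chain E x y →₀ R) :
    coder sd φ (coderTail sd φ u) =
      cut (fun _ => conc.compl₁₂ ((coder sd φ).comp (sgn sd))
        (ι.comp (Finsupp.linearCombination R (φ _ _)))) u +
      coderTail sd φ (coderTail sd φ u) := by
  have h1 : coderTail sd φ (coderTail sd φ u) = _ := comp_cut (coderTail sd φ) _ u
  rw [h1, ← LinearMap.add_apply, ← cut_add]
  refine (comp_cut (coder sd φ) _ u).trans ?_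
  exact LinearMap.congr_fun (cut_ext fun z p q => by simp [coder_conc]) _

/-- The first sum collects the pairs of disjoint insertions. Moving the sign operator past the odd
`coder` gives it the sign opposite to that of its counterpart in `coder_coderTail`, so the two
cancel in the square. -/
theorem coderTail_conc_coder {x y z : Ob} (u : Chain E x y →₀ R) (f : E y z →₀ R) :
    coderTail sd φ (conc (coder sd φ u) (ι f)) =
      -cut (fun _ => (conc.compl₁₂ ((coder sd φ).comp (sgn sd))
        (ι.comp (Finsupp.linearCombination R (φ _ _)))).compl₂ (conc.flip (ι f))) u +
      cut (fun _ => conc.compl₂ ((ι.comp (Finsupp.linearCombination R (φ _ _))).comp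
        ((conc.flip (ι f)).comp (coder sd φ)))) u := by
  rw [coderTail, cut_conc, cut_coder sd φ h0, LinearMap.compl₁₂_apply, LinearMap.comp_apply,
    linearCombination_one R φ _ (h0 _), map_zero, map_zero, add_zero,
    ← LinearMap.neg_apply, ← neg_one_smul R (cut _), ← cut_smul]
  congr 1
  · exact LinearMap.congr_fun (cut_ext fun z p q => by simp [sgn_coder sd φ hφ]) _
  · exact LinearMap.congr_fun (cut_ext fun z p q => by simp [sgn_sgn]) _

/-- The terms of the square of a coderivation that end in the last letter. -/
theorem coder_square_tail {x y z : Ob} (w : Chain E x y) (f : E y z) :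
    coderTail sd φ (conc (coder sd φ (Finsupp.single w 1)) (ι (Finsupp.single f 1))) +
      coder sd φ (coderTail sd φ (Finsupp.single (w.cons f) 1)) =
    cut (fun _ => conc.compl₂ ((ι.comp (Finsupp.linearCombination R (φ _ _))).comp
      (coder sd φ))) (Finsupp.single (w.cons f) 1) := by
  rw [coderTail_conc_coder sd φ h0 hφ, coder_coderTail, coderTail_coderTail sd φ h0,
    cut_cons, cut_cons, cut_cons]
  have h4 : cut (fun a => (conc.compl₂ ((ι.comp (Finsupp.linearCombination R (φ a z))).comp
        (coder sd φ))).compl₂ (conc.flip (ι (Finsupp.single f 1)))) (Finsupp.single w (1 : R)) =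
      cut (fun a => (conc (x := x)).compl₂ ((ι.comp (Finsupp.linearCombination R (φ a z))).comp
        ((conc.flip (ι (Finsupp.single f 1))).comp (coder sd φ)))) (Finsupp.single w 1) +
      cut (fun a => (conc.compl₂ ((ι.comp (Finsupp.linearCombination R (φ a z))).comp
        (coderTail sd φ))).compl₂ (conc.flip (ι (Finsupp.single f 1)))) (Finsupp.single w 1) := by
    rw [← LinearMap.add_apply, ← cut_add]
    exact LinearMap.congr_fun (cut_ext fun z p q => by simp [coder_conc]) _
  rw [h4]
  simp only [LinearMap.compl₁₂_apply, LinearMap.compl₂_apply, LinearMap.comp_apply,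
    linearCombination_one R φ _ (h0 _), coder_one sd φ h0, coderTail_one sd φ h0, map_zero,
    add_zero]
  abel

/-- If the corestriction of the square of a coderivation vanishes on all substrings of `w`, then
so does the square of the coderivation on `w`. -/
theorem coder_coder {x y : Ob} (w : Chain E x y)
    (h : ∀ a b (p : Chain E x a) (r : Chain E a b) (q : Chain E b y), (p.append r).append q = w →
      Finsupp.linearCombination R (φ _ _) (coder sd φ (Finsupp.single r 1)) = 0) :
    coder sd φ (coder sd φ (Finsupp.single w 1)) = 0 := by
  induction w with
  | nil => rw [← one, coder_one sd φ h0, map_zero]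
  | cons w f ih =>
    -- The square on `w · f` is the square on `w` followed by `f`, plus the sum of `p · φ(coder r)`
    -- over the final segments `r` of `w · f`.
    rw [coder_cons, map_add, coder_conc, ih, map_zero, LinearMap.zero_apply, zero_add,
      coder_square_tail sd φ h0 hφ]
    · refine (cut_congr _ _ _ fun a p r hw => ?_).trans
        (LinearMap.congr_fun cut_zero (Finsupp.single (w.cons f) (1 : R)))
      simp [h _ _ p r (nil _) hw]
    · intro a b p r q hw
      exact h a b p r (q.cons f) (by rw [append, hw])

end Sign

end Chain

-- Corestriction of a coderivation, and coderivations extending a differential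

namespace Chain

variable {R : Type u} [CommRing R] {Ob : Type u} {E : Ob → Ob → Type u}

/-- All edges of a string satisfy `P`. -/
def All (P : ∀ x y : Ob, E x y → Prop) : ∀ {x y : Ob}, Chain E x y → Prop
  | _, _, nil _ => True
  | _, _, cons p f => All P p ∧ P _ _ f

theorem all_append (P : ∀ x y : Ob, E x y → Prop) {x y z : Ob} (p : Chain E x y)
    (q : Chain E y z) : (p.append q).All P ↔ p.All P ∧ q.All P := by
  induction q with
  | nil => simp [append, All]
  | cons q f ih => simp only [append, All, ih, and_assoc]

theorem edge_single {x y : Ob} (f : E x y) : edge R (single f) = Finsupp.single f 1 := rfl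

theorem cut_of_nil_left {N : Type u} [AddCommGroup N] [Module R N] {x y : Ob}
    (Φ : ∀ z, (Chain E x z →₀ R) →ₗ[R] (Chain E z y →₀ R) →ₗ[R] N) (w : Chain E x y)
    (h : ∀ z (p : Chain E x z) (q : Chain E z y), p.length ≠ 0 →
      Φ z (Finsupp.single p 1) (Finsupp.single q 1) = 0) :
    cut Φ (Finsupp.single w 1) = Φ x (one R E x) (Finsupp.single w 1) := by
  induction w with
  | nil => exact cut_one Φ
  | cons w f ih =>
    rw [cut_cons, ih, one, one, h _ (w.cons f) _ (by simp [length])]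
    · simp [conc_ι_single]
    · intro z p q hp
      simp [conc_ι_single, h z p _ hp]

theorem π_conc {x y z : Ob} (u : Chain E x y →₀ R) (q : Chain E y z) (hq : q.length ≠ 0)
    (hu : u ∈ Finsupp.supported R R {p | p.length ≠ 0}) :
    π (conc u (Finsupp.single q 1)) = 0 := by
  have := Finsupp.linearMap_mem_of_mem_supported
    (π.comp (conc.flip (Finsupp.single q (1 : R)))) ⊥ _ (fun p hp => ?_) u hu
  · simpa using this
  · simp only [LinearMap.comp_apply, LinearMap.flip_apply, conc_single, π_single]
    rw [edge_eq_zero, Submodule.mem_bot]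
    simp only [Set.mem_ofPred_eq] at hp
    rw [length_append]
    omega

theorem π_conc_ι {x y z : Ob} (p : Chain E x y) (hp : p.length ≠ 0) (v : E y z →₀ R) :
    π (conc (Finsupp.single p 1) (ι v)) = 0 := by
  refine Finsupp.linearMap_eq_of_single ((π.comp (conc (Finsupp.single p (1 : R)))).comp ι) 0 v
    fun t _ => ?_
  simp only [LinearMap.comp_apply, conc_ι_single, π_single]
  rw [edge_eq_zero, LinearMap.zero_apply]
  simpa [length] using hp

variable (sd : ∀ x y : Ob, E x y → ℤ) (φ : ∀ x y : Ob, Chain E x y → (E x y →₀ R))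

theorem coder_single_mem_supported {x y : Ob} (w : Chain E x y) (S : Set (Chain E x y))
    (h : ∀ a b (p : Chain E x a) (r : Chain E a b) (q : Chain E b y), (p.append r).append q = w →
      ∀ t ∈ (φ _ _ r).support, (p.cons t).append q ∈ S) :
    coder sd φ (Finsupp.single w 1) ∈ Finsupp.supported R R S :=
  coder_mem sd φ w LinearMap.id _ fun a b p r q hw t ht =>
    Finsupp.single_mem_supported R 1 (h a b p r q hw t ht)

/-- A term `p · φ(r) · q` has length one only if `p` and `q` are empty, that is, if `r` is the whole
string. -/
theorem π_coder {x y : Ob} (w : Chain E x y) (h0 : ∀ x, φ x x (nil x) = 0) :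
    π (coder sd φ (Finsupp.single w 1)) = φ x y w := by
  cases w with
  | nil =>
    rw [← one, coder_one sd φ h0, map_zero, h0]
  | cons w f =>
    rw [coder_cons, map_add, ι_single, π_conc _ _ (by simp [single, length]), zero_add]
    · rw [coderTail, comp_cut, cut_of_nil_left]
      · simp only [LinearMap.compr₂_apply, LinearMap.compl₁₂_apply, sgn_one, one_conc,
          LinearMap.comp_apply, π_ι, Finsupp.linearCombination_single, one_smul]
      · intro z p q hp
        simp only [LinearMap.compr₂_apply, LinearMap.compl₁₂_apply, LinearMap.comp_apply]
        rw [sgn_single, Units.smul_def, map_zsmul, LinearMap.smul_apply, map_zsmul,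
          π_conc_ι p hp, smul_zero]
    · refine coder_single_mem_supported sd φ w _ fun a b p r q _ t _ => ?_
      simp [length_append, length]

theorem coder_add (ψ : ∀ x y : Ob, Chain E x y → (E x y →₀ R)) {x y : Ob}
    (u : Chain E x y →₀ R) :
    coder sd (fun x y w => φ x y w + ψ x y w) u = coder sd φ u + coder sd ψ u := by
  have h1 : ∀ {x y : Ob} (u : Chain E x y →₀ R),
      Finsupp.linearCombination R (fun w => φ x y w + ψ x y w) u =
      Finsupp.linearCombination R (φ x y) u + Finsupp.linearCombination R (ψ x y) u := by
    intro x y u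
    exact LinearMap.congr_fun (Finsupp.linearMap_ext_single
      (g := Finsupp.linearCombination R (φ x y) + Finsupp.linearCombination R (ψ x y))
      fun p => by simp) u
  have h2 : ∀ {x y : Ob} (u : Chain E x y →₀ R),
      coderTail sd (fun x y w => φ x y w + ψ x y w) u = coderTail sd φ u + coderTail sd ψ u := by
    intro x y u
    rw [coderTail, coderTail, coderTail, ← LinearMap.add_apply, ← cut_add]
    exact LinearMap.congr_fun (cut_ext fun z p q => by simp [h1]) u
  rw [coder, coder, coder, ← LinearMap.add_apply, ← cut_add]
  exact LinearMap.congr_fun (cut_ext fun z p q => by simp [h2]) u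

/-- For `φ` supported on single letters the coderivation is the usual differential of a tensor
product. This is the recursion by which `diffF` is defined later. -/
theorem coder_edge_cons (δ : ∀ x y : Ob, E x y → (E x y →₀ R)) {x y z : Ob} (w : Chain E x y)
    (f : E y z) :
    coder sd (fun x y w => Finsupp.linearCombination R (δ x y) (edge R w))
        (Finsupp.single (w.cons f) 1) =
      conc (coder sd (fun x y w => Finsupp.linearCombination R (δ x y) (edge R w))
        (Finsupp.single w 1)) (ι (Finsupp.single f 1)) +
      (sumDeg sd w).negOnePow • conc (Finsupp.single w 1) (ι (δ y z f)) := by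
  rw [coder_cons]
  congr 1
  rw [coderTail, cut_cons]
  have h1 : ∀ x, Finsupp.linearCombination R
      (fun w => Finsupp.linearCombination R (δ x x) (edge R w)) (one R E x) = 0 := by
    intro x; simp [one, edge]
  simp only [LinearMap.compl₁₂_apply, LinearMap.comp_apply, h1, map_zero, add_zero]
  have h2 : conc (sgn sd (Finsupp.single w (1 : R))) (ι (δ y z f)) =
      (sumDeg sd w).negOnePow • conc (Finsupp.single w 1) (ι (δ y z f)) := by
    rw [sgn_single, Units.smul_def, map_zsmul, Units.smul_def, LinearMap.smul_apply]
  rw [← h2]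
  have h3 : ∀ {a b} (p : Chain E x a) (q : Chain E a b) (f : E b z),
      (conc.compl₁₂ (sgn sd) (ι.comp (Finsupp.linearCombination R
        fun w => Finsupp.linearCombination R (δ a z) (edge R w)))).compl₂
        (conc.flip (ι (Finsupp.single f 1))) (Finsupp.single p (1 : R)) (Finsupp.single q 1) =
      conc (sgn sd (Finsupp.single p 1)) (ι (Finsupp.linearCombination R (δ a z)
        (edge R (q.cons f)))) := by
    intro a b p q f
    simp [conc_ι_single]
  cases w with
  | nil =>
    rw [← one, cut_one, one, h3]
    simp [edge]
  | cons w g =>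
    rw [cut_cons]
    -- A final segment with at least two letters contributes nothing, since `edge` vanishes on it.
    have h4 : cut (fun a => ((conc.compl₁₂ (sgn sd) (ι.comp (Finsupp.linearCombination R
        fun w => Finsupp.linearCombination R (δ a z) (edge R w)))).compl₂
        (conc.flip (ι (Finsupp.single f 1)))).compl₂ (conc.flip (ι (Finsupp.single g 1))))
          (Finsupp.single w (1 : R)) = (0 : Chain E x z →₀ R) := by
      refine (cut_congr _ _ _ fun a p r hw => ?_).trans
        (LinearMap.congr_fun cut_zero (Finsupp.single w (1 : R)))
      rw [LinearMap.compl₂_apply, LinearMap.flip_apply, conc_ι_single, h3]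
      simp [edge]
    rw [h4, zero_add, one, h3]
    simp [edge]

end Chain

-- Trees of cells, their degrees and weights

mutual
/-- The basis of a semi-free resolution: a cell `gen i a n c t` with boundary `∑ c k • t k` lying
over the morphism `a` of degree `i`, or a formal operation applied to a string. -/
inductive CellTree (R : Type u) {Ob : Type u} (H : Ob → Ob → ℤ → Type u) : Ob → Ob → Type u
  | gen {x y : Ob} (i : ℤ) (a : H x y i) (n : ℕ) (c : Fin n → R) (t : Fin n → CellTree R H x y) :
      CellTree R H x y
  | node {x y : Ob} (w : CellForest R H x y) : CellTree R H x y
/-- Composable strings of cell trees. -/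
inductive CellForest (R : Type u) {Ob : Type u} (H : Ob → Ob → ℤ → Type u) : Ob → Ob → Type u
  | nil (x : Ob) : CellForest R H x x
  | cons {x y z : Ob} (p : CellForest R H x y) (f : CellTree R H y z) : CellForest R H x z
end

namespace CellForest

variable {R : Type u} {Ob : Type u} {H : Ob → Ob → ℤ → Type u}

/-- A forest as a string. -/
def toChain : ∀ {x y : Ob}, CellForest R H x y → Chain (CellTree R H) x y
  | _, _, .nil _ => .nil _
  | _, _, .cons p f => (toChain p).cons f

/-- A string of trees as a forest. -/
def ofChain : ∀ {x y : Ob}, Chain (CellTree R H) x y → CellForest R H x y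
  | _, _, .nil _ => .nil _
  | _, _, .cons p f => (ofChain p).cons f

theorem toChain_ofChain {x y : Ob} (w : Chain (CellTree R H) x y) : (ofChain w).toChain = w := by
  induction w with
  | nil => simp only [ofChain, toChain]
  | cons p f ih => simp only [ofChain, toChain, ih]

theorem ofChain_toChain : ∀ {x y : Ob} (w : CellForest R H x y), ofChain w.toChain = w
  | _, _, .nil _ => by simp only [ofChain, toChain]
  | _, _, .cons p f => by simp only [toChain, ofChain, ofChain_toChain p]

end CellForest

namespace CellTree

variable {R : Type u} {Ob : Type u} {H : Ob → Ob → ℤ → Type u}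

/-- The tree whose root carries the string `w`. -/
def graft {x y : Ob} (w : Chain (CellTree R H) x y) : CellTree R H x y :=
  .node (.ofChain w)

/-- The recursor of the mutual inductive types, with forests replaced by strings of trees. -/
theorem induct {P : ∀ x y : Ob, CellTree R H x y → Prop}
    (hgen : ∀ x y i (a : H x y i) n c t, (∀ k, P x y (t k)) → P x y (gen i a n c t))
    (hgraft : ∀ x y (w : Chain (CellTree R H) x y), w.All P → P x y (graft w)) :
    ∀ x y (t : CellTree R H x y), P x y t := by
  intro x y t
  refine CellTree.rec (motive_1 := P) (motive_2 := fun _ _ w => w.toChain.All P)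
    ?_ ?_ ?_ ?_ t
  · intro x y i a n c t h
    exact hgen _ _ i a n c t h
  · intro x y w h
    have := hgraft _ _ _ h
    rwa [graft, CellForest.ofChain_toChain] at this
  · intro x
    simp only [CellForest.toChain, Chain.All]
  · intro x y z p f hp hf
    simp only [CellForest.toChain, Chain.All]
    exact ⟨hp, hf⟩

mutual
/-- The degree of a tree, lowered by one. -/
def sdeg : ∀ x y : Ob, CellTree R H x y → ℤ
  | _, _, .gen i _ _ _ _ => i - 1
  | _, _, .node w => sdegF _ _ w + 1
/-- The total lowered degree of a forest. -/
def sdegF : ∀ x y : Ob, CellForest R H x y → ℤ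
  | _, _, .nil _ => 0
  | _, _, .cons p f => sdegF _ _ p + sdeg _ _ f
end

theorem sdegF_ofChain {x y : Ob} (w : Chain (CellTree R H) x y) :
    sdegF _ _ (.ofChain w) = w.sumDeg sdeg := by
  induction w with
  | nil => simp only [CellForest.ofChain, sdegF, Chain.sumDeg]
  | cons p f ih => simp only [CellForest.ofChain, sdegF, Chain.sumDeg, ih]

theorem sdeg_graft {x y : Ob} (w : Chain (CellTree R H) x y) :
    sdeg x y (graft w) = w.sumDeg sdeg + 1 := by
  rw [graft, sdeg, sdegF_ofChain]

theorem sdeg_gen {x y : Ob} (i : ℤ) (a : H x y i) (n : ℕ) (c : Fin n → R)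
    (t : Fin n → CellTree R H x y) : sdeg x y (gen i a n c t) = i - 1 := by
  rw [sdeg]

mutual
/-- A weight of trees which is lowered by the differential. -/
def wt : ∀ x y : Ob, CellTree R H x y → ℕ
  | _, _, .gen _ _ _ _ t => 1 + ∑ k, wt _ _ (t k)
  -- Each edge contributes its weight plus one, so the subtraction is not truncated for two or more
  -- edges. The shift by two makes a string strictly heavier when a substring of length at least two
  -- is expanded from the single edge that its operation yields.
  | _, _, .node w => wtF _ _ w - 2
/-- The weight of a forest. -/
def wtF : ∀ x y : Ob, CellForest R H x y → ℕ
  | _, _, .nil _ => 0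
  | _, _, .cons p f => wtF _ _ p + (wt _ _ f + 1)
end

/-- The weight of a tree as an edge of a string. -/
def wtEdge (x y : Ob) (t : CellTree R H x y) : ℤ := wt x y t + 1

theorem wtF_ofChain {x y : Ob} (w : Chain (CellTree R H) x y) :
    (wtF _ _ (.ofChain w) : ℤ) = w.sumDeg wtEdge := by
  induction w with
  | nil => simp only [CellForest.ofChain, wtF, Chain.sumDeg, Nat.cast_zero]
  | cons p f ih =>
    simp only [CellForest.ofChain, wtF, Chain.sumDeg, ← ih, wtEdge]; push_cast; ring

theorem length_le_sumDeg_wtEdge {x y : Ob} (w : Chain (CellTree R H) x y) :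
    (w.length : ℤ) ≤ w.sumDeg wtEdge := by
  induction w with
  | nil => simp [Chain.length, Chain.sumDeg]
  | cons p f ih => simp only [Chain.length, Chain.sumDeg, wtEdge]; push_cast; linarith

theorem wt_graft {x y : Ob} (w : Chain (CellTree R H) x y) (hw : 2 ≤ w.length) :
    (wt x y (graft w) : ℤ) = w.sumDeg wtEdge - 2 := by
  have := wtF_ofChain w
  have := length_le_sumDeg_wtEdge w
  rw [graft, wt]
  omega

theorem wt_gen {x y : Ob} (i : ℤ) (a : H x y i) (n : ℕ) (c : Fin n → R)
    (t : Fin n → CellTree R H x y) (k : Fin n) : wt x y (t k) < wt x y (gen i a n c t) := by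
  rw [wt]
  have := Finset.single_le_sum (f := fun k => wt x y (t k)) (fun _ _ => Nat.zero_le _)
    (Finset.mem_univ k)
  omega

/-- The strings of two trees the last of which is a cell. -/
def IsWord : ∀ {x y : Ob}, Chain (CellTree R H) x y → Prop
  | _, _, .cons (.cons (.nil _) _) (.gen _ _ _ _ _) => True
  | _, _, _ => False

theorem isWord_iff {x z : Ob} (w : Chain (CellTree R H) x z) :
    IsWord w ↔ ∃ (y : Ob) (s : CellTree R H x y) (i : ℤ) (a : H y z i) (n : ℕ) (c : Fin n → R)
      (t : Fin n → CellTree R H y z), w = (Chain.single s).cons (gen i a n c t) := by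
  constructor
  · intro h
    match w, h with
    | .cons (.cons (.nil _) s) (.gen i a n c t), _ => exact ⟨_, s, i, a, n, c, t, rfl⟩
  · rintro ⟨y, s, i, a, n, c, t, rfl⟩
    simp only [Chain.single, IsWord]

/-- The strings that may be grafted: those of two trees the last of which is a cell in the
differential graded case, all strings of at least two trees in the `A∞` case. -/
def IsNormal (dg : Bool) {x y : Ob} (w : Chain (CellTree R H) x y) : Prop :=
  match dg with
  | true => IsWord w
  | false => 2 ≤ w.length

theorem IsNormal.two_le {dg : Bool} {x y : Ob} {w : Chain (CellTree R H) x y}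
    (h : IsNormal dg w) : 2 ≤ w.length := by
  cases dg with
  | false => exact h
  | true =>
    obtain ⟨y, s, i, a, n, c, t, rfl⟩ := (isWord_iff w).1 h
    simp [Chain.length, Chain.single]

-- The operations with at least two arguments

variable [CommRing R]

open Classical in
mutual
/-- The product of words in the differential graded case. -/
noncomputable def mul : ∀ y z : Ob, CellTree R H y z → ∀ x : Ob, CellTree R H x y →
    (CellTree R H x z →₀ R)
  | _, _, .gen i a n c s, _, t => .single (graft ((Chain.single t).cons (.gen i a n c s))) 1
  | _, _, .node w, _, t =>
    -- Forced by associativity: the product of `t` with a word `s · c` ending in a cell `c` is, up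
    -- to sign, the word `(t · s) · c`. The value zero concerns only strings that do not occur in
    -- valid trees.
    if IsWord w.toChain then
      (-(sdeg _ _ t).negOnePow) • Finsupp.lmapDomain R R graft (mulF _ _ w _ t)
    else 0
/-- The product with the first letter of a string. -/
noncomputable def mulF : ∀ y z : Ob, CellForest R H y z → ∀ x : Ob, CellTree R H x y →
    (Chain (CellTree R H) x z →₀ R)
  | _, _, .nil _, _, _ => 0
  | _, _, .cons (.nil _) f, _, t => Chain.ι (mul _ _ f _ t)
  | _, _, .cons (.cons p g) f, _, t =>
    Chain.conc (mulF _ _ (.cons p g) _ t) (Chain.ι (Finsupp.single f 1))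
end

theorem mul_gen {x y z : Ob} (i : ℤ) (a : H y z i) (n : ℕ) (c : Fin n → R)
    (s : Fin n → CellTree R H y z) (t : CellTree R H x y) :
    mul y z (gen i a n c s) x t =
      Finsupp.single (graft ((Chain.single t).cons (gen i a n c s))) 1 := by
  rw [mul]

theorem mul_graft_of_not_isWord {x y z : Ob} (w : Chain (CellTree R H) y z) (hw : ¬ IsWord w)
    (t : CellTree R H x y) : mul y z (graft w) x t = 0 := by
  rw [graft, mul, CellForest.toChain_ofChain, if_neg hw]

theorem mul_word {x y y' z : Ob} (s : CellTree R H y y') (i : ℤ) (a : H y' z i) (n : ℕ)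
    (c : Fin n → R) (t' : Fin n → CellTree R H y' z) (t : CellTree R H x y) :
    mul y z (graft ((Chain.single s).cons (gen i a n c t'))) x t =
      (-(sdeg _ _ t).negOnePow) • Finsupp.lmapDomain R R
        (fun r => graft ((Chain.single r).cons (gen i a n c t'))) (mul y y' s x t) := by
  rw [graft, mul, CellForest.toChain_ofChain, if_pos ((isWord_iff _).2 ⟨_, _, _, _, _, _, _, rfl⟩)]
  simp only [Chain.single, CellForest.ofChain, mulF]
  congr 1
  refine LinearMap.congr_fun (f := (Finsupp.lmapDomain R R graft).comp
    ((Chain.conc.flip (Chain.ι (Finsupp.single (gen i a n c t') 1))).comp Chain.ι))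
    (Finsupp.linearMap_ext_single fun r => ?_) _
  simp only [LinearMap.comp_apply, LinearMap.flip_apply, Chain.ι_single r]
  rw [Chain.conc_ι_single, Finsupp.lmapDomain_apply, Finsupp.lmapDomain_apply,
    Finsupp.mapDomain_single, Finsupp.mapDomain_single]
  rfl

theorem mul_support (x y : Ob) (t : CellTree R H x y)
    (P : ∀ z, CellTree R H y z → CellTree R H x z → Prop)
    (h1 : ∀ z i (a : H y z i) n c s, P z (gen i a n c s)
      (graft ((Chain.single t).cons (gen i a n c s))))
    (h2 : ∀ y' z s i (a : H y' z i) n c t' r, P y' s r →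
      P z (graft ((Chain.single s).cons (gen i a n c t')))
        (graft ((Chain.single r).cons (gen i a n c t')))) :
    ∀ z (s : CellTree R H y z), ∀ r ∈ (mul y z s x t).support, P z s r := by
  classical
  -- The object `y` is fixed by `t`, while `induct` needs all the endpoints of `s` to vary.
  suffices h : ∀ y' z (s : CellTree R H y' z), ∀ hy : y' = y,
      ∀ r ∈ (mul y z (hy ▸ s) x t).support, P z (hy ▸ s) r from fun z s => h y z s rfl
  refine induct ?_ ?_
  · rintro _ z i a n c s - rfl r hr
    simp only [mul_gen] at hr
    rw [Finset.mem_singleton.1 (Finsupp.support_single_subset hr)]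
    exact h1 _ _ _ _ _ _
  · rintro _ z w ih rfl r hr
    by_cases hw : IsWord w
    · obtain ⟨y', s, i, a, n, c, t', rfl⟩ := (isWord_iff w).1 hw
      simp only [mul_word] at hr
      rw [Units.smul_def] at hr
      obtain ⟨r', hr', rfl⟩ := Finset.mem_image.1
        (Finsupp.mapDomain_support (Finsupp.support_smul hr))
      simp only [Chain.single, Chain.All] at ih
      exact h2 _ _ _ _ _ _ _ _ _ (ih.1.2 trivial r' hr')
    · simp [mul_graft_of_not_isWord w hw] at hr

/-- The operations with at least two arguments on the basis of trees. -/
noncomputable def op (dg : Bool) (x y : Ob) : Chain (CellTree R H) x y → (CellTree R H x y →₀ R) :=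
  match dg with
  | true => fun w => match w with
    | .cons (.cons (.nil _) t) s => mul _ _ s _ t
    | _ => 0
  | false => fun w => if 2 ≤ w.length then Finsupp.single (graft w) 1 else 0

theorem op_of_length_le_one (dg : Bool) {x y : Ob} (w : Chain (CellTree R H) x y)
    (hw : w.length ≤ 1) : op dg x y w = 0 := by
  cases dg with
  | true =>
    match w, hw with
    | .nil _, _ => rfl
    | .cons (.nil _) _, _ => rfl
    | .cons (.cons _ _) _, h => simp [Chain.length] at h
  | false => exact if_neg (by omega)

theorem op_true_cons {x y z : Ob} (t : CellTree R H x y) (s : CellTree R H y z) :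
    op true x z ((Chain.single t).cons s) = mul y z s x t := rfl

theorem op_true_of_three_le {x y : Ob} (w : Chain (CellTree R H) x y)
    (hw : 3 ≤ w.length) : op true x y w = 0 := by
  match w, hw with
  | .cons (.cons (.cons _ _) _) _, _ => rfl

theorem op_of_isNormal (dg : Bool) {x y : Ob} (w : Chain (CellTree R H) x y)
    (hw : IsNormal dg w) : op dg x y w = Finsupp.single (graft w) 1 := by
  cases dg with
  | false => exact if_pos hw
  | true =>
    obtain ⟨y, s, i, a, n, c, t, rfl⟩ := (isWord_iff w).1 hw
    rw [op_true_cons, mul_gen]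

theorem op_support (dg : Bool) {x y : Ob} (w : Chain (CellTree R H) x y)
    (P : CellTree R H x y → Prop) (h1 : IsNormal dg w → P (graft w))
    (h2 : ∀ z (t : CellTree R H x z) (s : CellTree R H z y), dg = true →
      w = (Chain.single t).cons s → ∀ r ∈ (mul z y s x t).support, P r) :
    ∀ r ∈ (op dg x y w).support, P r := by
  intro r hr
  cases dg with
  | true =>
    cases w with
    | nil => simp [op] at hr
    | cons w s =>
    cases w with
    | nil => simp [op] at hr
    | cons w t =>
    cases w with
    | nil => exact h2 _ t s rfl rfl r hr
    | cons w t' => simp [op] at hr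
  | false =>
    by_cases hw : 2 ≤ w.length
    · rw [show op false x y w = _ from if_pos hw] at hr
      rw [Finset.mem_singleton.1 (Finsupp.support_single_subset hr)]
      exact h1 hw
    · rw [show op false x y w = _ from if_neg hw] at hr
      simp at hr

theorem sdeg_of_mem_support_op (dg : Bool) (x y : Ob) (w : Chain (CellTree R H) x y) :
    ∀ r ∈ (op dg x y w).support, sdeg x y r = w.sumDeg sdeg + 1 := by
  refine op_support dg w _ (fun _ => sdeg_graft w) ?_
  rintro z t s - rfl
  simp only [Chain.sumDeg, Chain.single, zero_add]
  refine mul_support x z t (fun y s r => sdeg x y r = sdeg x z t + sdeg z y s + 1) ?_ ?_ y s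
  · intro z i a n c s
    rw [sdeg_graft]
    simp [Chain.sumDeg, Chain.single]
  · intro y' z s i a n c t' r h
    rw [sdeg_graft, sdeg_graft]
    simp only [Chain.sumDeg, Chain.single, h]
    ring

theorem wt_of_mem_support_op (dg : Bool) (x y : Ob) (w : Chain (CellTree R H) x y) :
    ∀ r ∈ (op dg x y w).support, (wt x y r : ℤ) + 2 ≤ w.sumDeg wtEdge := by
  refine op_support dg w _ (fun h => by rw [wt_graft w h.two_le]; simp) ?_
  rintro z t s - rfl
  simp only [Chain.sumDeg, Chain.single, zero_add]
  refine mul_support x z t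
    (fun y s r => (wt x y r : ℤ) + 2 ≤ wtEdge x z t + wtEdge z y s) ?_ ?_ y s
  · intro z i a n c s
    rw [wt_graft _ (by simp [Chain.single, Chain.length])]
    simp [Chain.sumDeg, Chain.single]
  · intro y' z s i a n c t' r h
    rw [wtEdge, wtEdge, wt_graft _ (by simp [Chain.single, Chain.length]),
      wt_graft _ (by simp [Chain.single, Chain.length])]
    simp only [wtEdge] at h
    simp only [Chain.sumDeg, Chain.single, wtEdge]
    linarith

-- The differential on trees

open Classical in
mutual
/-- The differential on the basis of trees. -/
noncomputable def diff (dg : Bool) : ∀ x y : Ob, CellTree R H x y → (CellTree R H x y →₀ R)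
  -- Terms of the wrong degree are discarded, so that the differential has degree one on all trees,
  -- valid or not.
  | _, _, .gen i _ _ c t => ∑ k, if sdeg _ _ (t k) = i then Finsupp.single (t k) (c k) else 0
  | x, y, .node w =>
    -- The `A∞`-relation of the string, solved for the differential of its graft. The insertions
    -- that involve `diff` itself are split off as `diffF`, to make the recursion structural.
    if IsNormal dg w.toChain then
      -Finsupp.linearCombination R (op dg x y)
        (Chain.coder sdeg (op dg) (Finsupp.single w.toChain 1) + diffF dg _ _ w)
    else 0
/-- The differential on the tensor products of trees. -/
noncomputable def diffF (dg : Bool) : ∀ x y : Ob, CellForest R H x y →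
    (Chain (CellTree R H) x y →₀ R)
  | _, _, .nil _ => 0
  | _, _, .cons p f => Chain.conc (diffF dg _ _ p) (Chain.ι (Finsupp.single f 1)) +
      (sdegF _ _ p).negOnePow •
        Chain.conc (Finsupp.single p.toChain 1) (Chain.ι (diff dg _ _ f))
end

/-- All the operations on the basis of trees. -/
noncomputable def ops (dg : Bool) (x y : Ob) (w : Chain (CellTree R H) x y) :
    CellTree R H x y →₀ R :=
  op dg x y w + Finsupp.linearCombination R (diff dg x y) (Chain.edge R w)

theorem diffF_ofChain (dg : Bool) {x y : Ob} (w : Chain (CellTree R H) x y) :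
    diffF dg x y (.ofChain w) = Chain.coder sdeg
      (fun x y w => Finsupp.linearCombination R (diff dg x y) (Chain.edge R w))
      (Finsupp.single w 1) := by
  induction w with
  | nil =>
    rw [CellForest.ofChain, diffF, ← Chain.one, Chain.coder_one]
    intro x
    rw [Chain.edge, map_zero]
  | cons p f ih =>
    rw [CellForest.ofChain, diffF, Chain.coder_edge_cons, ih, sdegF_ofChain,
      CellForest.toChain_ofChain]

theorem diff_graft (dg : Bool) {x y : Ob} (w : Chain (CellTree R H) x y) (hw : IsNormal dg w) :
    diff dg x y (graft w) = -Finsupp.linearCombination R (op dg x y)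
      (Chain.coder sdeg (ops dg) (Finsupp.single w 1)) := by
  rw [graft, diff, CellForest.toChain_ofChain, if_pos hw, diffF_ofChain, ← Chain.coder_add]
  rfl

theorem diff_graft_of_not_isNormal (dg : Bool) {x y : Ob} (w : Chain (CellTree R H) x y)
    (hw : ¬ IsNormal dg w) : diff dg x y (graft w) = 0 := by
  rw [graft, diff, CellForest.toChain_ofChain, if_neg hw]

open Classical in
theorem diff_gen (dg : Bool) {x y : Ob} (i : ℤ) (a : H x y i) (n : ℕ) (c : Fin n → R)
    (t : Fin n → CellTree R H x y) : diff dg x y (gen i a n c t) =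
      ∑ k, if sdeg _ _ (t k) = i then Finsupp.single (t k) (c k) else 0 := by
  rw [diff]

theorem ops_nil (dg : Bool) (x : Ob) : ops dg x x (.nil x : Chain (CellTree R H) x x) = 0 := by
  rw [ops, op_of_length_le_one _ _ (by simp [Chain.length]), Chain.edge, map_zero, add_zero]

theorem ops_single (dg : Bool) {x y : Ob} (t : CellTree R H x y) :
    ops dg x y (.single t) = diff dg x y t := by
  rw [ops, op_of_length_le_one _ _ (by simp [Chain.length, Chain.single]), Chain.edge_single,
    Finsupp.linearCombination_single, one_smul, zero_add]

theorem ops_of_two_le (dg : Bool) {x y : Ob} (w : Chain (CellTree R H) x y) (hw : 2 ≤ w.length) :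
    ops dg x y w = op dg x y w := by
  rw [ops, Chain.edge_eq_zero _ (by omega), map_zero, add_zero]

theorem linearCombination_ops (dg : Bool) {x y : Ob} (u : Chain (CellTree R H) x y →₀ R) :
    Finsupp.linearCombination R (ops dg x y) u = Finsupp.linearCombination R (op dg x y) u +
      Finsupp.linearCombination R (diff dg x y) (Chain.π u) := by
  refine LinearMap.congr_fun (g := Finsupp.linearCombination R (op dg x y) +
    (Finsupp.linearCombination R (diff dg x y)).comp Chain.π)
    (Finsupp.linearMap_ext_single fun w => ?_) u
  simp [ops, Chain.π_single]

end CellTree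

-- Coderivations on strings of at most three letters

namespace Chain

variable {R : Type u} [CommRing R] {Ob : Type u} {E : Ob → Ob → Type u}
  (sd : ∀ x y : Ob, E x y → ℤ) (φ : ∀ x y : Ob, Chain E x y → (E x y →₀ R))

theorem conc_single_ι {x y z : Ob} (f : E x y) (v : E y z →₀ R) :
    conc (Finsupp.single (single f) (1 : R)) (ι v) = conc (ι (Finsupp.single f 1)) (ι v) := by
  rw [ι_single]

theorem coder_single (h0 : ∀ x, φ x x (nil x) = 0) {x y : Ob} (f : E x y) :
    coder sd φ (Finsupp.single (single f) 1) = ι (φ x y (single f)) := by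
  have h := coder_one sd φ h0 (x := x)
  rw [one] at h
  rw [single, coder_cons, h, map_zero, LinearMap.zero_apply, zero_add, coderTail, cut_single]
  simp only [splits, List.map_append, List.map_cons, List.map_nil, List.sum_append, List.sum_cons,
    List.sum_nil, LinearMap.compl₁₂_apply, LinearMap.comp_apply, Finsupp.linearCombination_single,
    one_smul, h0, map_zero, add_zero]
  rw [← one, sgn_one, one_conc]

/-- These expansions for two and three letters serve the DG case, where they yield the Leibniz rule
and associativity. -/
theorem coder_pair (h0 : ∀ x, φ x x (nil x) = 0) {x y z : Ob} (f : E x y) (g : E y z) :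
    coder sd φ (Finsupp.single ((single f).cons g) 1) =
      conc (ι (φ x y (single f))) (ι (Finsupp.single g 1)) +
      (sd x y f).negOnePow • conc (ι (Finsupp.single f 1)) (ι (φ y z (single g))) +
      ι (φ x z ((single f).cons g)) := by
  rw [coder_cons, coder_single sd φ h0, add_assoc]
  congr 1
  rw [coderTail, cut_single]
  simp only [single, splits, List.map_append, List.map_cons, List.map_nil, List.sum_append,
    List.sum_cons, List.sum_nil, LinearMap.compl₁₂_apply, LinearMap.comp_apply,
    Finsupp.linearCombination_single, one_smul, h0, map_zero, add_zero]
  rw [← one, sgn_one, one_conc, sgn_single, Units.smul_def, map_zsmul, LinearMap.smul_apply,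
    ← single, conc_single_ι, add_comm]
  simp [sumDeg, single, Units.smul_def]

theorem coder_triple (h0 : ∀ x, φ x x (nil x) = 0) {w x y z : Ob} (e : E w x) (f : E x y)
    (g : E y z) :
    coder sd φ (Finsupp.single (((single e).cons f).cons g) 1) =
      (conc (conc (ι (φ w x (single e))) (ι (Finsupp.single f 1))) (ι (Finsupp.single g 1)) +
      (sd w x e).negOnePow • conc (conc (ι (Finsupp.single e 1)) (ι (φ x y (single f))))
        (ι (Finsupp.single g 1)) +
      ((sd w x e).negOnePow * (sd x y f).negOnePow) • conc (conc (ι (Finsupp.single e 1))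
        (ι (Finsupp.single f 1))) (ι (φ y z (single g)))) +
      (conc (ι (φ w y ((single e).cons f))) (ι (Finsupp.single g 1)) +
      (sd w x e).negOnePow • conc (ι (Finsupp.single e 1)) (ι (φ x z ((single f).cons g)))) +
      ι (φ w z (((single e).cons f).cons g)) := by
  have h : conc (ι (Finsupp.single e (1 : R))) (ι (Finsupp.single f 1)) =
      Finsupp.single ((single e).cons f) 1 := by
    rw [ι_single e, conc_ι_single]
  rw [coder_cons, coder_pair sd φ h0, coderTail, cut_single, h]
  simp only [single, splits, List.map_append, List.map_cons, List.map_nil, List.sum_append,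
    List.sum_cons, List.sum_nil, LinearMap.compl₁₂_apply, LinearMap.comp_apply,
    Finsupp.linearCombination_single, one_smul, h0, map_zero, add_zero]
  rw [← one, sgn_one, one_conc, sgn_single, sgn_single]
  simp only [Units.smul_def, map_zsmul, LinearMap.smul_apply, map_add, LinearMap.add_apply]
  rw [ι_single e, single]
  simp only [sumDeg, zero_add, Int.negOnePow_add]
  abel

end Chain

-- The differential raises degrees by one and lowers weights

namespace CellTree

variable {R : Type u} {Ob : Type u} {H : Ob → Ob → ℤ → Type u} [CommRing R]

theorem diff_graft_mem (dg : Bool) {x y : Ob} (w : Chain (CellTree R H) x y)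
    (M : Submodule R (CellTree R H x y →₀ R))
    (h : IsNormal dg w → ∀ a b (p : Chain (CellTree R H) x a) (r : Chain (CellTree R H) a b)
      (q : Chain (CellTree R H) b y), (p.append r).append q = w →
      ∀ t ∈ (ops dg a b r).support, op dg x y ((p.cons t).append q) ∈ M) :
    diff dg x y (graft w) ∈ M := by
  by_cases hw : IsNormal dg w
  · rw [diff_graft dg w hw]
    refine M.neg_mem (Chain.coder_mem sdeg (ops dg) w _ M fun a b p r q hpq t ht => ?_)
    simpa using h hw a b p r q hpq t ht
  · rw [diff_graft_of_not_isNormal dg w hw]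
    exact M.zero_mem

theorem ops_support (dg : Bool) {x y : Ob} (w : Chain (CellTree R H) x y)
    (P : CellTree R H x y → Prop) (h1 : ∀ r ∈ (op dg x y w).support, P r)
    (h2 : ∀ t, w = .single t → ∀ r ∈ (diff dg x y t).support, P r) :
    ∀ r ∈ (ops dg x y w).support, P r := by
  intro r hr
  cases w with
  | nil => simp [ops_nil] at hr
  | cons w t =>
  cases w with
  | nil => exact h2 t rfl r (by rwa [← Chain.single, ops_single] at hr)
  | cons w s => exact h1 r (by rwa [ops_of_two_le _ _ (by simp [Chain.length])] at hr)

theorem exists_of_mem_support_diff_gen (dg : Bool) {x y : Ob} (i : ℤ) (a : H x y i) (n : ℕ)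
    (c : Fin n → R) (t : Fin n → CellTree R H x y) (r : CellTree R H x y)
    (hr : r ∈ (diff dg x y (gen i a n c t)).support) : ∃ k, r = t k ∧ sdeg x y r = i := by
  classical
  rw [diff_gen] at hr
  obtain ⟨k, -, hk⟩ := Finset.mem_biUnion.1 (Finsupp.support_finsetSum hr)
  refine ⟨k, ?_⟩
  split_ifs at hk with h
  · have := Finset.mem_singleton.1 (Finsupp.support_single_subset hk)
    exact ⟨this, this ▸ h⟩
  · simp at hk

theorem sdeg_of_mem_support_diff (dg : Bool) : ∀ (x y : Ob) (t : CellTree R H x y),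
    ∀ r ∈ (diff dg x y t).support, sdeg x y r = sdeg x y t + 1 := by
  refine induct ?_ ?_
  · intro x y i a n c t _ r hr
    obtain ⟨k, -, hk⟩ := exists_of_mem_support_diff_gen dg i a n c t r hr
    rw [hk, sdeg_gen, sub_add_cancel]
  · intro x y w ih
    have := diff_graft_mem dg w (Finsupp.supported R R {r | sdeg x y r = sdeg x y (graft w) + 1}) ?_
    · exact fun r hr => (Finsupp.mem_supported R _).1 this hr
    · rintro - a b p r q rfl t ht
      refine (Finsupp.mem_supported R _).2 fun u hu => ?_
      have hu := sdeg_of_mem_support_op dg _ _ _ u hu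
      have ht' : sdeg a b t = r.sumDeg sdeg + 1 := by
        refine ops_support dg r (fun t => sdeg a b t = r.sumDeg sdeg + 1)
          (sdeg_of_mem_support_op dg _ _ _) ?_ t ht
        rintro s rfl u hu
        rw [Chain.all_append, Chain.all_append] at ih
        simp only [Chain.single, Chain.All] at ih
        rw [ih.1.2.2 u hu]
        simp [Chain.single, Chain.sumDeg]
      rw [Set.mem_ofPred_eq, hu, sdeg_graft]
      simp only [Chain.sumDeg_append, Chain.sumDeg, ht']
      ring

theorem sdeg_of_mem_support_ops (dg : Bool) (x y : Ob) (w : Chain (CellTree R H) x y) :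
    ∀ r ∈ (ops dg x y w).support, sdeg x y r = w.sumDeg sdeg + 1 := by
  refine ops_support dg w (fun r => sdeg x y r = w.sumDeg sdeg + 1)
    (sdeg_of_mem_support_op dg _ _ _) ?_
  rintro s rfl r hr
  rw [sdeg_of_mem_support_diff dg _ _ s r hr]
  simp [Chain.single, Chain.sumDeg]

/-- The boundary of a cell is lighter than the cell by definition of the weight. On a graft, either
a substring is merged into one lighter edge, or one letter is replaced by terms of its differential,
lighter by induction. The resulting filtration is what makes the complexes semi-free. -/
theorem wt_of_mem_support_diff (dg : Bool) : ∀ (x y : Ob) (t : CellTree R H x y),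
    ∀ r ∈ (diff dg x y t).support, wt x y r < wt x y t := by
  refine induct ?_ ?_
  · intro x y i a n c t _ r hr
    obtain ⟨k, rfl, -⟩ := exists_of_mem_support_diff_gen dg i a n c t r hr
    exact wt_gen i a n c t k
  · intro x y w ih
    have := diff_graft_mem dg w (Finsupp.supported R R {r | wt x y r < wt x y (graft w)}) ?_
    · exact fun r hr => (Finsupp.mem_supported R _).1 this hr
    · rintro hw a b p r q rfl t ht
      refine (Finsupp.mem_supported R _).2 fun u hu => ?_
      have hu := wt_of_mem_support_op dg _ _ _ u hu
      -- As an edge, `t` has weight `wt t + 1`, so it is strictly lighter than the substring `r`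
      -- that it replaces.
      have ht' : (wt a b t : ℤ) + 2 ≤ r.sumDeg wtEdge := by
        refine ops_support dg r (fun t => (wt a b t : ℤ) + 2 ≤ r.sumDeg wtEdge)
          (wt_of_mem_support_op dg _ _ _) ?_ t ht
        rintro s rfl u hu
        rw [Chain.all_append, Chain.all_append] at ih
        simp only [Chain.single, Chain.All] at ih
        have := ih.1.2.2 u hu
        simp only [Chain.single, Chain.sumDeg, wtEdge]
        omega
      have hg := wt_graft _ hw.two_le
      simp only [Chain.sumDeg_append, Chain.sumDeg, wtEdge] at hu hg ht'
      rw [Set.mem_ofPred_eq]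
      have : ((wt x y u : ℕ) : ℤ) < wt x y (graft ((p.append r).append q)) := by
        rw [hg]
        linarith
      exact_mod_cast this

-- Associativity and the Leibniz rule for products of words

section DG

/-- The bilinear extension of the product of words. -/
noncomputable def mulL {x y z : Ob} : (CellTree R H x y →₀ R) →ₗ[R] (CellTree R H y z →₀ R) →ₗ[R]
    (CellTree R H x z →₀ R) :=
  Finsupp.linearCombination R fun t => Finsupp.linearCombination R fun s => mul y z s x t

theorem mulL_single {x y z : Ob} (t : CellTree R H x y) (s : CellTree R H y z) :
    mulL (Finsupp.single t (1 : R)) (Finsupp.single s 1) = mul y z s x t := by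
  simp [mulL]

theorem linearCombination_op_ι (dg : Bool) {x y : Ob} (v : CellTree R H x y →₀ R) :
    Finsupp.linearCombination R (op dg x y) (Chain.ι v) = 0 := by
  refine LinearMap.congr_fun (f := (Finsupp.linearCombination R (op dg x y)).comp Chain.ι) (g := 0)
    (Finsupp.linearMap_ext_single fun t => ?_) v
  rw [LinearMap.comp_apply, Chain.ι_single, Finsupp.linearCombination_single, one_smul,
    op_of_length_le_one _ _ (by simp [Chain.length, Chain.single]), LinearMap.zero_apply]

theorem linearCombination_op_true_pair {x y z : Ob} (u : CellTree R H x y →₀ R)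
    (v : CellTree R H y z →₀ R) :
    Finsupp.linearCombination R (op true x z) (Chain.conc (Chain.ι u) (Chain.ι v)) = mulL u v := by
  refine LinearMap.congr_fun₂ (f := (Chain.conc.compl₁₂ Chain.ι Chain.ι).compr₂
    (Finsupp.linearCombination R (op true x z)))
    (Finsupp.linearMap_ext_single fun t => Finsupp.linearMap_ext_single fun s => ?_) u v
  simp only [LinearMap.compr₂_apply, LinearMap.compl₁₂_apply]
  rw [Chain.ι_single t, Chain.conc_ι_single, Finsupp.linearCombination_single, one_smul,
    op_true_cons, mulL_single]

theorem linearCombination_op_true_triple {w x y z : Ob} (a : CellTree R H w x →₀ R)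
    (u : CellTree R H x y →₀ R) (v : CellTree R H y z →₀ R) :
    Finsupp.linearCombination R (op true w z)
      (Chain.conc (Chain.conc (Chain.ι a) (Chain.ι u)) (Chain.ι v)) = 0 := by
  have h1 : Chain.conc (Chain.ι a) (Chain.ι u) ∈
      Finsupp.supported R R {p : Chain (CellTree R H) w y | p.length = 2} := by
    refine Finsupp.linearMap_mem_of_single (Chain.conc.flip (Chain.ι u) ∘ₗ Chain.ι) _ a
      fun t _ => ?_
    refine Finsupp.linearMap_mem_of_single (Chain.conc (Chain.ι (Finsupp.single t 1)) ∘ₗ Chain.ι)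
      _ u fun s _ => ?_
    rw [LinearMap.comp_apply, Chain.ι_single t, Chain.conc_ι_single]
    exact Finsupp.single_mem_supported _ _ rfl
  have := Finsupp.linearMap_mem_of_mem_supported (Finsupp.linearCombination R (op true w z) ∘ₗ
    Chain.conc.flip (Chain.ι v)) ⊥ _ (fun p hp => ?_) _ h1
  · simpa using this
  · refine Finsupp.linearMap_mem_of_single ((Finsupp.linearCombination R (op true w z)) ∘ₗ
      (Chain.conc (Finsupp.single p 1) ∘ₗ Chain.ι)) _ v fun t _ => ?_
    rw [Set.mem_ofPred_eq] at hp
    rw [LinearMap.comp_apply, LinearMap.comp_apply, Chain.conc_ι_single,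
      Finsupp.linearCombination_single, op_true_of_three_le _ (by simp [Chain.length, hp]),
      smul_zero]
    exact Submodule.zero_mem _

theorem mul_word_eq {x y y' z : Ob} (s : CellTree R H y y') (i : ℤ) (a : H y' z i) (n : ℕ)
    (c : Fin n → R) (t' : Fin n → CellTree R H y' z) (t : CellTree R H x y) :
    mul y z (graft ((Chain.single s).cons (gen i a n c t'))) x t =
      (-(sdeg _ _ t).negOnePow) • mulL (mul y y' s x t) (Finsupp.single (gen i a n c t') 1) := by
  rw [mul_word]
  congr 1
  refine LinearMap.congr_fun (g := mulL.flip (Finsupp.single (gen i a n c t') 1))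
    (Finsupp.linearMap_ext_single fun r => ?_) _
  rw [LinearMap.flip_apply, mulL_single, mul_gen]
  simp

/-- The product of words is associative up to sign. -/
theorem mul_assoc_single {w x y : Ob} (t : CellTree R H w x) (s : CellTree R H x y) :
    ∀ z (r : CellTree R H y z), mulL (mul x y s w t) (Finsupp.single r 1) =
      (-(sdeg _ _ t).negOnePow) • mulL (Finsupp.single t 1) (mul y z r x s) := by
  suffices h : ∀ y' z (r : CellTree R H y' z), ∀ hy : y' = y,
      mulL (mul x y s w t) (Finsupp.single (hy ▸ r) 1) =
      (-(sdeg _ _ t).negOnePow) • mulL (Finsupp.single t 1) (mul y z (hy ▸ r) x s) from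
    fun z r => h y z r rfl
  refine induct ?_ ?_
  · rintro _ z i a n c r - rfl
    simp only [mul_gen]
    rw [mulL_single, mul_word_eq, smul_smul, neg_mul_neg, ← Int.negOnePow_add,
      Int.negOnePow_even _ (by simp), one_smul]
  · rintro _ z v ih rfl
    simp only
    by_cases hv : IsWord v
    · obtain ⟨y', r, i, a, n, c, t', rfl⟩ := (isWord_iff v).1 hv
      simp only [Chain.single, Chain.All] at ih
      have ih := ih.1.2 trivial
      -- Taking the last cell out of a product costs a sign given by the degree of the left factor:
      -- `sdeg t + sdeg s + 1` here, `sdeg t` in `h2`.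
      have h1 : mulL (mul x _ s w t) (Finsupp.single (graft ((Chain.single r).cons
          (gen i a n c t'))) 1) = ((sdeg w x t).negOnePow * (sdeg _ _ s).negOnePow) •
            mulL (mulL (mul x _ s w t) (Finsupp.single r 1))
              (Finsupp.single (gen i a n c t') (1 : R)) := by
        rw [Units.smul_def]
        refine Finsupp.linearMap_eq_of_single
          (mulL.flip (Finsupp.single (graft ((Chain.single r).cons (gen i a n c t'))) 1))
          ((((sdeg w x t).negOnePow * (sdeg _ _ s).negOnePow : ℤˣ) : ℤ) •
            (mulL.flip (Finsupp.single (gen i a n c t') (1 : R))) ∘ₗ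
            (mulL.flip (Finsupp.single r 1))) (mul x _ s w t) fun u hu => ?_
        have hu : sdeg _ _ u = _ := sdeg_of_mem_support_op true w _
          ((Chain.single t).cons s) u hu
        simp only [LinearMap.flip_apply, LinearMap.smul_apply, LinearMap.comp_apply, mulL_single]
        rw [mul_word_eq, hu, ← Units.smul_def]
        simp [Chain.sumDeg, Chain.single, Int.negOnePow_add]
      have h2 : mulL (Finsupp.single t (1 : R)) (mulL (mul _ y' r x s)
          (Finsupp.single (gen i a n c t') 1)) = (-(sdeg _ _ t).negOnePow) •
          mulL (mulL (Finsupp.single t (1 : R)) (mul _ y' r x s))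
          (Finsupp.single (gen i a n c t') 1) := by
        rw [Units.smul_def]
        refine LinearMap.congr_fun (f := (mulL (Finsupp.single t (1 : R))) ∘ₗ
          (mulL.flip (Finsupp.single (gen i a n c t') (1 : R))))
          (g := ((-(sdeg w x t).negOnePow : ℤˣ) : ℤ) •
            (mulL.flip (Finsupp.single (gen i a n c t') (1 : R))) ∘ₗ
            (mulL (Finsupp.single t (1 : R)))) (Finsupp.linearMap_ext_single fun u => ?_) _
        simp only [LinearMap.flip_apply, LinearMap.smul_apply, LinearMap.comp_apply, mulL_single,
          mul_gen]
        rw [mul_word_eq, ← Units.smul_def]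
      rw [h1, ih, mul_word_eq]
      simp only [Units.smul_def, map_zsmul, LinearMap.smul_apply, smul_smul] at h2 ⊢
      rw [h2, smul_smul]
      congr 1
      push_cast
      ring
    · have h0 : mulL (mul x _ s w t) (Finsupp.single (graft v) (1 : R)) = 0 := by
        refine Finsupp.linearMap_eq_of_single (mulL.flip (Finsupp.single (graft v) (1 : R))) 0
          _ fun u _ => ?_
        rw [LinearMap.flip_apply, mulL_single, mul_graft_of_not_isWord v hv, LinearMap.zero_apply]
      rw [h0, mul_graft_of_not_isWord v hv, map_zero, smul_zero]

theorem mulL_assoc {w x y z : Ob} (t : CellTree R H w x) (v : CellTree R H x y →₀ R)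
    (u : CellTree R H y z →₀ R) : mulL (mulL (Finsupp.single t 1) v) u =
      (-(sdeg _ _ t).negOnePow) • mulL (Finsupp.single t 1) (mulL v u) := by
  rw [Units.smul_def]
  refine LinearMap.congr_fun₂ (f := mulL ∘ₗ (mulL (Finsupp.single t (1 : R))))
    (g := ((-(sdeg w x t).negOnePow : ℤˣ) : ℤ) • mulL.compr₂ (mulL (Finsupp.single t (1 : R))))
    (Finsupp.linearMap_ext_single fun s => Finsupp.linearMap_ext_single fun r => ?_) v u
  simp only [LinearMap.comp_apply, LinearMap.smul_apply, LinearMap.compr₂_apply, mulL_single]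
  rw [mul_assoc_single, Units.smul_def]

end DG

end CellTree

namespace CellTree

variable {R : Type u} {Ob : Type u} {H : Ob → Ob → ℤ → Type u} [CommRing R]

section DG

theorem mulL_assoc_of_sdeg {w x y z : Ob} (a : CellTree R H w x →₀ R) (e : ℤ)
    (ha : ∀ r ∈ a.support, sdeg w x r = e) (v : CellTree R H x y →₀ R)
    (u : CellTree R H y z →₀ R) :
    mulL (mulL a v) u = (-e.negOnePow) • mulL a (mulL v u) := by
  rw [Units.smul_def]
  refine Finsupp.linearMap_eq_of_single ((mulL.flip u) ∘ₗ (mulL.flip v))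
    (((-e.negOnePow : ℤˣ) : ℤ) • mulL.flip (mulL v u)) a fun r hr => ?_
  simp only [LinearMap.comp_apply, LinearMap.smul_apply, LinearMap.flip_apply]
  rw [mulL_assoc, ha r hr, Units.smul_def]

theorem diff_pair {x y z : Ob} (t : CellTree R H x y) (s : CellTree R H y z)
    (h : IsNormal true ((Chain.single t).cons s)) :
    diff true x z (graft ((Chain.single t).cons s)) =
      -(mulL (diff true x y t) (Finsupp.single s 1) +
        (sdeg x y t).negOnePow • mulL (Finsupp.single t 1) (diff true y z s)) := by
  rw [diff_graft _ _ h, Chain.coder_pair _ _ (ops_nil true), map_add, map_add,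
    linearCombination_op_ι, linearCombination_op_true_pair, ops_single, ops_single, Units.smul_def,
    map_zsmul, linearCombination_op_true_pair, add_zero, Units.smul_def]

/-- The Leibniz rule for the product of words. -/
theorem diff_mul : ∀ (y z : Ob) (s : CellTree R H y z), ∀ (x : Ob) (t : CellTree R H x y),
    Finsupp.linearCombination R (diff true x z) (mul y z s x t) +
      mulL (diff true x y t) (Finsupp.single s 1) +
      (sdeg x y t).negOnePow • mulL (Finsupp.single t 1) (diff true y z s) = 0 := by
  refine induct ?_ ?_
  · intro y z i a n c s _ x t
    rw [mul_gen, Finsupp.linearCombination_single, one_smul, diff_pair]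
    · abel
    · exact (isWord_iff ((Chain.single t).cons (gen i a n c s))).2 ⟨_, t, i, a, n, c, s, rfl⟩
  · intro y z w ih x t
    by_cases hw : IsWord w
    · obtain ⟨y', s, i, a, n, c, t', rfl⟩ := (isWord_iff w).1 hw
      simp only [Chain.single, Chain.All] at ih
      have ih := ih.1.2 x t
      have hs : Finsupp.single (graft ((Chain.single s).cons (gen i a n c t'))) (1 : R) =
          mulL (Finsupp.single s 1) (Finsupp.single (gen i a n c t') 1) := by
        rw [mulL_single, mul_gen]
      have hv : ∀ r ∈ (mul y y' s x t).support, sdeg _ _ r = sdeg _ _ t + sdeg _ _ s + 1 := by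
        intro r hr
        have := sdeg_of_mem_support_op true _ _ ((Chain.single t).cons s) r hr
        simpa [Chain.sumDeg, Chain.single] using this
      have hd : Finsupp.linearCombination R (diff true x z)
          (mulL (mul y y' s x t) (Finsupp.single (gen i a n c t') 1)) =
          -(mulL (Finsupp.linearCombination R (diff true x y') (mul y y' s x t))
            (Finsupp.single (gen i a n c t') 1) +
            (((sdeg _ _ t + sdeg _ _ s + 1).negOnePow : ℤˣ) : ℤ) •
              mulL (mul y y' s x t) (diff true _ _ (gen i a n c t'))) := by
        refine Finsupp.linearMap_eq_of_single
          ((Finsupp.linearCombination R (diff true x z)) ∘ₗ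
            (mulL.flip (Finsupp.single (gen i a n c t') 1)))
          (-((mulL.flip (Finsupp.single (gen i a n c t') (1 : R))) ∘ₗ
            (Finsupp.linearCombination R (diff true x y')) +
            (((sdeg _ _ t + sdeg _ _ s + 1).negOnePow : ℤˣ) : ℤ) •
              mulL.flip (diff true _ _ (gen i a n c t')))) _ fun r hr => ?_
        simp only [LinearMap.comp_apply, LinearMap.neg_apply, LinearMap.add_apply,
          LinearMap.smul_apply, LinearMap.flip_apply, mulL_single, mul_gen,
          Finsupp.linearCombination_single, one_smul]
        rw [diff_pair _ _ ((isWord_iff _).2 ⟨_, r, _, _, _, _, _, rfl⟩), hv r hr, Units.smul_def]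
      have hn := diff_pair s (gen i a n c t') hw
      -- With the word written as `s · c`, the rule follows from the rule for `t` and `s`,
      -- multiplied by `c` on the right, once all products are reassociated.
      have h1 := mulL_assoc_of_sdeg (diff true x y t) _ (sdeg_of_mem_support_diff true _ _ t)
        (Finsupp.single s (1 : R)) (Finsupp.single (gen i a n c t') 1)
      have h2 := mulL_assoc t (diff true y y' s) (Finsupp.single (gen i a n c t') (1 : R))
      have h3 := mulL_assoc t (Finsupp.single s (1 : R)) (diff true y' z (gen i a n c t'))
      have ih := congrArg (fun v => mulL v (Finsupp.single (gen i a n c t') (1 : R))) ih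
      rw [hs, mul_word_eq, hn]
      simp only [Units.smul_def, map_zsmul, map_add, map_neg, map_zero, LinearMap.add_apply,
        LinearMap.smul_apply, LinearMap.zero_apply, hd, mulL_single] at h1 h2 h3 ih ⊢
      -- The sign `ε` of `t` occurs quadratically, so its two values are treated separately; the
      -- sign `δ` of `s` can stay a variable.
      have ht : (((sdeg x y t).negOnePow : ℤˣ) : ℤ) * (((sdeg x y t).negOnePow : ℤˣ) : ℤ) = 1 := by
        rw [← Units.val_mul, ← Int.negOnePow_add, Int.negOnePow_even _ (by simp), Units.val_one]
      simp only [Int.negOnePow_add, Int.negOnePow_one, Units.val_neg, Units.val_mul, Units.val_one]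
        at h1 h2 h3 ih ⊢
      generalize (((sdeg x y t).negOnePow : ℤˣ) : ℤ) = ε at *
      generalize (((sdeg y y' s).negOnePow : ℤˣ) : ℤ) = δ at *
      rw [h1, h2, add_assoc] at ih
      rw [h3, eq_neg_of_add_eq_zero_left ih]
      rcases mul_self_eq_one_iff.1 ht with rfl | rfl <;> module
    · have h0 : mulL (diff true x y t) (Finsupp.single (graft w) (1 : R)) = 0 := by
        refine Finsupp.linearMap_eq_of_single (mulL.flip (Finsupp.single (graft w) (1 : R))) 0
          _ fun u _ => ?_
        rw [LinearMap.flip_apply, mulL_single, mul_graft_of_not_isWord w hw, LinearMap.zero_apply]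
      rw [h0, mul_graft_of_not_isWord w hw, diff_graft_of_not_isNormal true w hw, map_zero,
        map_zero,
        smul_zero, add_zero, add_zero]

end DG

-- The relations on trees and the square of the differential

theorem linearCombination_ops_ι (dg : Bool) {x y : Ob} (v : CellTree R H x y →₀ R) :
    Finsupp.linearCombination R (ops dg x y) (Chain.ι v) =
      Finsupp.linearCombination R (diff dg x y) v := by
  rw [linearCombination_ops, linearCombination_op_ι, zero_add, Chain.π_ι]

/-- The `A∞`-relations with at least two arguments on the basis of trees. -/
theorem ops_coder_of_two_le (dg : Bool) {x y : Ob} (w : Chain (CellTree R H) x y)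
    (hw : 2 ≤ w.length) : Finsupp.linearCombination R (ops dg x y)
      (Chain.coder sdeg (ops dg) (Finsupp.single w 1)) = 0 := by
  rw [linearCombination_ops, Chain.π_coder _ _ _ (ops_nil dg), ops_of_two_le _ _ hw]
  -- In the free case the relation is the definition of the differential of a graft. In the DG case
  -- two letters give the Leibniz rule and three give associativity. With four or more, one of the
  -- two nested operations has at least three arguments and vanishes.
  cases dg with
  | false =>
    rw [op_of_isNormal false w hw, Finsupp.linearCombination_single, one_smul,
      diff_graft false w hw,
      add_neg_cancel]
  | true =>
    cases w with
    | nil => simp [Chain.length] at hw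
    | cons w r =>
    cases w with
    | nil => simp [Chain.length] at hw
    | cons w s =>
    cases w with
    | nil =>
      have h := Chain.coder_pair sdeg (ops (R := R) (H := H) true) (ops_nil true) s r
      rw [← Chain.single, h, op_true_cons, map_add, map_add, linearCombination_op_ι,
        linearCombination_op_true_pair, ops_single, ops_single, Units.smul_def,
        map_zsmul, linearCombination_op_true_pair, add_zero, ← Units.smul_def, add_comm,
        ← add_assoc, diff_mul]
    | cons w t =>
    cases w with
    | nil =>
      have h := Chain.coder_triple sdeg (ops (R := R) (H := H) true) (ops_nil true) t s r
      have h2 : ∀ {x y z : Ob} (t : CellTree R H x y) (s : CellTree R H y z),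
          ops true x z ((Chain.single t).cons s) = mul y z s x t := fun t s => by
        rw [ops_of_two_le _ _ (by simp [Chain.single, Chain.length]), op_true_cons]
      rw [← Chain.single, h, op_true_of_three_le _ (by simp [Chain.length, Chain.single]), map_zero,
        add_zero]
      simp only [map_add, Units.smul_def, map_zsmul, linearCombination_op_true_triple,
        linearCombination_op_true_pair, linearCombination_op_ι, h2]
      rw [mul_assoc_single]
      simp [Units.smul_def]
    | cons w t' =>
      rw [op_true_of_three_le _ (by simp [Chain.length]), map_zero, add_zero]
      have := Chain.coder_mem sdeg (ops (R := R) (H := H) true)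
        ((((w.cons t').cons t).cons s).cons r) (Finsupp.linearCombination R (op true x y)) ⊥ ?_
      · simpa using this
      · intro a b p v q hv u hu
        rw [Submodule.mem_bot, Finsupp.linearCombination_single, one_smul]
        have hl := congrArg Chain.length hv
        simp only [Chain.length_append, Chain.length] at hl
        by_cases h3 : 3 ≤ v.length
        · rw [ops_of_two_le _ _ (by omega), op_true_of_three_le _ h3] at hu
          simp at hu
        · exact op_true_of_three_le _ (by rw [Chain.length_append, Chain.length]; omega)

/-- All relations with at least two arguments hold already, so the corestricted square of the
coderivation only sees single letters. -/
theorem ops_coder (dg : Bool) {x y : Ob} (u : Chain (CellTree R H) x y →₀ R) :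
    Finsupp.linearCombination R (ops dg x y) (Chain.coder sdeg (ops dg) u) =
      Finsupp.linearCombination R (diff dg x y)
        (Finsupp.linearCombination R (diff dg x y) (Chain.π u)) := by
  refine LinearMap.congr_fun (f := (Finsupp.linearCombination R (ops dg x y)) ∘ₗ
    (Chain.coder sdeg (ops dg))) (g := (Finsupp.linearCombination R (diff dg x y)) ∘ₗ
    (Finsupp.linearCombination R (diff dg x y)) ∘ₗ Chain.π)
    (Finsupp.linearMap_ext_single fun w => ?_) u
  simp only [LinearMap.comp_apply, Chain.π_single]
  cases w with
  | nil =>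
    rw [← Chain.one, Chain.coder_one _ _ (ops_nil dg), map_zero, Chain.edge, map_zero, map_zero]
  | cons w t =>
  cases w with
  | nil =>
    rw [← Chain.single, Chain.coder_single _ _ (ops_nil dg), Chain.edge_single,
      linearCombination_ops_ι, ops_single, Finsupp.linearCombination_single, one_smul]
  | cons w s =>
    rw [ops_coder_of_two_le _ _ (by simp [Chain.length]),
      Chain.edge_eq_zero _ (by simp [Chain.length]), map_zero, map_zero]

/-- By hypothesis the corestricted square vanishes on all substrings, so the coderivation squares to
zero on `w`. Then `ops_coder`, applied to the coderivation of `w`, whose only term of length one is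
the graft, gives the claim. -/
theorem diff_diff_graft (dg : Bool) {x y : Ob} (w : Chain (CellTree R H) x y)
    (hw : w.All fun x y t => Finsupp.linearCombination R (diff dg x y) (diff dg x y t) = 0) :
    Finsupp.linearCombination R (diff dg x y) (diff dg x y (graft w)) = 0 := by
  by_cases hn : IsNormal dg w
  · have h := Chain.coder_coder sdeg (ops dg) (ops_nil dg) (sdeg_of_mem_support_ops dg) w ?_
    · have h2 := ops_coder dg (Chain.coder sdeg (ops dg) (Finsupp.single w 1))
      rw [h, map_zero, Chain.π_coder _ _ _ (ops_nil dg), ops_of_two_le _ _ hn.two_le,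
        op_of_isNormal _ _ hn, Finsupp.linearCombination_single, one_smul] at h2
      exact h2.symm
    · rintro a b p r q rfl
      rw [ops_coder, Chain.π_single]
      rw [Chain.all_append, Chain.all_append] at hw
      cases r with
      | nil => rw [Chain.edge, map_zero, map_zero]
      | cons r t =>
      cases r with
      | nil =>
        rw [← Chain.single, Chain.edge_single, Finsupp.linearCombination_single, one_smul]
        simp only [Chain.All] at hw
        exact hw.1.2.2
      | cons r s => rw [Chain.edge_eq_zero _ (by simp [Chain.length]), map_zero, map_zero]
  · rw [diff_graft_of_not_isNormal _ _ hn, map_zero]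

end CellTree

-- Images of strings; operations in one variable

theorem Chain.map_append {Ob Ob' : Type u} {E : Ob → Ob → Type u} {E' : Ob' → Ob' → Type u}
    (o : Ob → Ob') (φ : ∀ x y, E x y → E' (o x) (o y)) {x y z : Ob} (p : Chain E x y)
    (q : Chain E y z) : (p.append q).map o φ = (p.map o φ).append (q.map o φ) := by
  induction q with
  | nil => simp only [append, map]
  | cons q f ih => simp only [append, map, ih]

theorem Chain.length_map {Ob Ob' : Type u} {E : Ob → Ob → Type u} {E' : Ob' → Ob' → Type u}
    (o : Ob → Ob') (φ : ∀ x y, E x y → E' (o x) (o y)) {x y : Ob} (p : Chain E x y) :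
    (p.map o φ).length = p.length := by
  induction p with
  | nil => simp only [map, length]
  | cons q f ih => simp only [map, length, ih]

theorem Chain.splits_map {Ob Ob' : Type u} {E : Ob → Ob → Type u} {E' : Ob' → Ob' → Type u}
    (o : Ob → Ob') (φ : ∀ x y, E x y → E' (o x) (o y)) {x y : Ob} (p : Chain E x y) :
    (p.map o φ).splits =
      p.splits.map fun s => ⟨o s.1, s.2.1.map o φ, s.2.2.map o φ⟩ := by
  induction p with
  | nil => simp only [map, splits, List.map_cons, List.map_nil]
  | cons q f ih =>
    simp only [map, splits, ih, List.map_append, List.map_map, List.map_cons, List.map_nil,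
      Function.comp_def]

namespace AInfCat

variable {R : Type u} [CommRing R] (B : AInfCat R)

/-- The operations as linear maps in one variable. -/
def slot {x a b y : B.Obj} (p : Chain (GradedEdge B.Hom) x a) (d : ℤ)
    (q : Chain (GradedEdge B.Hom) b y) (e : ℤ) : B.Hom a b d →ₗ[R] B.Hom x y e where
  toFun f := B.m ((p.cons ⟨d, f⟩).append q) e
  map_add' f g := B.m_add p d f g q e
  map_smul' c f := B.m_smul p d c f q e

theorem slot_apply {x a b y : B.Obj} (p : Chain (GradedEdge B.Hom) x a) (d : ℤ)
    (q : Chain (GradedEdge B.Hom) b y) (e : ℤ) (f : B.Hom a b d) :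
    B.slot p d q e f = B.m ((p.cons ⟨d, f⟩).append q) e := rfl

variable {B}

/-- The relation with three arguments: as `m³ = 0`, only the two bracketings survive. -/
theorem IsDG.m_assoc (hB : IsDG B) {w x y z : B.Obj} {i j k : ℤ} (f : B.Hom w x i)
    (g : B.Hom x y j) (h : B.Hom y z k) (a b e : ℤ) (ha : a = i + j) (hb : b = j + k) :
    B.m ((Chain.single ⟨a, B.m ((Chain.single ⟨i, f⟩).cons ⟨j, g⟩) a⟩).cons ⟨k, h⟩) e =
      -(i - 1).negOnePow •
        B.m ((Chain.single ⟨i, f⟩).cons ⟨b, B.m ((Chain.single ⟨j, g⟩).cons ⟨k, h⟩) b⟩) e := by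
  subst ha hb
  have hr := B.rel (((Chain.single ⟨i, f⟩).cons ⟨j, g⟩).cons ⟨k, h⟩) e
  have hd : ∀ {x y : B.Obj} (w : Chain (GradedEdge B.Hom) x y) (e : ℤ), 3 ≤ w.length →
      B.m w e = 0 := fun w e hw => hB _ _ w e hw
  have h0 := B.m_zero (Chain.nil w) (0 + i + j + k + 2 - 3) (Chain.nil z) e
  rw [Chain.append] at h0
  simp only [Chain.single, Chain.splits, List.map_cons, List.map_nil, List.sum_cons,
    List.sum_nil, List.nil_append, List.cons_append, add_zero] at hr
  simp [Chain.append, B.m_nil, Chain.deg, Chain.length, hd, h0] at hr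
  have e1 : 0 + i + j + 2 - 2 = i + j := by ring
  have e2 : 0 + j + k + 2 - 2 = j + k := by ring
  rw [e1, e2] at hr
  rw [Units.smul_def, Units.val_neg, neg_smul, ← Units.smul_def]
  exact eq_neg_of_add_eq_zero_left hr

end AInfCat

-- Evaluation of trees in an `A∞`-category

namespace CellTree

variable {R : Type u} [CommRing R] {Ob : Type u} {H : Ob → Ob → ℤ → Type u}

section Eval

variable (B : AInfCat R) (o : Ob → B.Obj)
  (g : ∀ (x y : Ob) (i : ℤ) (_ : H x y i) (n : ℕ) (_ : Fin n → R)
    (_ : Fin n → CellTree R H x y) (_ : B.Hom (o x) (o y) (i + 1)), B.Hom (o x) (o y) i)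

mutual
/-- The evaluation of trees in an `A∞`-category, given the values of cells in terms of the values
of their boundaries: `eval x y t e` is the component of degree `e` of the value of `t`. -/
noncomputable def eval : ∀ x y : Ob, CellTree R H x y → ∀ e, B.Hom (o x) (o y) e
  | _, _, .gen i a n c t => fun e =>
    if h : i = e then h ▸ g _ _ i a n c t (∑ k, c k • eval _ _ (t k) (i + 1)) else 0
  | _, _, .node w => B.m (evalF _ _ w)
/-- The evaluation of forests. -/
noncomputable def evalF : ∀ x y : Ob, CellForest R H x y → Chain (GradedEdge B.Hom) (o x) (o y)
  | _, _, .nil _ => .nil _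
  | _, _, .cons p f => (evalF _ _ p).cons ⟨sdeg _ _ f + 1, eval _ _ f (sdeg _ _ f + 1)⟩
end

/-- The evaluation of strings of trees. -/
noncomputable def evalC {x y : Ob} (w : Chain (CellTree R H) x y) :
    Chain (GradedEdge B.Hom) (o x) (o y) :=
  w.map (E' := GradedEdge B.Hom) o
    fun x y t => ⟨sdeg x y t + 1, eval B o g x y t (sdeg x y t + 1)⟩

theorem evalF_ofChain {x y : Ob} (w : Chain (CellTree R H) x y) :
    evalF B o g x y (.ofChain w) = evalC B o g w := by
  induction w with
  | nil => simp only [CellForest.ofChain, evalF, evalC, Chain.map]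
  | cons p f ih =>
    simp only [CellForest.ofChain, evalF, ih]
    rfl

theorem eval_graft {x y : Ob} (w : Chain (CellTree R H) x y) (e : ℤ) :
    eval B o g x y (graft w) e = B.m (evalC B o g w) e := by
  rw [graft, eval, evalF_ofChain]

theorem eval_gen {x y : Ob} (i : ℤ) (a : H x y i) (n : ℕ) (c : Fin n → R)
    (t : Fin n → CellTree R H x y) : eval B o g x y (gen i a n c t) i =
      g x y i a n c t (∑ k, c k • eval B o g x y (t k) (i + 1)) := by
  rw [eval]
  exact dif_pos rfl

theorem evalC_append {x y z : Ob} (p : Chain (CellTree R H) x y) (q : Chain (CellTree R H) y z) :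
    evalC B o g (p.append q) = (evalC B o g p).append (evalC B o g q) :=
  Chain.map_append _ _ p q

theorem deg_evalC {x y : Ob} (w : Chain (CellTree R H) x y) :
    (evalC B o g w).deg = w.sumDeg sdeg + w.length := by
  induction w with
  | nil => simp [evalC, Chain.map, Chain.deg, Chain.sumDeg, Chain.length]
  | cons p f ih =>
    simp only [evalC, Chain.map, Chain.deg, Chain.sumDeg, Chain.length] at ih ⊢
    rw [ih]
    push_cast
    ring

theorem length_evalC {x y : Ob} (w : Chain (CellTree R H) x y) :
    (evalC B o g w).length = w.length := Chain.length_map _ _ w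

theorem m_evalC_of_ne {x y : Ob} (w : Chain (CellTree R H) x y) (e : ℤ)
    (h : e ≠ w.sumDeg sdeg + 2) : B.m (evalC B o g w) e = 0 :=
  B.m_deg _ _ (by rw [deg_evalC, length_evalC]; intro h'; exact h (by rw [h']; ring))

theorem eval_of_ne (x y : Ob) (t : CellTree R H x y) (e : ℤ) (h : e ≠ sdeg x y t + 1) :
    eval B o g x y t e = 0 := by
  revert h e
  refine induct (P := fun x y t => ∀ e, e ≠ sdeg x y t + 1 → eval B o g x y t e = 0) ?_ ?_ x y t
  · intro x y i a n c t _ e h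
    rw [sdeg_gen] at h
    rw [eval]
    exact dif_neg fun h' => h (by rw [← h']; ring)
  · intro x y w _ e h
    rw [sdeg_graft] at h
    rw [eval_graft, m_evalC_of_ne]
    intro h'
    exact h (by rw [h']; ring)

/-- The linear extension of the evaluation of trees. -/
noncomputable def evalL (x y : Ob) (e : ℤ) : (CellTree R H x y →₀ R) →ₗ[R] B.Hom (o x) (o y) e :=
  Finsupp.linearCombination R fun t => eval B o g x y t e

theorem evalL_single {x y : Ob} (e : ℤ) (t : CellTree R H x y) :
    evalL B o g x y e (Finsupp.single t 1) = eval B o g x y t e := by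
  simp [evalL]

theorem evalL_of_ne {x y : Ob} (e d : ℤ) (v : CellTree R H x y →₀ R)
    (hv : ∀ t ∈ v.support, sdeg x y t = d) (h : e ≠ d + 1) : evalL B o g x y e v = 0 := by
  refine Finsupp.linearMap_eq_of_single _ 0 v fun t ht => ?_
  rw [evalL_single, eval_of_ne _ _ _ _ _ _ _ (by rwa [hv t ht]), LinearMap.zero_apply]

/-- The linear extension of the operations on the values of strings of trees. -/
noncomputable def evalT (x y : Ob) (e : ℤ) :
    (Chain (CellTree R H) x y →₀ R) →ₗ[R] B.Hom (o x) (o y) e :=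
  Finsupp.linearCombination R fun w => B.m (evalC B o g w) e

theorem evalT_single {x y : Ob} (e : ℤ) (w : Chain (CellTree R H) x y) :
    evalT B o g x y e (Finsupp.single w 1) = B.m (evalC B o g w) e := by
  simp [evalT]

theorem evalT_conc {x a b y : Ob} (p : Chain (CellTree R H) x a) (v : CellTree R H a b →₀ R)
    (q : Chain (CellTree R H) b y) (d e : ℤ) (hv : ∀ t ∈ v.support, sdeg a b t + 1 = d) :
    evalT B o g x y e (Chain.conc (Chain.conc (Finsupp.single p 1) (Chain.ι v))
      (Finsupp.single q 1)) =
    B.m (((evalC B o g p).cons ⟨d, evalL B o g a b d v⟩).append (evalC B o g q)) e := by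
  refine Finsupp.linearMap_eq_of_single (evalT B o g x y e ∘ₗ
    (Chain.conc.flip (Finsupp.single q 1)) ∘ₗ (Chain.conc (Finsupp.single p 1)) ∘ₗ Chain.ι)
    ((B.slot (evalC B o g p) d (evalC B o g q) e) ∘ₗ (evalL B o g a b d)) v fun t ht => ?_
  obtain rfl := hv t ht
  simp only [LinearMap.comp_apply, LinearMap.flip_apply, AInfCat.slot_apply, evalL_single]
  rw [Chain.conc_ι_single, Chain.conc_single, evalT_single, evalC_append]
  rfl

/-- Term by term this is the `A∞`-relation of `B` for the string of values of `w`. -/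
theorem evalT_coder (φ : ∀ x y : Ob, Chain (CellTree R H) x y → (CellTree R H x y →₀ R))
    {x y : Ob} (w : Chain (CellTree R H) x y)
    (hφ : ∀ (x y : Ob) (w : Chain (CellTree R H) x y), ∀ t ∈ (φ x y w).support,
      sdeg x y t = w.sumDeg sdeg + 1)
    (h : ∀ a b (p : Chain (CellTree R H) x a) (r : Chain (CellTree R H) a b)
      (q : Chain (CellTree R H) b y), (p.append r).append q = w → ∀ e,
      evalL B o g a b e (φ a b r) = B.m (evalC B o g r) e) (e : ℤ) :
    evalT B o g x y e (Chain.coder sdeg φ (Finsupp.single w 1)) = 0 := by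
  rw [← B.rel (evalC B o g w) e, Chain.coder, Chain.comp_cut, Chain.cut_single, evalC,
    Chain.splits_map, List.map_map]
  refine congrArg List.sum (List.map_congr_left fun s hs => ?_)
  simp only [Function.comp_apply, Chain.splits_map, List.map_map]
  rw [LinearMap.compr₂_apply, LinearMap.comp_apply, Chain.coderTail]
  refine (Chain.comp_cut ((evalT B o g x y e) ∘ₗ (Chain.conc.flip (Finsupp.single s.2.2 1)))
    _ _).trans ?_
  rw [Chain.cut_single]
  refine congrArg List.sum (List.map_congr_left fun t ht => ?_)
  simp only [Function.comp_apply, LinearMap.compr₂_apply, LinearMap.compl₁₂_apply,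
    LinearMap.comp_apply, LinearMap.flip_apply, Finsupp.linearCombination_single, one_smul]
  rw [Chain.sgn_single, Units.smul_def, map_zsmul, LinearMap.smul_apply, map_zsmul,
    LinearMap.smul_apply, map_zsmul, evalT_conc B o g t.2.1 _ s.2.2 (t.2.2.sumDeg sdeg + 2) e
      (fun r hr => by rw [hφ _ _ _ r hr]; ring),
    h _ _ t.2.1 t.2.2 s.2.2 (by rw [Chain.append_of_mem_splits _ _ ht,
      Chain.append_of_mem_splits _ _ hs])]
  -- The difference of degree and length is the sum of the shifted degrees, so the signs of
  -- `AInfCat.rel` and of `coder` agree.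
  have h1 := deg_evalC B o g t.2.1
  have h2 := length_evalC B o g t.2.1
  have h3 := deg_evalC B o g t.2.2
  have h4 := length_evalC B o g t.2.2
  rw [evalC] at h1 h2 h3 h4
  rw [h1, h2, h3, h4, add_sub_cancel_right, Units.smul_def]
  exact congrArg (fun d => (((t.2.1.sumDeg sdeg).negOnePow : ℤˣ) : ℤ) •
    B.m (((evalC B o g t.2.1).cons ⟨d, B.m (evalC B o g t.2.2) d⟩).append
      (evalC B o g s.2.2)) e) (by ring)

end Eval

end CellTree

-- Canonical enumeration of a linear combination

namespace Finsupp

variable {R X : Type u} [CommRing R]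

/-- An enumeration of the terms of a linear combination. -/
noncomputable def enum (z : X →₀ R) : Σ n : ℕ, (Fin n → R) × (Fin n → X) :=
  ⟨z.support.card, fun k => z (z.support.equivFin.symm k), fun k => z.support.equivFin.symm k⟩

theorem enum_mem_support (z : X →₀ R) (k : Fin z.enum.1) : z.enum.2.2 k ∈ z.support :=
  (z.support.equivFin.symm k).2

theorem sum_enum {N : Type u} [AddCommGroup N] [Module R N] (z : X →₀ R) (f : X → N) :
    ∑ k, z.enum.2.1 k • f (z.enum.2.2 k) = Finsupp.linearCombination R f z := by
  rw [Finsupp.linearCombination_apply, Finsupp.sum, ← Finset.sum_coe_sort z.support]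
  exact Equiv.sum_comp z.support.equivFin.symm fun x => z x • f x

theorem sum_single_enum (z : X →₀ R) :
    ∑ k, Finsupp.single (z.enum.2.2 k) (z.enum.2.1 k) = z := by
  refine Eq.trans (Finset.sum_congr rfl fun k _ => ?_)
    ((sum_enum z fun x => Finsupp.single x (1 : R)).trans ?_)
  · simp
  · rw [Finsupp.linearCombination_apply]
    simp

end Finsupp

-- Valid trees and their evaluation

namespace CellTree

variable {R : Type u} [CommRing R] (dg : Bool) (A : AInfCat R)

/-- The morphism over which a tree lies. -/
noncomputable def val (x y : A.Obj) (t : CellTree R A.Hom x y) (e : ℤ) : A.Hom x y e :=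
  eval A (fun x => x) (fun _ _ _ a _ _ _ _ => a) x y t e

mutual
/-- The trees all of whose cells are attached along a cycle of the correct degree, which lies over
the boundary of the morphism of the cell, and is enumerated in the standard way. -/
def Valid : ∀ x y : A.Obj, CellTree R A.Hom x y → Prop
  | x, y, .gen i a _ c t => (∀ k, Valid _ _ (t k) ∧ sdeg x y (t k) = i) ∧
      ∑ k, c k • diff dg x y (t k) = 0 ∧
      ∑ k, c k • val A x y (t k) (i + 1) = A.d x y i (i + 1) a ∧
      -- This clause makes a valid cell depend only on `a` and on its boundary as an element of the
      -- free module, which strict functoriality needs.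
      Finsupp.enum (∑ k, Finsupp.single (t k) (c k)) = ⟨_, c, t⟩
  | _, _, .node w => IsNormal dg w.toChain ∧ ValidF _ _ w
/-- The forests of valid trees. -/
def ValidF : ∀ x y : A.Obj, CellForest R A.Hom x y → Prop
  | _, _, .nil _ => True
  | _, _, .cons p f => ValidF _ _ p ∧ Valid _ _ f
end

theorem validF_ofChain {x y : A.Obj} (w : Chain (CellTree R A.Hom) x y) :
    ValidF dg A x y (.ofChain w) ↔ w.All (Valid dg A) := by
  induction w with
  | nil => simp only [CellForest.ofChain, ValidF, Chain.All]
  | cons p f ih => simp only [CellForest.ofChain, ValidF, Chain.All, ih]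

theorem valid_graft {x y : A.Obj} (w : Chain (CellTree R A.Hom) x y) :
    Valid dg A x y (graft w) ↔ IsNormal dg w ∧ w.All (Valid dg A) := by
  rw [graft, Valid, CellForest.toChain_ofChain, validF_ofChain]

theorem valid_gen {x y : A.Obj} (i : ℤ) (a : A.Hom x y i) (n : ℕ) (c : Fin n → R)
    (t : Fin n → CellTree R A.Hom x y) : Valid dg A x y (gen i a n c t) ↔
      (∀ k, Valid dg A x y (t k) ∧ sdeg x y (t k) = i) ∧
      ∑ k, c k • diff dg x y (t k) = 0 ∧
      ∑ k, c k • val A x y (t k) (i + 1) = A.d x y i (i + 1) a ∧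
      Finsupp.enum (∑ k, Finsupp.single (t k) (c k)) = ⟨_, c, t⟩ := by
  rw [Valid]

variable {dg A}

/-- The cell over `a` with boundary `z`. -/
noncomputable def cell {x y : A.Obj} (i : ℤ) (a : A.Hom x y i) (z : CellTree R A.Hom x y →₀ R) :
    CellTree R A.Hom x y :=
  gen i a z.enum.1 z.enum.2.1 z.enum.2.2

theorem valid_cell {x y : A.Obj} {i : ℤ} {a : A.Hom x y i} {z : CellTree R A.Hom x y →₀ R}
    (h1 : ∀ t ∈ z.support, Valid dg A x y t ∧ sdeg x y t = i)
    (h2 : Finsupp.linearCombination R (diff dg x y) z = 0)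
    (h3 : Finsupp.linearCombination R (fun t => val A x y t (i + 1)) z = A.d x y i (i + 1) a) :
    Valid dg A x y (cell i a z) := by
  rw [cell, valid_gen, Finsupp.sum_enum z (diff dg x y),
    Finsupp.sum_enum z (fun t => val A x y t (i + 1)), Finsupp.sum_single_enum]
  exact ⟨fun k => h1 _ (Finsupp.enum_mem_support z k), h2, h3, rfl⟩

theorem cell_of_valid {x y : A.Obj} {i : ℤ} {a : A.Hom x y i} {n : ℕ} {c : Fin n → R}
    {t : Fin n → CellTree R A.Hom x y} (h : Valid dg A x y (gen i a n c t)) :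
    cell i a (∑ k, Finsupp.single (t k) (c k)) = gen i a n c t := by
  rw [cell, ((valid_gen ..).1 h).2.2.2]

theorem diff_gen_of_valid {x y : A.Obj} {i : ℤ} {a : A.Hom x y i} {n : ℕ} {c : Fin n → R}
    {t : Fin n → CellTree R A.Hom x y} (h : Valid dg A x y (gen i a n c t)) :
    diff dg x y (gen i a n c t) = ∑ k, Finsupp.single (t k) (c k) := by
  classical
  rw [diff_gen]
  exact Finset.sum_congr rfl fun k _ => if_pos (((valid_gen ..).1 h).1 k).2

theorem diff_diff (x y : A.Obj) (t : CellTree R A.Hom x y) (ht : Valid dg A x y t) :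
    Finsupp.linearCombination R (diff dg x y) (diff dg x y t) = 0 := by
  revert ht
  refine induct (P := fun x y t => Valid dg A x y t →
    Finsupp.linearCombination R (diff dg x y) (diff dg x y t) = 0) ?_ ?_ x y t
  · intro x y i a n c t _ h
    rw [diff_gen_of_valid h, map_sum]
    simpa using ((valid_gen ..).1 h).2.1
  · intro x y w ih h
    replace h := ((valid_graft ..).1 h).2
    refine diff_diff_graft dg w ?_
    induction w with
    | nil => simp only [Chain.All]
    | cons w f ih' =>
      simp only [Chain.All] at ih h ⊢
      exact ⟨ih' ih.1 h.1, ih.2 h.2⟩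

theorem valid_of_mem_support_op (x y : A.Obj) (w : Chain (CellTree R A.Hom) x y)
    (hw : w.All (Valid dg A)) : ∀ r ∈ (op dg x y w).support, Valid dg A x y r := by
  refine op_support dg w _ (fun hn => (valid_graft ..).2 ⟨hn, hw⟩) ?_
  rintro z t s rfl rfl
  simp only [Chain.single, Chain.All] at hw
  intro r hr
  refine mul_support x z t
    (fun y s r => Valid true A _ _ s → Valid true A _ _ r) ?_ ?_ y s r hr hw.2
  · intro z i a n c s h
    rw [valid_graft]
    exact ⟨(isWord_iff ((Chain.single t).cons (gen i a n c s))).2 ⟨_, t, i, a, n, c, s, rfl⟩,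
      by simp only [Chain.single, Chain.All]; exact ⟨hw.1, h⟩⟩
  · intro y' z s i a n c t' r ih h
    rw [valid_graft] at h ⊢
    simp only [Chain.single, Chain.All] at h ⊢
    exact ⟨(isWord_iff ((Chain.single r).cons (gen i a n c t'))).2 ⟨_, r, i, a, n, c, t', rfl⟩,
      ⟨trivial, ih h.2.1.2⟩, h.2.2⟩

theorem valid_of_mem_support_diff (x y : A.Obj) (t : CellTree R A.Hom x y)
    (ht : Valid dg A x y t) : ∀ r ∈ (diff dg x y t).support, Valid dg A x y r := by
  revert ht
  refine induct (P := fun x y t => Valid dg A x y t →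
    ∀ r ∈ (diff dg x y t).support, Valid dg A x y r) ?_ ?_ x y t
  · intro x y i a n c t _ h r hr
    obtain ⟨k, rfl, -⟩ := exists_of_mem_support_diff_gen dg i a n c t r hr
    exact (((valid_gen ..).1 h).1 k).1
  · intro x y w ih h
    have := diff_graft_mem dg w (Finsupp.supported R R {r | Valid dg A x y r}) ?_
    · exact fun r hr => (Finsupp.mem_supported R _).1 this hr
    · rintro hw a b p r q rfl t ht
      refine (Finsupp.mem_supported R _).2 fun u hu => ?_
      have h := ((valid_graft ..).1 h).2
      rw [Chain.all_append, Chain.all_append] at ih h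
      refine valid_of_mem_support_op x y ((p.cons t).append q) ?_ u hu
      rw [Chain.all_append]
      simp only [Chain.All]
      refine ⟨⟨h.1.1, ?_⟩, h.2⟩
      refine ops_support dg r (Valid dg A a b) (valid_of_mem_support_op _ _ _ h.1.2) ?_ t ht
      rintro s rfl
      simp only [Chain.single, Chain.All] at ih h
      exact ih.1.2.2 h.1.2.2

theorem valid_of_mem_support_ops (x y : A.Obj) (w : Chain (CellTree R A.Hom) x y)
    (hw : w.All (Valid dg A)) : ∀ r ∈ (ops dg x y w).support, Valid dg A x y r := by
  refine ops_support dg w (Valid dg A x y) (valid_of_mem_support_op _ _ _ hw) ?_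
  rintro s rfl
  simp only [Chain.single, Chain.All] at hw
  exact valid_of_mem_support_diff x y s hw.2

section Eval

variable (B : AInfCat R) (o : A.Obj → B.Obj)
  (g : ∀ (x y : A.Obj) (i : ℤ) (_ : A.Hom x y i) (n : ℕ) (_ : Fin n → R)
    (_ : Fin n → CellTree R A.Hom x y) (_ : B.Hom (o x) (o y) (i + 1)), B.Hom (o x) (o y) i)

/-- Induction on `s`: associativity in `B` undoes the rebracketing in the definition of `mul`. -/
theorem evalL_mul (hB : AInfCat.IsDG B) (x y : A.Obj) (t : CellTree R A.Hom x y) (z : A.Obj)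
    (s : CellTree R A.Hom y z) (hs : Valid true A y z s) (e : ℤ) :
    evalL B o g x z e (mul y z s x t) = B.m (evalC B o g ((Chain.single t).cons s)) e := by
  suffices h : ∀ y' z (s : CellTree R A.Hom y' z), ∀ hy : y' = y, Valid true A y' z s → ∀ e,
      evalL B o g x z e (mul y z (hy ▸ s) x t) =
        B.m (evalC B o g ((Chain.single t).cons (hy ▸ s))) e from h y z s rfl hs e
  clear hs s z e
  refine induct ?_ ?_
  · rintro _ z i a n c s - rfl - e
    simp only [mul_gen]
    rw [evalL_single, eval_graft]
  · rintro _ z w ih rfl hw e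
    simp only
    rw [valid_graft] at hw
    obtain ⟨y', s, i, a, n, c, t', rfl⟩ := (isWord_iff w).1 hw.1
    have hw := hw.2
    simp only [Chain.single, Chain.All] at ih hw
    have ih := ih.1.2 trivial hw.1.2
    have hv : ∀ r ∈ (mul _ y' s x t).support, sdeg _ _ r = sdeg _ _ t + sdeg _ _ s + 1 := by
      intro r hr
      have := sdeg_of_mem_support_op true _ _ ((Chain.single t).cons s) r hr
      simpa [Chain.sumDeg, Chain.single] using this
    have h1 : evalL B o g x z e (Finsupp.lmapDomain R R
        (fun r => graft ((Chain.single r).cons (gen i a n c t'))) (mul _ y' s x t)) =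
        B.m ((Chain.single ⟨sdeg _ _ t + 1 + (sdeg _ _ s + 1), evalL B o g x y' _
          (mul _ y' s x t)⟩).cons ⟨sdeg _ _ (gen i a n c t') + 1,
            eval B o g _ _ (gen i a n c t') _⟩) e := by
      refine Finsupp.linearMap_eq_of_single (evalL B o g x z e ∘ₗ (Finsupp.lmapDomain R R
        (fun r => graft ((Chain.single r).cons (gen i a n c t')))))
        ((B.slot (Chain.nil _) _ (Chain.single ⟨sdeg _ _ (gen i a n c t') + 1,
            eval B o g _ _ (gen i a n c t') _⟩) e) ∘ₗ evalL B o g x y' _) _ fun r hr => ?_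
      simp only [LinearMap.comp_apply, Finsupp.lmapDomain_apply, Finsupp.mapDomain_single,
        evalL_single, AInfCat.slot_apply, eval_graft]
      rw [show sdeg _ _ t + 1 + (sdeg _ _ s + 1) = sdeg _ _ r + 1 by rw [hv r hr]; ring]
      rfl
    rw [mul_word, Units.smul_def, map_zsmul, h1, ih]
    have h2 := hB.m_assoc (eval B o g _ _ t (sdeg _ _ t + 1)) (eval B o g _ _ s (sdeg _ _ s + 1))
      (eval B o g _ _ (gen i a n c t') (sdeg _ _ (gen i a n c t') + 1)) (sdeg _ _ t + 1 +
        (sdeg _ _ s + 1)) (sdeg _ _ (graft ((Chain.single s).cons (gen i a n c t'))) + 1) e rfl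
        (by rw [sdeg_graft]; simp only [Chain.sumDeg, Chain.single]; ring)
    refine (congrArg (fun v => ((-(sdeg _ _ t).negOnePow : ℤˣ) : ℤ) • v) h2).trans ?_
    rw [Units.smul_def, smul_smul, add_sub_cancel_right, ← Units.val_mul, neg_mul_neg,
      ← Int.negOnePow_add, Int.negOnePow_even _ (by simp), Units.val_one, one_smul]
    simp only [evalC, Chain.map, Chain.single]
    rw [eval_graft]
    rfl

theorem evalL_op (hB : dg = true → AInfCat.IsDG B) {x y : A.Obj}
    (w : Chain (CellTree R A.Hom) x y) (hw : w.All (Valid dg A)) (hl : 2 ≤ w.length) (e : ℤ) :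
    evalL B o g x y e (op dg x y w) = B.m (evalC B o g w) e := by
  cases dg with
  | false => rw [op_of_isNormal false w hl, evalL_single, eval_graft]
  | true =>
    have hB := hB rfl
    by_cases h3 : 3 ≤ w.length
    · rw [op_true_of_three_le _ h3, map_zero, hB _ _ _ _ (by rwa [length_evalC])]
    · cases w with
      | nil => simp [Chain.length] at hl
      | cons w s =>
      cases w with
      | nil => simp [Chain.length] at hl
      | cons w t =>
      cases w with
      | nil =>
        simp only [Chain.All] at hw
        exact evalL_mul B o g hB x _ t y s hw.2 e
      | cons w r => simp [Chain.length] at h3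

/-- The evaluation commutes with the differential. -/
theorem evalL_diff (hB : dg = true → AInfCat.IsDG B)
    (hg : ∀ (x y : A.Obj) (i : ℤ) (a : A.Hom x y i) (n : ℕ) (c : Fin n → R)
      (t : Fin n → CellTree R A.Hom x y), Valid dg A x y (gen i a n c t) →
      B.d _ _ (i + 1) (i + 2) (∑ k, c k • eval B o g x y (t k) (i + 1)) = 0 →
      B.d _ _ i (i + 1) (g x y i a n c t (∑ k, c k • eval B o g x y (t k) (i + 1))) =
        ∑ k, c k • eval B o g x y (t k) (i + 1))
    (x y : A.Obj) (t : CellTree R A.Hom x y) (ht : Valid dg A x y t) (e : ℤ) :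
    evalL B o g x y e (diff dg x y t) =
      B.d _ _ (sdeg x y t + 1) e (eval B o g x y t (sdeg x y t + 1)) := by
  revert ht e
  refine induct (P := fun x y t => Valid dg A x y t → ∀ e,
    evalL B o g x y e (diff dg x y t) =
      B.d _ _ (sdeg x y t + 1) e (eval B o g x y t (sdeg x y t + 1))) ?_ ?_ x y t
  · intro x y i a n c t ih h e
    have hs := sdeg_of_mem_support_diff dg x y (gen i a n c t)
    rw [sdeg_gen, sub_add_cancel] at hs ⊢
    by_cases he : e = i + 1
    · subst he
      rw [eval_gen, hg x y i a n c t h, diff_gen_of_valid h, map_sum]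
      · refine Finset.sum_congr rfl fun k _ => ?_
        simp [evalL]
      -- The value of the boundary is closed: the boundary is a cycle by validity, and evaluation
      -- commutes with the differential on its terms by induction.
      · have h2 := congrArg (evalL B o g x y (i + 2)) ((valid_gen ..).1 h).2.1
        rw [map_zero, map_sum] at h2
        rw [map_sum, ← h2]
        refine Finset.sum_congr rfl fun k _ => ?_
        have hk := ((valid_gen ..).1 h).1 k
        have ihk := ih k hk.1 (i + 2)
        rw [hk.2] at ihk
        rw [map_smul, map_smul, ihk]
    · rw [B.d_eq_zero _ _ _ _ he, LinearMap.zero_apply, evalL_of_ne _ _ _ _ _ _ hs he]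
  · intro x y w ih h e
    rw [valid_graft] at h
    obtain ⟨hn, hw⟩ := h
    -- In the relation of `B` for the values of `w`, the outer operations with at least two
    -- arguments give minus the value of the differential of the graft. The outer differentials give
    -- the differential of the value of the graft.
    have key := evalT_coder B o g (ops dg) w (sdeg_of_mem_support_ops dg) ?_ e
    · have h1 : evalT B o g x y e (Chain.coder sdeg (ops dg) (Finsupp.single w 1)) =
          evalL B o g x y e (Finsupp.linearCombination R (op dg x y)
            (Chain.coder sdeg (ops dg) (Finsupp.single w 1))) +
          Finsupp.linearCombination R (fun t => B.d _ _ (sdeg x y t + 1) e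
            (eval B o g x y t (sdeg x y t + 1)))
              (Chain.π (Chain.coder sdeg (ops dg) (Finsupp.single w 1))) := by
        refine Finsupp.linearMap_eq_of_single (evalT B o g x y e)
          (evalL B o g x y e ∘ₗ (Finsupp.linearCombination R (op dg x y)) +
            (Finsupp.linearCombination R (fun t => B.d _ _ (sdeg x y t + 1) e
            (eval B o g x y t (sdeg x y t + 1)))) ∘ₗ Chain.π) _ fun v hv => ?_
        have hv' : v.All (Valid dg A) := by
          refine (Finsupp.mem_supported R _).1 (Chain.coder_single_mem_supported sdeg (ops dg) w
            {v | v.All (Valid dg A)} ?_) hv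
          rintro a b p r q rfl t ht
          rw [Chain.all_append, Chain.all_append] at hw
          rw [Set.mem_ofPred_eq, Chain.all_append]
          simp only [Chain.All]
          exact ⟨⟨hw.1.1, valid_of_mem_support_ops _ _ _ hw.1.2 t ht⟩, hw.2⟩
        simp only [LinearMap.add_apply, LinearMap.comp_apply, evalT_single, Chain.π_single,
          Finsupp.linearCombination_single, one_smul]
        by_cases hl : 2 ≤ v.length
        · rw [evalL_op B o g hB v hv' hl, Chain.edge_eq_zero _ (by omega), map_zero, add_zero]
        · rw [op_of_length_le_one _ _ (by omega), map_zero, zero_add]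
          cases v with
          | nil => rw [Chain.edge, map_zero]; exact B.m_nil _ _
          | cons v s =>
          cases v with
          | nil =>
            rw [← Chain.single, Chain.edge_single, Finsupp.linearCombination_single, one_smul]
            rfl
          | cons v s' => simp [Chain.length] at hl
      rw [key, Chain.π_coder _ _ _ (ops_nil dg), ops_of_two_le _ _ hn.two_le,
        op_of_isNormal _ _ hn, Finsupp.linearCombination_single, one_smul] at h1
      rw [diff_graft _ _ hn, map_neg]
      exact (eq_neg_of_add_eq_zero_right h1.symm).symm
    · rintro a b p r q rfl e
      rw [Chain.all_append, Chain.all_append] at hw ih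
      by_cases hl : 2 ≤ r.length
      · rw [ops_of_two_le _ _ hl, evalL_op B o g hB r hw.1.2 hl]
      · cases r with
        | nil => rw [ops_nil, map_zero]; exact (B.m_nil _ _).symm
        | cons v s =>
        cases v with
        | nil =>
          simp only [Chain.All] at hw ih
          rw [← Chain.single, ops_single, ih.1.2.2 hw.1.2.2]
          rfl
        | cons v s' => simp [Chain.length] at hl

theorem evalL_ops (hB : dg = true → AInfCat.IsDG B)
    (hg : ∀ (x y : A.Obj) (i : ℤ) (a : A.Hom x y i) (n : ℕ) (c : Fin n → R)
      (t : Fin n → CellTree R A.Hom x y), Valid dg A x y (gen i a n c t) →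
      B.d _ _ (i + 1) (i + 2) (∑ k, c k • eval B o g x y (t k) (i + 1)) = 0 →
      B.d _ _ i (i + 1) (g x y i a n c t (∑ k, c k • eval B o g x y (t k) (i + 1))) =
        ∑ k, c k • eval B o g x y (t k) (i + 1))
    {x y : A.Obj} (w : Chain (CellTree R A.Hom) x y) (hw : w.All (Valid dg A)) (e : ℤ) :
    evalL B o g x y e (ops dg x y w) = B.m (evalC B o g w) e := by
  by_cases hl : 2 ≤ w.length
  · rw [ops_of_two_le _ _ hl, evalL_op B o g hB w hw hl]
  · cases w with
    | nil => rw [ops_nil, map_zero]; exact (B.m_nil _ _).symm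
    | cons v s =>
    cases v with
    | nil =>
      simp only [Chain.All] at hw
      rw [← Chain.single, ops_single, evalL_diff B o g hB hg _ _ _ hw.2]
      rfl
    | cons v s' => simp [Chain.length] at hl

end Eval

end CellTree

-- The resolution as an `A∞`-category

namespace AInfCat

open CellTree

variable {R : Type u} [CommRing R] (dg : Bool) (A : AInfCat R)

/-- The valid trees of a given degree. -/
def cells (x y : A.Obj) (e : ℤ) : Set (CellTree R A.Hom x y) :=
  {t | Valid dg A x y t ∧ sdeg x y t + 1 = e}

/-- The morphisms of the semi-free resolution. -/
abbrev CmHom (x y : A.Obj) (e : ℤ) : Type u :=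
  ↥(Finsupp.supported R R (cells dg A x y e))

variable {dg A}

/-- The tensor product of a string of combinations of trees. -/
noncomputable def ten : ∀ {x y : A.Obj}, Chain (GradedEdge (CmHom dg A)) x y →
    (Chain (CellTree R A.Hom) x y →₀ R)
  | _, _, .nil x => Chain.one R _ x
  | _, _, .cons p f => Chain.conc (ten p) (Chain.ι f.2.1)

theorem ten_append {x y z : A.Obj} (p : Chain (GradedEdge (CmHom dg A)) x y)
    (q : Chain (GradedEdge (CmHom dg A)) y z) :
    ten (p.append q) = Chain.conc (ten p) (ten q) := by
  induction q with
  | nil => rw [Chain.append, ten, Chain.conc_one]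
  | cons q f ih => rw [Chain.append, ten, ten, ih, Chain.conc_assoc]

/-- A tensor product is cut only between its factors, each a combination of single letters. Thus
identities for strings of trees pass to strings of combinations. -/
theorem cut_ten {N : Type u} [AddCommGroup N] [Module R N] {x y : A.Obj}
    (Φ : ∀ z, (Chain (CellTree R A.Hom) x z →₀ R) →ₗ[R] (Chain (CellTree R A.Hom) z y →₀ R) →ₗ[R] N)
    (w : Chain (GradedEdge (CmHom dg A)) x y) :
    Chain.cut Φ (ten w) = (w.splits.map fun s => Φ s.1 (ten s.2.1) (ten s.2.2)).sum := by
  induction w with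
  | nil => simp [ten, Chain.cut_one, Chain.splits]
  | cons p f ih =>
    rw [ten, Chain.cut_conc, ih]
    simp [Chain.splits, ten, Function.comp_def]

theorem conc_mem_supported {x y z : A.Obj} {u : Chain (CellTree R A.Hom) x y →₀ R}
    {v : CellTree R A.Hom y z →₀ R} {S : Set (Chain (CellTree R A.Hom) x y)}
    {T : Set (CellTree R A.Hom y z)} (hu : u ∈ Finsupp.supported R R S)
    (hv : v ∈ Finsupp.supported R R T) :
    Chain.conc u (Chain.ι v) ∈ Finsupp.supported R R {w | ∃ p ∈ S, ∃ t ∈ T, w = p.cons t} := by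
  refine Finsupp.linearMap_mem_of_mem_supported (Chain.conc.flip (Chain.ι v)) _ S (fun p hp => ?_)
    u hu
  refine Finsupp.linearMap_mem_of_mem_supported ((Chain.conc (Finsupp.single p 1)) ∘ₗ Chain.ι) _ T
    (fun t ht => ?_) v hv
  rw [LinearMap.comp_apply, Chain.conc_ι_single]
  exact Finsupp.single_mem_supported R 1 ⟨p, hp, t, ht, rfl⟩

theorem ten_mem {x y : A.Obj} (w : Chain (GradedEdge (CmHom dg A)) x y) :
    ten w ∈ Finsupp.supported R R {p | p.All (Valid dg A) ∧
      p.sumDeg sdeg = w.deg - w.length ∧ p.length = w.length} := by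
  induction w with
  | nil =>
    rw [ten, Chain.one]
    refine Finsupp.single_mem_supported R 1 ?_
    simp [Chain.All, Chain.sumDeg, Chain.deg, Chain.length]
  | cons p f ih =>
    rw [ten]
    refine Finsupp.supported_mono ?_ (conc_mem_supported ih f.2.2)
    rintro _ ⟨q, ⟨h1, h2, h3⟩, t, ⟨ht1, ht2⟩, rfl⟩
    simp only [Set.mem_ofPred_eq, Chain.All, Chain.sumDeg, Chain.deg, Chain.length]
    refine ⟨⟨h1, ht1⟩, ?_, by rw [h3]⟩
    rw [h2, ← ht2]
    push_cast
    ring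

theorem ten_support {x y : A.Obj} (w : Chain (GradedEdge (CmHom dg A)) x y) :
    ∀ p ∈ (ten w).support, p.All (Valid dg A) ∧
      p.sumDeg sdeg = w.deg - w.length ∧ p.length = w.length :=
  fun _ hp => (Finsupp.mem_supported R _).1 (ten_mem w) hp

theorem sgn_ten {x y : A.Obj} (w : Chain (GradedEdge (CmHom dg A)) x y) :
    Chain.sgn sdeg (ten w) = (w.deg - w.length).negOnePow • ten w := by
  rw [Units.smul_def]
  refine Finsupp.linearMap_eq_of_single
    (Chain.sgn sdeg : (Chain (CellTree R A.Hom) x y →₀ R) →ₗ[R] (Chain (CellTree R A.Hom) x y →₀ R))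
    (((w.deg - w.length).negOnePow : ℤ) • LinearMap.id) _ fun p hp => ?_
  rw [Chain.sgn_single, (ten_support w p hp).2.1, Units.smul_def, LinearMap.smul_apply,
    LinearMap.id_apply]

theorem ops_ten_mem {x y : A.Obj} (w : Chain (GradedEdge (CmHom dg A)) x y) (e : ℤ)
    (he : e = w.deg + 2 - w.length) : Finsupp.linearCombination R (ops dg x y) (ten w) ∈
      Finsupp.supported R R (cells dg A x y e) := by
  refine Finsupp.linearMap_mem_of_single _ _ _ fun p hp => ?_
  obtain ⟨h1, h2, -⟩ := ten_support w p hp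
  rw [Finsupp.linearCombination_single, one_smul]
  refine (Finsupp.mem_supported R _).2 fun t ht => ⟨valid_of_mem_support_ops _ _ _ h1 t ht, ?_⟩
  rw [sdeg_of_mem_support_ops _ _ _ _ t ht, h2, he]
  ring

open Classical in
variable (dg A) in
/-- The component of degree `e` of the value of the operations on tensor products of trees. -/
noncomputable def opsL (x y : A.Obj) (e : ℤ) :
    (Chain (CellTree R A.Hom) x y →₀ R) →ₗ[R] CmHom dg A x y e :=
  (Finsupp.restrictDom R R (cells dg A x y e)) ∘ₗ (Finsupp.linearCombination R (ops dg x y))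

theorem opsL_ten {x y : A.Obj} (w : Chain (GradedEdge (CmHom dg A)) x y) (e : ℤ)
    (he : e = w.deg + 2 - w.length) :
    (opsL dg A x y e (ten w)).1 = Finsupp.linearCombination R (ops dg x y) (ten w) := by
  classical
  rw [opsL, LinearMap.comp_apply, Finsupp.restrictDom_apply, Finsupp.filter_eq_self_iff]
  intro t ht
  exact (Finsupp.mem_supported R _).1 (ops_ten_mem w e he) (Finsupp.mem_support_iff.2 ht)

theorem opsL_ten_of_ne {x y : A.Obj} (w : Chain (GradedEdge (CmHom dg A)) x y) (e : ℤ)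
    (he : e ≠ w.deg + 2 - w.length) : opsL dg A x y e (ten w) = 0 := by
  classical
  ext1
  rw [opsL, LinearMap.comp_apply, Finsupp.restrictDom_apply, ZeroMemClass.coe_zero,
    Finsupp.filter_eq_zero_iff]
  intro t ht
  by_contra h
  exact he (ht.2.symm.trans ((Finsupp.mem_supported R _).1 (ops_ten_mem w _ rfl)
    (Finsupp.mem_support_iff.2 h)).2)

theorem diff_diff_edge {x y : A.Obj} (p : Chain (CellTree R A.Hom) x y) (hp : p.All (Valid dg A)) :
    Finsupp.linearCombination R (diff dg x y) (Finsupp.linearCombination R (diff dg x y)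
      (Chain.edge R p)) = 0 := by
  match p, hp with
  | .nil _, _ => simp [Chain.edge]
  | .cons (.nil _) t, h =>
    simp only [Chain.All] at h
    rw [Chain.edge, Finsupp.linearCombination_single, one_smul, diff_diff _ _ t h.2]
  | .cons (.cons _ _) _, _ => simp [Chain.edge]

theorem opsL_coder_ten {x y : A.Obj} (w : Chain (GradedEdge (CmHom dg A)) x y) (e : ℤ) :
    opsL dg A x y e (Chain.coder sdeg (ops dg) (ten w)) = 0 := by
  classical
  rw [opsL, LinearMap.comp_apply, ops_coder]
  have : Finsupp.linearCombination R (diff dg x y) (Finsupp.linearCombination R (diff dg x y)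
      (Chain.π (ten w))) = 0 := by
    refine Finsupp.linearMap_eq_of_single ((Finsupp.linearCombination R (diff dg x y)) ∘ₗ
      (Finsupp.linearCombination R (diff dg x y)) ∘ₗ Chain.π) 0 _ fun p hp => ?_
    simp only [LinearMap.comp_apply, Chain.π_single, LinearMap.zero_apply]
    exact diff_diff_edge p (ten_support w p hp).1
  rw [this, map_zero]

theorem ten_cons_append {x a b y : A.Obj} (p : Chain (GradedEdge (CmHom dg A)) x a) (d : ℤ)
    (f : CmHom dg A a b d) (q : Chain (GradedEdge (CmHom dg A)) b y) :
    ten ((p.cons ⟨d, f⟩).append q) =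
      Chain.conc (Chain.conc (ten p) (Chain.ι f.1)) (ten q) := by
  rw [ten_append, ten]

variable (dg A) in
/-- The semi-free resolution. -/
noncomputable abbrev cm : AInfCat R where
  Obj := A.Obj
  Hom := CmHom dg A
  m w e := opsL dg A _ _ e (ten w)
  m_nil x e := by
    rw [ten, opsL, LinearMap.comp_apply, Chain.one, Finsupp.linearCombination_single, ops_nil,
      smul_zero, map_zero]
  m_deg w e he := opsL_ten_of_ne w e he
  m_add p d f g q e := by
    simp only [ten_cons_append, Submodule.coe_add, map_add, LinearMap.add_apply]
  m_smul p d c f q e := by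
    simp only [ten_cons_append, Submodule.coe_smul, map_smul, LinearMap.smul_apply]
  rel {x y} w e := by
    -- The relation is the corestricted square of the coderivation, evaluated on `ten w` and
    -- expanded over the cuts.
    rw [← opsL_coder_ten w e, Chain.coder, cut_ten, map_list_sum, List.map_map]
    refine congrArg List.sum (List.map_congr_left fun s _ => ?_)
    rw [Function.comp_apply, LinearMap.comp_apply, Chain.coderTail, cut_ten]
    refine Eq.trans ?_ (map_list_sum ((opsL dg A x y e) ∘ₗ (Chain.conc.flip (ten s.2.2))) _).symm
    rw [List.map_map]
    refine congrArg List.sum (List.map_congr_left fun t _ => ?_)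
    rw [Function.comp_apply, LinearMap.compl₁₂_apply, sgn_ten, ten_cons_append,
      opsL_ten _ _ rfl, Units.smul_def, Units.smul_def, map_zsmul, LinearMap.smul_apply, map_zsmul]
    rfl

theorem opsL_ten_of_three_le {x y : A.Obj} (w : Chain (GradedEdge (CmHom true A)) x y) (e : ℤ)
    (hw : 3 ≤ w.length) : opsL true A x y e (ten w) = 0 := by
  classical
  rw [opsL, LinearMap.comp_apply]
  have : Finsupp.linearCombination R (ops true x y) (ten w) = 0 := by
    refine Finsupp.linearMap_eq_of_single _ 0 _ fun p hp => ?_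
    have h := (ten_support w p hp).2.2
    rw [Finsupp.linearCombination_single, one_smul, ops_of_two_le _ _ (by omega),
      op_true_of_three_le _ (by omega), LinearMap.zero_apply]
  rw [this, map_zero]

variable (A) in
theorem isDG_cm : IsDG (cm true A) := by
  intro x y w e hw
  exact opsL_ten_of_three_le (A := A) (x := x) (y := y) w e hw

end AInfCat

theorem Chain.deg_map {Ob Ob' : Type u} {H : Ob → Ob → ℤ → Type u} {H' : Ob' → Ob' → ℤ → Type u}
    (o : Ob → Ob') (φ : ∀ x y i, H x y i → H' (o x) (o y) i) {x y : Ob}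
    (w : Chain (GradedEdge H) x y) :
    (w.map (E' := GradedEdge H') o fun x y f => ⟨f.1, φ x y f.1 f.2⟩).deg = w.deg := by
  induction w with
  | nil => simp only [map, deg]
  | cons q f ih => simp only [map, deg, ih]

-- Strict functors out of the resolution

namespace AInfCat

open CellTree

variable {R : Type u} [CommRing R] {dg : Bool} {A : AInfCat R}

section EvalFunctor

variable (B : AInfCat R) (o : A.Obj → B.Obj)
  (g : ∀ (x y : A.Obj) (i : ℤ) (_ : A.Hom x y i) (n : ℕ) (_ : Fin n → R)
    (_ : Fin n → CellTree R A.Hom x y) (_ : B.Hom (o x) (o y) (i + 1)), B.Hom (o x) (o y) i)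

variable (dg) in
/-- The values of cells are compatible with the differential. -/
def Compatible : Prop :=
  ∀ (x y : A.Obj) (i : ℤ) (a : A.Hom x y i) (n : ℕ) (c : Fin n → R)
      (t : Fin n → CellTree R A.Hom x y), Valid dg A x y (gen i a n c t) →
      B.d _ _ (i + 1) (i + 2) (∑ k, c k • eval B o g x y (t k) (i + 1)) = 0 →
      B.d _ _ i (i + 1) (g x y i a n c t (∑ k, c k • eval B o g x y (t k) (i + 1))) =
        ∑ k, c k • eval B o g x y (t k) (i + 1)

/-- The last factor is expanded into trees, which are moved into `q` one at a time; therefore `q`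
has to be arbitrary in the induction. -/
theorem evalT_ten_append {x y : A.Obj} (w : Chain (GradedEdge (CmHom dg A)) x y) :
    ∀ {z : A.Obj} (q : Chain (CellTree R A.Hom) y z) (e : ℤ),
      evalT B o g x z e (Chain.conc (ten w) (Finsupp.single q 1)) =
        B.m ((w.map (E' := GradedEdge B.Hom) o
          (fun x y f => ⟨f.1, evalL B o g x y f.1 f.2.1⟩)).append (evalC B o g q)) e := by
  induction w with
  | nil =>
    intro z q e
    rw [ten, Chain.one_conc, evalT_single, Chain.map, Chain.nil_append]
  | @cons y a p f ih =>
    intro z q e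
    rw [ten, Chain.map]
    refine Finsupp.linearMap_eq_of_single (evalT B o g x z e ∘ₗ
      (Chain.conc.flip (Finsupp.single q 1)) ∘ₗ (Chain.conc (ten p)) ∘ₗ Chain.ι)
      ((B.slot _ f.1 (evalC B o g q) e) ∘ₗ (evalL B o g _ _ f.1)) f.2.1 fun t ht => ?_
    obtain ⟨-, ht⟩ := (Finsupp.mem_supported R _).1 f.2.2 ht
    simp only [LinearMap.comp_apply, LinearMap.flip_apply, AInfCat.slot_apply, evalL_single]
    rw [Chain.conc_assoc, Chain.ι_single, Chain.conc_single, ih, evalC_append, ← ht]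
    rw [← Chain.append_assoc]
    rfl

theorem evalL_opsL {x y : A.Obj} (hB : dg = true → IsDG B) (hg : Compatible dg B o g)
    (w : Chain (GradedEdge (CmHom dg A)) x y) (e : ℤ) :
    evalL B o g x y e (opsL dg A x y e (ten w)).1 =
      B.m (w.map (E' := GradedEdge B.Hom) o
        (fun x y f => ⟨f.1, evalL B o g x y f.1 f.2.1⟩)) e := by
  by_cases he : e = w.deg + 2 - w.length
  · have h := evalT_ten_append B o g w (.nil y) e
    rw [← Chain.one, Chain.conc_one] at h
    rw [opsL_ten w e he]
    refine Eq.trans ?_ h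
    refine Finsupp.linearMap_eq_of_single ((evalL B o g x y e) ∘ₗ
      (Finsupp.linearCombination R (ops dg x y))) (evalT B o g x y e) _ fun p hp => ?_
    rw [LinearMap.comp_apply, Finsupp.linearCombination_single, one_smul, evalT_single,
      evalL_ops B o g hB hg p (ten_support w p hp).1]
  · rw [opsL_ten_of_ne w e he, ZeroMemClass.coe_zero, map_zero, B.m_deg]
    rwa [Chain.length_map,
      Chain.deg_map o fun x y i (f : CmHom dg A x y i) => evalL B o g x y i f.1]

/-- The functor on the semi-free resolution with given values on cells. -/
noncomputable abbrev evalFunctor (hB : dg = true → IsDG B) (hg : Compatible dg B o g) :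
    StrictFunctor (cm dg A) B where
  obj := o
  map x y e := evalL B o g x y e ∘ₗ Submodule.subtype _
  map_m w e := evalL_opsL B o g hB hg w e

end EvalFunctor

/-- A valid tree as a morphism of the semi-free resolution. -/
noncomputable def basis {x y : A.Obj} {e : ℤ} (t : CellTree R A.Hom x y)
    (ht : t ∈ cells dg A x y e) : CmHom dg A x y e :=
  ⟨Finsupp.single t 1, Finsupp.single_mem_supported R 1 ht⟩

theorem cmHom_ext {x y : A.Obj} {e : ℤ} {N : Type u} [AddCommGroup N] [Module R N]
    {f g : CmHom dg A x y e →ₗ[R] N} (h : ∀ t ht, f (basis t ht) = g (basis t ht)) : f = g := by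
  ext v
  obtain ⟨v', hv', hv⟩ := Finsupp.linearMap_mem_of_mem_supported LinearMap.id
    ((LinearMap.eqLocus f g).map (Submodule.subtype _)) _
    (fun t ht => ⟨basis t ht, h t ht, rfl⟩) v.1 v.2
  obtain rfl : v' = v := Subtype.ext hv
  exact hv'

/-- Lifts a string of valid trees to a string of morphisms of the resolution. A normal graft thereby
becomes the value of an operation, to which `map_m` of a strict functor applies. -/
theorem ten_map {x y : A.Obj} (w : Chain (CellTree R A.Hom) x y) (hw : w.All (Valid dg A)) :
    ∃ w' : Chain (GradedEdge (CmHom dg A)) x y, ten w' = Finsupp.single w 1 ∧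
      w'.deg = w.sumDeg sdeg + w.length ∧ w'.length = w.length ∧
      ∀ (B : AInfCat R) (F : StrictFunctor (cm dg A) B) (g : ∀ (x y : A.Obj) (i : ℤ)
        (_ : A.Hom x y i) (n : ℕ) (_ : Fin n → R) (_ : Fin n → CellTree R A.Hom x y)
        (_ : B.Hom (F.obj x) (F.obj y) (i + 1)), B.Hom (F.obj x) (F.obj y) i),
        (w.All fun x y t => ∀ e ht, F.map x y e (basis t ht) = eval B F.obj g x y t e) →
        w'.map (E' := GradedEdge B.Hom) F.obj (fun x y f => ⟨f.1, F.map x y f.1 f.2⟩) =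
          evalC B F.obj g w := by
  induction w with
  | nil =>
    refine ⟨.nil _, by rw [ten, Chain.one], ?_⟩
    simp [Chain.deg, Chain.sumDeg, Chain.length, Chain.map, evalC]
  | cons p t ih =>
    simp only [Chain.All] at hw
    obtain ⟨w', h1, h2, h3, h4⟩ := ih hw.1
    refine ⟨w'.cons ⟨_, basis t ⟨hw.2, rfl⟩⟩, ?_, ?_, ?_, ?_⟩
    · rw [ten, h1]
      exact Chain.conc_ι_single p t
    · simp only [Chain.deg, Chain.sumDeg, Chain.length, h2]
      push_cast
      ring
    · simp only [Chain.length, h3]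
    · intro B F g h
      simp only [Chain.All] at h
      rw [Chain.map, h4 B F g h.1]
      exact congrArg (fun f => (evalC B F.obj g p).cons
        (⟨sdeg _ _ t + 1, f⟩ : GradedEdge B.Hom _ _)) (h.2 _ ⟨hw.2, rfl⟩)

/-- A functor on the semi-free resolution is determined by its values on cells. -/
theorem map_basis_eq_eval {B : AInfCat R} (F : StrictFunctor (cm dg A) B)
    (g : ∀ (x y : A.Obj) (i : ℤ) (_ : A.Hom x y i) (n : ℕ) (_ : Fin n → R)
      (_ : Fin n → CellTree R A.Hom x y) (_ : B.Hom (F.obj x) (F.obj y) (i + 1)),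
      B.Hom (F.obj x) (F.obj y) i)
    (h : ∀ (x y : A.Obj) (i : ℤ) (a : A.Hom x y i) (n : ℕ) (c : Fin n → R)
      (t : Fin n → CellTree R A.Hom x y) (ht : gen i a n c t ∈ cells dg A x y i)
      (hk : ∀ k, t k ∈ cells dg A x y (i + 1)),
      F.map x y i (basis _ ht) =
        g x y i a n c t (F.map x y (i + 1) (∑ k, c k • basis (t k) (hk k))))
    (x y : A.Obj) (t : CellTree R A.Hom x y) (e : ℤ) (ht : t ∈ cells dg A x y e) :
    F.map x y e (basis t ht) = eval B F.obj g x y t e := by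
  revert e
  refine induct (P := fun x y t => ∀ e (ht : t ∈ cells dg A x y e),
    F.map x y e (basis t ht) = eval B F.obj g x y t e) ?_ ?_ x y t
  · intro x y i a n c t ih e ht
    obtain rfl : i = e := by
      have := ht.2
      rw [sdeg_gen] at this
      linarith
    have hk : ∀ k, t k ∈ cells dg A x y (i + 1) := fun k =>
      ⟨(((valid_gen ..).1 ht.1).1 k).1, by rw [(((valid_gen ..).1 ht.1).1 k).2]⟩
    rw [h x y i a n c t ht hk, eval_gen, map_sum]
    refine congrArg _ (Finset.sum_congr rfl fun k _ => ?_)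
    rw [map_smul, ih k]
  · intro x y w ih e ht
    obtain ⟨hv, hd⟩ := ht
    have hw := (valid_graft ..).1 hv
    obtain ⟨w', h1, h2, h3, h4⟩ := ten_map w hw.2
    rw [sdeg_graft] at hd
    have hb : basis (graft w) ⟨hv, by rw [sdeg_graft]; exact hd⟩ = opsL dg A x y e (ten w') := by
      refine Subtype.ext ?_
      rw [opsL_ten w' e (by rw [h2, h3, ← hd]; ring), h1, Finsupp.linearCombination_single,
        one_smul,
        ops_of_two_le _ _ hw.1.two_le, op_of_isNormal _ _ hw.1]
      rfl
    rw [hb, eval_graft]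
    refine (F.map_m (x := x) (y := y) w' e).trans (congrArg (fun w => B.m w e) (h4 B F g ?_))
    refine ih

end AInfCat

-- Cells as morphisms, the projection and functoriality

namespace AInfCat

open CellTree

variable {R : Type u} [CommRing R]

/-- Trees are built from cells by operations, which strict functors preserve, so a match on cells
suffices. The match is required for every `v`, so no validity enters. -/
theorem StrictFunctor.map_eval {Ob : Type u} {H : Ob → Ob → ℤ → Type u} {C B : AInfCat R}
    (G : StrictFunctor C B) (o : Ob → C.Obj)
    (g : ∀ (x y : Ob) (i : ℤ) (_ : H x y i) (n : ℕ) (_ : Fin n → R)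
      (_ : Fin n → CellTree R H x y) (_ : C.Hom (o x) (o y) (i + 1)), C.Hom (o x) (o y) i)
    (g' : ∀ (x y : Ob) (i : ℤ) (_ : H x y i) (n : ℕ) (_ : Fin n → R)
      (_ : Fin n → CellTree R H x y) (_ : B.Hom (G.obj (o x)) (G.obj (o y)) (i + 1)),
      B.Hom (G.obj (o x)) (G.obj (o y)) i)
    (h : ∀ x y i a n c t v,
      G.map _ _ i (g x y i a n c t v) = g' x y i a n c t (G.map _ _ (i + 1) v))
    (x y : Ob) (t : CellTree R H x y) (e : ℤ) :
    G.map _ _ e (eval C o g x y t e) = eval B (fun x => G.obj (o x)) g' x y t e := by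
  revert e
  refine induct (P := fun x y t => ∀ e,
    G.map _ _ e (eval C o g x y t e) = eval B (fun x => G.obj (o x)) g' x y t e) ?_ ?_ x y t
  · intro x y i a n c t ih e
    by_cases he : i = e
    · subst he
      rw [eval_gen, eval_gen, h, map_sum]
      refine congrArg _ (Finset.sum_congr rfl fun k _ => ?_)
      rw [map_smul, ih k]
    · have hs : e ≠ sdeg x y (gen i a n c t) + 1 := by
        rw [sdeg_gen, sub_add_cancel]
        exact Ne.symm he
      rw [eval_of_ne _ _ _ _ _ _ _ hs, eval_of_ne _ _ _ _ _ _ _ hs, map_zero]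
  · intro x y w ih e
    rw [eval_graft, eval_graft, G.map_m]
    refine congrArg (fun w => B.m w e) ?_
    rw [evalC, Chain.map_map, evalC]
    clear e
    induction w with
    | nil => simp only [Chain.map]
    | cons p t ih' =>
      simp only [Chain.All] at ih
      rw [Chain.map, Chain.map, ih' ih.1, ih.2]

variable {dg : Bool} {A : AInfCat R}

theorem cm_d {x y : A.Obj} (i : ℤ) (v : CmHom dg A x y i) :
    ((cm dg A).d x y i (i + 1) v).1 = Finsupp.linearCombination R (diff dg x y) v.1 := by
  refine (opsL_ten (Chain.single ⟨i, v⟩) (i + 1) ?_).trans ?_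
  · simp only [Chain.single, Chain.deg, Chain.length]
    push_cast
    ring
  · rw [Chain.single, ten, ten, Chain.one_conc, linearCombination_ops_ι]

/-- The projection of the semi-free resolution. -/
noncomputable def proj (x y : A.Obj) (e : ℤ) : CmHom dg A x y e →ₗ[R] A.Hom x y e :=
  evalL A (fun x => x) (fun _ _ _ a _ _ _ _ => a) x y e ∘ₗ Submodule.subtype _

theorem proj_basis {x y : A.Obj} {e : ℤ} (t : CellTree R A.Hom x y) (ht : t ∈ cells dg A x y e) :
    proj x y e (basis t ht) = val A x y t e := by
  rw [val, ← evalL_single]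
  rfl

theorem compatible_proj :
    Compatible dg A (fun x => x) (fun x y i (a : A.Hom x y i) _ _ _ _ => a) :=
  fun _ _ _ _ _ _ _ h _ => ((valid_gen ..).1 h).2.2.1.symm

variable (A) in
/-- The projection of the semi-free resolution, as a functor. -/
noncomputable abbrev cmProj (hA : dg = true → IsDG A) : StrictFunctor (cm dg A) A :=
  evalFunctor A (fun x => x) (fun _ _ _ a _ _ _ _ => a) hA compatible_proj

theorem linearCombination_diff_eq_zero_iff {x y : A.Obj} {i j : ℤ} (h : i + 1 = j)
    (v : CmHom dg A x y i) :
    Finsupp.linearCombination R (diff dg x y) v.1 = 0 ↔ (cm dg A).d x y i j v = 0 := by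
  subst h
  rw [← cm_d]
  exact ZeroMemClass.coe_eq_zero

/-- The morphism given by a cell. -/
noncomputable def cellHom {x y : A.Obj} {i : ℤ} (a : A.Hom x y i) (z : CmHom dg A x y (i + 1))
    (h1 : Finsupp.linearCombination R (diff dg x y) z.1 = 0)
    (h2 : proj x y (i + 1) z = A.d x y i (i + 1) a) : CmHom dg A x y i :=
  basis (cell i a z.1) ⟨valid_cell
    (fun _ ht => ⟨((Finsupp.mem_supported R _).1 z.2 ht).1,
      add_right_cancel ((Finsupp.mem_supported R _).1 z.2 ht).2⟩)
    h1 h2, by rw [cell, sdeg_gen, sub_add_cancel]⟩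

theorem d_basis_gen {x y : A.Obj} {i : ℤ} {a : A.Hom x y i} {n : ℕ} {c : Fin n → R}
    {t : Fin n → CellTree R A.Hom x y} (ht : gen i a n c t ∈ cells dg A x y i) :
    ((cm dg A).d x y i (i + 1) (basis _ ht)).1 = ∑ k, Finsupp.single (t k) (c k) := by
  rw [cm_d, basis, Finsupp.linearCombination_single, one_smul, diff_gen_of_valid ht.1]

theorem proj_basis_gen {x y : A.Obj} {i : ℤ} {a : A.Hom x y i} {n : ℕ} {c : Fin n → R}
    {t : Fin n → CellTree R A.Hom x y} (ht : gen i a n c t ∈ cells dg A x y i) :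
    proj x y i (basis _ ht) = a := by
  rw [proj_basis, val, eval_gen]

theorem d_cellHom {x y : A.Obj} {i : ℤ} (a : A.Hom x y i) (z : CmHom dg A x y (i + 1))
    (h1 : Finsupp.linearCombination R (diff dg x y) z.1 = 0)
    (h2 : proj x y (i + 1) z = A.d x y i (i + 1) a) :
    (cm dg A).d x y i (i + 1) (cellHom a z h1 h2) = z :=
  Subtype.ext ((d_basis_gen _).trans (Finsupp.sum_single_enum z.1))

theorem proj_cellHom {x y : A.Obj} {i : ℤ} (a : A.Hom x y i) (z : CmHom dg A x y (i + 1))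
    (h1 : Finsupp.linearCombination R (diff dg x y) z.1 = 0)
    (h2 : proj x y (i + 1) z = A.d x y i (i + 1) a) :
    proj x y i (cellHom a z h1 h2) = a :=
  proj_basis_gen _

theorem coe_sum_basis {x y : A.Obj} {i : ℤ} {n : ℕ} (c : Fin n → R)
    (t : Fin n → CellTree R A.Hom x y) (hk : ∀ k, t k ∈ cells dg A x y i) :
    (∑ k, c k • basis (t k) (hk k)).1 = ∑ k, Finsupp.single (t k) (c k) := by
  rw [AddSubmonoidClass.coe_finsetSum]
  refine Finset.sum_congr rfl fun k _ => ?_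
  rw [Submodule.coe_smul, basis, Finsupp.smul_single, smul_eq_mul, mul_one]

/-- The enumeration clause of `Valid` enters here: a valid cell is recovered from its boundary. -/
theorem basis_gen {x y : A.Obj} {i : ℤ} {a : A.Hom x y i} {n : ℕ} {c : Fin n → R}
    {t : Fin n → CellTree R A.Hom x y} (ht : gen i a n c t ∈ cells dg A x y i)
    (hk : ∀ k, t k ∈ cells dg A x y (i + 1)) :
    ∃ h1 h2, basis _ ht = cellHom a (∑ k, c k • basis (t k) (hk k)) h1 h2 := by
  have hv := (valid_gen ..).1 ht.1
  refine ⟨?_, ?_, Subtype.ext ?_⟩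
  · rw [coe_sum_basis, map_sum, ← hv.2.1]
    simp
  · rw [← hv.2.2.1, map_sum]
    refine Finset.sum_congr rfl fun k _ => ?_
    rw [map_smul, proj_basis]
  · refine Eq.trans ?_ (congrArg (fun z => Finsupp.single (cell i a z) 1)
      (coe_sum_basis c t hk).symm)
    rw [cell_of_valid ht.1]
    rfl

open Classical in
/-- A morphism over `a`, with boundary `z` if possible. -/
noncomputable def attach {x y : A.Obj} {i : ℤ} (a : A.Hom x y i) (z : CmHom dg A x y (i + 1)) :
    CmHom dg A x y i :=
  if h : Finsupp.linearCombination R (diff dg x y) z.1 = 0 ∧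
      proj x y (i + 1) z = A.d x y i (i + 1) a then cellHom a z h.1 h.2
  -- The default value also lies over `a`, so that `proj_attach` needs no hypothesis. Its boundary
  -- is the cell over `d a` with boundary zero.
  else cellHom a (cellHom (A.d x y i (i + 1) a) 0 (by rw [ZeroMemClass.coe_zero, map_zero])
    (by rw [A.d_comp_d, map_zero])) (by rw [← cm_d, d_cellHom, ZeroMemClass.coe_zero])
    (proj_cellHom ..)

theorem attach_eq_cellHom {x y : A.Obj} {i : ℤ} (a : A.Hom x y i) (z : CmHom dg A x y (i + 1))
    (h1 : Finsupp.linearCombination R (diff dg x y) z.1 = 0)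
    (h2 : proj x y (i + 1) z = A.d x y i (i + 1) a) : attach a z = cellHom a z h1 h2 :=
  dif_pos ⟨h1, h2⟩

theorem proj_attach {x y : A.Obj} {i : ℤ} (a : A.Hom x y i) (z : CmHom dg A x y (i + 1)) :
    proj x y i (attach a z) = a := by
  rw [attach]
  split_ifs <;> exact proj_cellHom ..

section Map

variable {B : AInfCat R} (F : StrictFunctor A B)

/-- Both sides are the evaluation in `B` that gives the cell over `a` the value `F a`. -/
theorem proj_eval (hB : dg = true → IsDG B) (x y : A.Obj) (t : CellTree R A.Hom x y) (e : ℤ) :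
    proj _ _ e (eval (cm dg B) F.obj (fun x y i a _ _ _ v => attach (F.map x y i a) v) x y t e) =
      F.map x y e (val A x y t e) :=
  ((cmProj B hB).map_eval F.obj (fun x y i a _ _ _ v => attach (F.map x y i a) v)
    (fun x y i a _ _ _ _ => F.map x y i a) (fun _ _ _ _ _ _ _ _ => proj_attach ..) x y t e).trans
    (F.map_eval (fun x => x) (fun _ _ _ a _ _ _ _ => a) (fun x y i a _ _ _ _ => F.map x y i a)
      (fun _ _ _ _ _ _ _ _ => rfl) x y t e).symm

theorem compatible_attach (hB : dg = true → IsDG B) :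
    Compatible dg (cm dg B) F.obj (fun x y i a _ _ _ v => attach (F.map x y i a) v) := by
  intro x y i a n c t h h0
  have h1 := (linearCombination_diff_eq_zero_iff (by ring) _).2 h0
  refine (congrArg _ (attach_eq_cellHom _ _ h1 ?_)).trans (d_cellHom ..)
  rw [map_sum, ← F.map_d, ← ((valid_gen ..).1 h).2.2.1, map_sum]
  refine Finset.sum_congr rfl fun k _ => ?_
  rw [map_smul, map_smul, proj_eval F hB]

/-- The functor induced on semi-free resolutions. -/
noncomputable abbrev cmMap (hB : dg = true → IsDG B) : StrictFunctor (cm dg A) (cm dg B) :=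
  evalFunctor (cm dg B) F.obj (fun x y i a _ _ _ v => attach (F.map x y i a) v)
    (by rintro rfl; exact isDG_cm B) (compatible_attach F hB)

theorem cmMap_basis (hB : dg = true → IsDG B) {x y : A.Obj} {e : ℤ} (t : CellTree R A.Hom x y)
    (ht : t ∈ cells dg A x y e) : (cmMap F hB).map x y e (basis t ht) =
      eval (cm dg B) F.obj (fun x y i a _ _ _ v => attach (F.map x y i a) v) x y t e :=
  evalL_single ..

theorem proj_cmMap (hB : dg = true → IsDG B) {x y : A.Obj} {e : ℤ} (v : CmHom dg A x y e) :
    proj _ _ e ((cmMap F hB).map x y e v) = F.map x y e (proj x y e v) := by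
  refine LinearMap.congr_fun (f := proj _ _ e ∘ₗ (cmMap F hB).map x y e)
    (g := F.map x y e ∘ₗ proj x y e) (cmHom_ext fun t ht => ?_) v
  refine (congrArg (proj _ _ e) (cmMap_basis F hB t ht)).trans ((proj_eval F hB x y t e).trans ?_)
  rw [LinearMap.comp_apply, proj_basis]

theorem cmMap_basis_gen (hB : dg = true → IsDG B) {x y : A.Obj} {i : ℤ} {a : A.Hom x y i} {n : ℕ}
    {c : Fin n → R} {t : Fin n → CellTree R A.Hom x y} (ht : gen i a n c t ∈ cells dg A x y i)
    (hk : ∀ k, t k ∈ cells dg A x y (i + 1)) : (cmMap F hB).map x y i (basis _ ht) =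
      attach (F.map x y i a) ((cmMap F hB).map x y (i + 1) (∑ k, c k • basis (t k) (hk k))) := by
  rw [cmMap_basis, eval_gen, map_sum]
  refine congrArg _ (Finset.sum_congr rfl fun k _ => ?_)
  rw [map_smul]
  exact congrArg (c k • ·) (cmMap_basis F hB _ _).symm

/-- The image of `z` is again a cycle over the boundary of `F a`, so the first branch of `attach`
applies. No choice remains in the image of a cell, and compatibility with composition follows. -/
theorem cmMap_cellHom (hB : dg = true → IsDG B) {x y : A.Obj} {i : ℤ} (a : A.Hom x y i)
    (z : CmHom dg A x y (i + 1)) (h1 : Finsupp.linearCombination R (diff dg x y) z.1 = 0)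
    (h2 : proj x y (i + 1) z = A.d x y i (i + 1) a) :
    ∃ h1' h2', (cmMap F hB).map x y i (cellHom a z h1 h2) =
      cellHom (F.map x y i a) ((cmMap F hB).map x y (i + 1) z) h1' h2' := by
  have h1' : Finsupp.linearCombination R (diff dg _ _) ((cmMap F hB).map x y (i + 1) z).1 = 0 := by
    rw [linearCombination_diff_eq_zero_iff rfl] at h1
    refine (linearCombination_diff_eq_zero_iff rfl _).2 ?_
    have := (cmMap F hB).map_d x y (i + 1) (i + 1 + 1) z
    rw [h1, map_zero] at this
    exact this.symm
  have h2' : proj _ _ (i + 1) ((cmMap F hB).map x y (i + 1) z) =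
      B.d _ _ i (i + 1) (F.map x y i a) := by
    rw [proj_cmMap, h2, F.map_d]
  refine ⟨h1', h2', ?_⟩
  refine Eq.trans ?_ (attach_eq_cellHom _ _ h1' h2')
  refine (cmMap_basis_gen F hB _ fun k => (Finsupp.mem_supported R _).1 z.2
    (Finsupp.enum_mem_support z.1 k)).trans ?_
  refine congrArg (fun z => attach (F.map x y i a) ((cmMap F hB).map x y (i + 1) z))
    (Subtype.ext ?_)
  rw [coe_sum_basis, Finsupp.sum_single_enum]

end Map

/-- The identity also sends the cell of `(a, z)` to itself, and a functor is determined by such a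
recursion on cells. -/
theorem cmMap_id (hA : dg = true → IsDG A) : cmMap (dg := dg) (𝟙 A : A ⟶ A) hA = 𝟙 (cm dg A) := by
  refine StrictFunctor.ext rfl (heq_of_eq (funext fun x => funext fun y => funext fun e =>
    cmHom_ext fun t ht => ?_))
  refine (cmMap_basis _ _ _ _).trans (map_basis_eq_eval (𝟙 (cm dg A) : cm dg A ⟶ cm dg A) _ ?_
    x y t e ht).symm
  intro x y i a n c t ht hk
  obtain ⟨h1, h2, h⟩ := basis_gen ht hk
  refine h.trans ?_
  rw [← attach_eq_cellHom]
  rfl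

theorem cmMap_comp {B C : AInfCat R} (F : A ⟶ B) (G : B ⟶ C) (hB : dg = true → IsDG B)
    (hC : dg = true → IsDG C) :
    cmMap (dg := dg) (@CategoryStruct.comp (AInfCat R) _ A B C F G) hC =
      @CategoryStruct.comp (AInfCat R) _ (cm dg A) (cm dg B) (cm dg C) (cmMap F hB)
        (cmMap G hC) := by
  refine StrictFunctor.ext rfl (heq_of_eq (funext fun x => funext fun y => funext fun e =>
    cmHom_ext fun t ht => ?_))
  let K : cm dg A ⟶ cm dg C :=
    (cmMap F hB : cm dg A ⟶ cm dg B) ≫ (cmMap G hC : cm dg B ⟶ cm dg C)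
  refine (cmMap_basis _ _ _ _).trans (map_basis_eq_eval K _ ?_ x y t e ht).symm
  intro x y i a n c t ht hk
  obtain ⟨h1, h2, h⟩ := basis_gen ht hk
  obtain ⟨h1', h2', h'⟩ := cmMap_cellHom F hB a _ h1 h2
  obtain ⟨h1'', h2'', h''⟩ := cmMap_cellHom G hC _ _ h1' h2'
  rw [h]
  refine (congrArg ((cmMap G hC).map _ _ i) h').trans (h''.trans ?_)
  rw [← attach_eq_cellHom]
  rfl

theorem cmMap_comp_cmProj {B : AInfCat R} (F : A ⟶ B) (hA : dg = true → IsDG A)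
    (hB : dg = true → IsDG B) :
    (cmMap F hB : cm dg A ⟶ cm dg B) ≫ cmProj B hB = (cmProj A hA : cm dg A ⟶ A) ≫ F :=
  StrictFunctor.ext rfl (heq_of_eq (funext fun _ => funext fun _ => funext fun _ =>
    LinearMap.ext fun v => proj_cmMap F hB v))

/-- The lifting property that characterizes surjective quasi-isomorphisms. -/
def StrictFunctor.LiftsBoundaries {C B : AInfCat R} (G : StrictFunctor C B) : Prop :=
  ∀ (x y : C.Obj) (i j k : ℤ) (_ : i + 1 = j) (_ : j + 1 = k) (a : B.Hom (G.obj x) (G.obj y) i)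
    (z : C.Hom x y j), C.d x y j k z = 0 → G.map x y j z = B.d _ _ i j a →
    ∃ l : C.Hom x y i, C.d x y i j l = z ∧ G.map x y i l = a

/-- The cell over `a` with boundary `z` is the required lift. -/
theorem liftsBoundaries_cmProj (hA : dg = true → IsDG A) :
    (cmProj A hA : StrictFunctor (cm dg A) A).LiftsBoundaries := by
  intro x y i j k hj hk a z h1 h2
  subst hj hk
  have h1 := (linearCombination_diff_eq_zero_iff (A := A) (x := x) (y := y) rfl z).2 h1
  exact ⟨cellHom (dg := dg) (A := A) (x := x) (y := y) a z h1 h2,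
    d_cellHom (dg := dg) (A := A) (x := x) (y := y) a z h1 h2,
    proj_cellHom (dg := dg) (A := A) (x := x) (y := y) a z h1 h2⟩

end AInfCat

-- Quasi-isomorphisms in terms of elements

namespace CochainComplex

variable {R : Type u} [CommRing R] {K L : CochainComplex (ModuleCat.{u} R) ℤ}

theorem iCycles_injective (K : CochainComplex (ModuleCat.{u} R) ℤ) (i : ℤ) :
    Function.Injective (K.iCycles i) :=
  (ModuleCat.mono_iff_injective _).1 inferInstance

theorem homologyπ_surjective (K : CochainComplex (ModuleCat.{u} R) ℤ) (i : ℤ) :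
    Function.Surjective (K.homologyπ i) :=
  (ModuleCat.epi_iff_surjective _).1 inferInstance

theorem exists_iCycles_eq {i j : ℤ} (h : i + 1 = j) (z : K.X i) (hz : K.d i j z = 0) :
    ∃ c : K.cycles i, K.iCycles i c = z := by
  have h1 := ShortComplex.exact_of_f_is_kernel (.mk (K.iCycles i) (K.d i j) (by simp))
    (K.cyclesIsKernel i j (ComplexShape.next_eq' _ h))
  exact (ShortComplex.moduleCat_exact_iff _).1 h1 z hz

theorem d_iCycles (i j : ℤ) (c : K.cycles i) : K.d i j (K.iCycles i c) = 0 := by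
  rw [← ModuleCat.comp_apply, HomologicalComplex.iCycles_d]
  rfl

theorem homologyπ_eq_zero_iff {i j : ℤ} (h : i + 1 = j) (c : K.cycles j) :
    K.homologyπ j c = 0 ↔ ∃ a : K.X i, K.d i j a = K.iCycles j c := by
  constructor
  · intro hc
    have h1 := ShortComplex.exact_of_g_is_cokernel (.mk (K.toCycles i j) (K.homologyπ j) (by simp))
      (K.homologyIsCokernel i j (ComplexShape.prev_eq' _ h))
    obtain ⟨a, ha⟩ := (ShortComplex.moduleCat_exact_iff _).1 h1 c hc
    refine ⟨a, ?_⟩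
    rw [← K.toCycles_i, ModuleCat.comp_apply]
    exact congrArg _ ha
  · rintro ⟨a, ha⟩
    rw [← K.toCycles_i, ModuleCat.comp_apply] at ha
    rw [← iCycles_injective K j ha, ← ModuleCat.comp_apply, K.toCycles_comp_homologyπ]
    rfl

theorem iCycles_cyclesMap (f : K ⟶ L) (i : ℤ) (c : K.cycles i) :
    L.iCycles i (HomologicalComplex.cyclesMap f i c) = f.f i (K.iCycles i c) := by
  rw [← ModuleCat.comp_apply, ← ModuleCat.comp_apply, HomologicalComplex.cyclesMap_i]

theorem homologyMap_homologyπ (f : K ⟶ L) (i : ℤ) (c : K.cycles i) :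
    HomologicalComplex.homologyMap f i (K.homologyπ i c) =
      L.homologyπ i (HomologicalComplex.cyclesMap f i c) := by
  rw [← ModuleCat.comp_apply, ← ModuleCat.comp_apply, HomologicalComplex.homologyπ_naturality]

/-- A criterion for quasi-isomorphisms in terms of elements. -/
theorem quasiIso_iff_exists (f : K ⟶ L) : QuasiIso f ↔ ∀ i j k : ℤ, i + 1 = j → j + 1 = k →
    (∀ (z : K.X j) (a : L.X i), K.d j k z = 0 → f.f j z = L.d i j a → ∃ l, K.d i j l = z) ∧
    (∀ b : L.X j, L.d j k b = 0 →
      ∃ (c : K.X j) (a : L.X i), K.d j k c = 0 ∧ f.f j c = b + L.d i j a) := by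
  constructor
  · rintro hf i j k hij hjk
    have hb := (ConcreteCategory.isIso_iff_bijective (HomologicalComplex.homologyMap f j)).1
      ((quasiIsoAt_iff_isIso_homologyMap f j).1 inferInstance)
    constructor
    · intro z a hz ha
      obtain ⟨c, rfl⟩ := exists_iCycles_eq hjk z hz
      rw [← homologyπ_eq_zero_iff hij]
      refine hb.1 ?_
      rw [map_zero]
      refine (homologyMap_homologyπ f j c).trans ((homologyπ_eq_zero_iff hij _).2 ⟨a, ?_⟩)
      rw [iCycles_cyclesMap, ha]
    · intro b hb0
      obtain ⟨b, rfl⟩ := exists_iCycles_eq hjk b hb0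
      obtain ⟨c, hc⟩ := hb.2 (L.homologyπ j b)
      obtain ⟨c, rfl⟩ := homologyπ_surjective K j c
      have h1 : L.homologyπ j (HomologicalComplex.cyclesMap f j c - b) = 0 := by
        rw [map_sub, ← homologyMap_homologyπ, sub_eq_zero]
        exact hc
      obtain ⟨a, ha⟩ := (homologyπ_eq_zero_iff hij _).1 h1
      refine ⟨K.iCycles j c, a, d_iCycles _ _ _, ?_⟩
      rw [ha, map_sub, iCycles_cyclesMap]
      abel
  · intro h
    rw [quasiIso_iff]
    intro j
    have hj : j - 1 + 1 = j := by ring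
    obtain ⟨h1, h2⟩ := h (j - 1) j (j + 1) hj rfl
    rw [quasiIsoAt_iff_isIso_homologyMap]
    refine (ConcreteCategory.isIso_iff_bijective (HomologicalComplex.homologyMap f j)).2 ⟨?_, ?_⟩
    · refine (injective_iff_map_eq_zero (HomologicalComplex.homologyMap f j).hom).2 fun c hc => ?_
      obtain ⟨c, rfl⟩ := homologyπ_surjective K j c
      have hc : L.homologyπ j (HomologicalComplex.cyclesMap f j c) = 0 :=
        (homologyMap_homologyπ f j c).symm.trans hc
      obtain ⟨a, ha⟩ := (homologyπ_eq_zero_iff hj _).1 hc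
      rw [iCycles_cyclesMap] at ha
      exact (homologyπ_eq_zero_iff hj _).2 (h1 _ a (d_iCycles _ _ _) ha.symm)
    · intro b
      obtain ⟨b, rfl⟩ := homologyπ_surjective L j b
      obtain ⟨c, a, hc, ha⟩ := h2 (L.iCycles j b) (d_iCycles _ _ _)
      obtain ⟨c, rfl⟩ := exists_iCycles_eq rfl c hc
      refine ⟨K.homologyπ j c, (homologyMap_homologyπ f j c).trans ?_⟩
      rw [← sub_eq_zero, ← map_sub]
      refine (homologyπ_eq_zero_iff hj _).2 ⟨a, ?_⟩
      rw [map_sub, iCycles_cyclesMap, ha]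
      abel

end CochainComplex

-- Surjective quasi-isomorphisms and the lifting of functors

namespace AInfCat

variable {R : Type u} [CommRing R]

section

variable {C B : AInfCat R} (G : StrictFunctor C B)

/-- A lift of `a` exists once its boundary has a closed lift, and `d a` has one because it can be
lifted with boundary zero. -/
theorem StrictFunctor.LiftsBoundaries.surjectiveOnMorphisms {G : StrictFunctor C B}
    (h : G.LiftsBoundaries) : G.SurjectiveOnMorphisms := by
  intro x y i a
  obtain ⟨z, hz, hz'⟩ := h x y (i + 1) (i + 1 + 1) _ rfl rfl (B.d _ _ i (i + 1) a) 0 (map_zero _)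
    (by rw [B.d_comp_d, map_zero])
  obtain ⟨l, -, hl⟩ := h x y i (i + 1) _ rfl rfl a z hz hz'
  exact ⟨l, hl⟩

/-- Injectivity on cohomology is the property without its second conclusion; surjectivity is the
case of boundary zero. -/
theorem StrictFunctor.LiftsBoundaries.quasiIso {G : StrictFunctor C B}
    (h : G.LiftsBoundaries) (x y : C.Obj) : QuasiIso (G.homMap x y) := by
  rw [CochainComplex.quasiIso_iff_exists]
  intro i j k hij hjk
  constructor
  · intro z a hz ha
    obtain ⟨l, hl, -⟩ := h x y i j k hij hjk a z hz ha
    exact ⟨l, hl⟩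
  · intro b hb
    obtain ⟨c, hc, hc'⟩ := h x y j k (k + 1) hjk rfl b 0 (map_zero _) ((map_zero _).trans hb.symm)
    exact ⟨c, 0, hc, hc'.trans (by rw [map_zero, add_zero])⟩

/-- Injectivity on cohomology gives some `l` with boundary `z`. The defect `a - G l` is closed,
hence up to a boundary the image of a cycle, and that boundary lifts because `G` is surjective. -/
theorem StrictFunctor.liftsBoundaries (h : ∀ x y, QuasiIso (G.homMap x y))
    (hs : G.SurjectiveOnMorphisms) : G.LiftsBoundaries := by
  intro x y i j k hij hjk a z hz ha
  have h := (CochainComplex.quasiIso_iff_exists (G.homMap x y)).1 (h x y)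
  obtain ⟨l, hl⟩ : ∃ l : C.Hom x y i, C.d x y i j l = z := (h i j k hij hjk).1 z a hz ha
  have h0 : B.d _ _ i j (a - G.map x y i l) = 0 := by
    rw [map_sub, ← ha, ← G.map_d, hl, sub_self]
  obtain ⟨c, b, hc, hb⟩ : ∃ (c : C.Hom x y i) (b : B.Hom _ _ (i - 1)), C.d x y i j c = 0 ∧
      G.map x y i c = a - G.map x y i l + B.d _ _ (i - 1) i b :=
    (h (i - 1) i j (by ring) hij).2 _ h0
  obtain ⟨b, rfl⟩ := hs x y (i - 1) b
  refine ⟨l + c - C.d x y (i - 1) i b, ?_, ?_⟩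
  · rw [map_sub, map_add, hl, hc, C.d_comp_d, add_zero, sub_zero]
  · rw [map_sub, map_add, hb, G.map_d]
    abel

end

open CellTree

variable {dg : Bool} {A : AInfCat R}

open Classical in
/-- The lifting property of semi-free resolutions. -/
theorem exists_cm_lift {B C : AInfCat R} (hC : dg = true → IsDG C) (F : StrictFunctor (cm dg A) B)
    (G : StrictFunctor C B) (hG : G.LiftsBoundaries) (hF : ∀ x, ∃ c, G.obj c = F.obj x) :
    ∃ F' : StrictFunctor (cm dg A) C,
      @CategoryStruct.comp (AInfCat R) _ (cm dg A) C B F' G = F := by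
  -- The object map of `F` is replaced by that of `G` after `o`, so that morphisms of `B` need no
  -- transport along equalities of objects.
  obtain ⟨fo, fm, fmm⟩ := F
  choose o ho using hF
  obtain rfl : (fun x => G.obj (o x)) = fo := funext ho
  let F : StrictFunctor (cm dg A) B := ⟨_, fm, fmm⟩
  -- This presents `F` as an evaluation whose values on cells ignore the boundary argument.
  let g' : ∀ (x y : A.Obj) (i : ℤ) (_ : A.Hom x y i) (n : ℕ) (_ : Fin n → R)
      (_ : Fin n → CellTree R A.Hom x y) (_ : B.Hom (G.obj (o x)) (G.obj (o y)) (i + 1)),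
      B.Hom (G.obj (o x)) (G.obj (o y)) i := fun x y i a n c t _ =>
    if h : gen i a n c t ∈ cells dg A x y i then fm x y i (basis _ h) else 0
  have hg' : ∀ x y i a n c t (ht : gen i a n c t ∈ cells dg A x y i) v,
      g' x y i a n c t v = fm x y i (basis _ ht) := fun _ _ _ _ _ _ _ ht _ => dif_pos ht
  have hF : ∀ x y t e (ht : t ∈ cells dg A x y e), fm x y e (basis t ht) =
      eval B (fun x => G.obj (o x)) g' x y t e :=
    map_basis_eq_eval F g' fun x y i a n c t ht hk =>
      (hg' x y i a n c t ht (fm x y (i + 1) (∑ k, c k • basis (t k) (hk k)))).symm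
  have hs := hG.surjectiveOnMorphisms
  -- A lift of `b`, with boundary `v` whenever some lift has it. It is defined for all pairs, so it
  -- can be used to evaluate raw trees.
  have hex : ∀ (x y : A.Obj) (i : ℤ) (b : B.Hom (G.obj (o x)) (G.obj (o y)) i)
      (v : C.Hom (o x) (o y) (i + 1)), ∃ l : C.Hom (o x) (o y) i, G.map _ _ i l = b ∧
      ((∃ l', G.map _ _ i l' = b ∧ C.d _ _ i (i + 1) l' = v) → C.d _ _ i (i + 1) l = v) := by
    intro x y i b v
    by_cases h : ∃ l', G.map _ _ i l' = b ∧ C.d _ _ i (i + 1) l' = v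
    · exact ⟨h.choose, h.choose_spec.1, fun _ => h.choose_spec.2⟩
    · obtain ⟨l, hl⟩ := hs (o x) (o y) i b
      exact ⟨l, hl, fun h' => absurd h' h⟩
  choose lift hlift hlift' using hex
  let g : ∀ (x y : A.Obj) (i : ℤ) (_ : A.Hom x y i) (n : ℕ) (_ : Fin n → R)
      (_ : Fin n → CellTree R A.Hom x y) (_ : C.Hom (o x) (o y) (i + 1)), C.Hom (o x) (o y) i :=
    fun x y i a n c t v => lift x y i (g' x y i a n c t (G.map _ _ _ v)) v
  have heval := G.map_eval (H := A.Hom) o g g' fun x y i a n c t v => hlift ..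
  have hcompat : Compatible (A := A) dg C o g := by
    intro x y i a n c t h h0
    refine hlift' _ _ _ _ _ ?_
    have ht : gen i a n c t ∈ cells dg A x y i := ⟨h, by rw [sdeg_gen, sub_add_cancel]⟩
    have hk : ∀ k, t k ∈ cells dg A x y (i + 1) := fun k =>
      ⟨(((valid_gen ..).1 h).1 k).1, by rw [(((valid_gen ..).1 h).1 k).2]⟩
    obtain ⟨l, hl, hl'⟩ := hG (o x) (o y) i (i + 1) (i + 2) rfl (by ring)
      (fm x y i (basis _ ht)) _ h0 (by
      refine Eq.trans ?_ (F.map_d x y i (i + 1) (basis _ ht))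
      have : (cm dg A).d x y i (i + 1) (basis _ ht) = ∑ k, c k • basis (t k) (hk k) :=
        Subtype.ext ((d_basis_gen ht).trans (coe_sum_basis c t hk).symm)
      rw [this, map_sum, map_sum]
      refine Finset.sum_congr rfl fun k _ => ?_
      rw [map_smul, map_smul, heval]
      exact congrArg (c k • ·) (hF _ _ _ _ (hk k)).symm)
    exact ⟨l, hl'.trans (hg' x y i a n c t ht 0).symm, hl⟩
  refine ⟨evalFunctor (A := A) C o g hC hcompat, StrictFunctor.ext rfl (heq_of_eq (funext fun x =>
    funext fun y => funext fun e => cmHom_ext fun t ht => ?_))⟩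
  refine Eq.trans ?_ (hF x y t e ht).symm
  refine Eq.trans ?_ (heval x y t e)
  exact congrArg (G.map _ _ e) (evalL_single ..)

end AInfCat

-- Homotopies by recursion on the weight of trees

namespace AInfCat

open CellTree

variable {R : Type u} [CommRing R] {dg : Bool} {A : AInfCat R}

section Homotopy

variable {x y : A.Obj} {L M : ℤ → Type u} [∀ i, AddCommGroup (L i)] [∀ i, Module R (L i)]
  [∀ i, AddCommGroup (M i)] [∀ i, Module R (M i)]

open Classical in
/-- The extension by zero of the values of a linear map on the basis of trees. -/
noncomputable def onTree (f : ∀ i, CmHom dg A x y i →ₗ[R] L i) (t : CellTree R A.Hom x y) (i : ℤ) :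
    L i :=
  if h : t ∈ cells dg A x y i then f i (basis t h) else 0

theorem onTree_eq (f : ∀ i, CmHom dg A x y i →ₗ[R] L i) (t : CellTree R A.Hom x y) {i : ℤ}
    (h : t ∈ cells dg A x y i) : onTree f t i = f i (basis t h) :=
  dif_pos h

theorem linearCombination_basis {N : Type u} [AddCommGroup N] [Module R N]
    {i : ℤ} (φ : CellTree R A.Hom x y → N) (t : CellTree R A.Hom x y)
    (h : t ∈ cells dg A x y i) : Finsupp.linearCombination R φ (basis t h).1 = φ t := by
  rw [basis, Finsupp.linearCombination_single, one_smul]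

theorem linearCombination_onTree (f : ∀ i, CmHom dg A x y i →ₗ[R] L i) {i : ℤ}
    (v : CmHom dg A x y i) : Finsupp.linearCombination R (fun t => onTree f t i) v.1 = f i v := by
  refine LinearMap.congr_fun (f := Finsupp.linearCombination R (fun t => onTree f t i) ∘ₗ
    Submodule.subtype _) (cmHom_ext fun t ht => ?_) v
  exact (linearCombination_basis _ t ht).trans (onTree_eq f t ht)

theorem d_basis {i : ℤ} (t : CellTree R A.Hom x y) (ht : t ∈ cells dg A x y i) :
    ((cm dg A).d x y i (i + 1) (basis t ht)).1 = diff dg x y t := by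
  rw [cm_d, linearCombination_basis]

theorem cells_of_mem_support_diff {t : CellTree R A.Hom x y} {i : ℤ} (ht : t ∈ cells dg A x y i)
    {r : CellTree R A.Hom x y} (hr : r ∈ (diff dg x y t).support) :
    r ∈ cells dg A x y (i + 1) :=
  ⟨valid_of_mem_support_diff _ _ t ht.1 r hr, by rw [sdeg_of_mem_support_diff _ _ _ _ r hr, ht.2]⟩

/-- Homotopies on the basis of trees can be lifted by induction on the weight. -/
theorem exists_homotopy_onTree (dL : ∀ i j, L i →ₗ[R] L j) (dM : ∀ i j, M i →ₗ[R] M j)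
    (p : ∀ i, L i →ₗ[R] M i)
    (hp : ∀ i j k, i + 1 = j → j + 1 = k → ∀ (a : M i) (z : L j), dL j k z = 0 →
      p j z = dM i j a → ∃ l : L i, dL i j l = z ∧ p i l = a)
    (f : ∀ i, CmHom dg A x y i →ₗ[R] L i)
    (hf : ∀ i j v, i + 1 = j → dL i j (f i v) = f j ((cm dg A).d x y i j v))
    (H : ∀ i j, CmHom dg A x y i →ₗ[R] M j)
    (hH : ∀ i j k, i + 1 = j → j + 1 = k → ∀ v, p j (f j v) =
      dM i j (H j i v) + H k j ((cm dg A).d x y j k v)) :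
    ∃ η : CellTree R A.Hom x y → ∀ j, L j, ∀ (t : CellTree R A.Hom x y) (i j k : ℤ), i + 1 = j →
      j + 1 = k → ∀ ht : t ∈ cells dg A x y j, dL i j (η t i) =
        f j (basis t ht) - Finsupp.linearCombination R (fun r => η r j) (diff dg x y t) ∧
        p i (η t i) = H j i (basis t ht) := by
  classical
  -- `Q η t i l` says that `l` is an admissible value of the homotopy on `t`, given the values `η`
  -- on the terms of its boundary.
  let Q : (CellTree R A.Hom x y → ∀ j, L j) → CellTree R A.Hom x y → ∀ i, L i → Prop :=
    fun η t i l => ∀ ht : t ∈ cells dg A x y (i + 1), dL i (i + 1) l = f (i + 1) (basis t ht) -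
      Finsupp.linearCombination R (fun r => η r (i + 1)) (diff dg x y t) ∧
      p i l = H (i + 1) i (basis t ht)
  -- The terms of the boundary of `t` are lighter than `t`, so replacing the values on the other
  -- trees by zero does not affect `Q`.
  let step : ∀ t, (∀ r, wt x y r < wt x y t → ∀ j, L j) → ∀ j, L j := fun t ih i =>
    Classical.epsilon (Q (fun r => if h : wt x y r < wt x y t then ih r h else 0) t i)
  let η : CellTree R A.Hom x y → ∀ j, L j := (measure (wt x y)).wf.fix step
  have hη : ∀ t i, η t i = Classical.epsilon (Q η t i) := by
    intro t i
    refine (congrFun ((measure (wt x y)).wf.fix_eq step t) i).trans ?_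
    refine congrArg Classical.epsilon (funext fun l => ?_)
    have : Finsupp.linearCombination R (fun r => (if h : wt x y r < wt x y t then η r else 0 :
        ∀ j, L j) (i + 1)) (diff dg x y t) =
        Finsupp.linearCombination R (fun r => η r (i + 1)) (diff dg x y t) := by
      refine Finsupp.linearMap_eq_of_single _ _ _ fun r hr => ?_
      rw [Finsupp.linearCombination_single, Finsupp.linearCombination_single,
        dif_pos (wt_of_mem_support_diff dg x y t r hr)]
    show (∀ ht, _ = _ - Finsupp.linearCombination R (fun r =>
      (if h : wt x y r < wt x y t then η r else 0 : ∀ j, L j) (i + 1)) (diff dg x y t) ∧ _) = _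
    rw [this]
  have key : ∀ n t, wt x y t < n → ∀ i, Q η t i (η t i) := by
    intro n
    induction n with
    | zero => exact fun t ht => absurd ht (by omega)
    | succ n ih =>
      intro t hn i
      rw [hη t i]
      refine Classical.epsilon_spec (p := Q η t i) ?_
      by_cases ht : t ∈ cells dg A x y (i + 1)
      · have ih : ∀ r ∈ (diff dg x y t).support, ∀ i, Q η r i (η r i) := fun r hr =>
          ih r (by have := wt_of_mem_support_diff dg x y t r hr; omega)
        have hdt := linearCombination_onTree (i := i + 1 + 1) f
          ((cm dg A).d x y (i + 1) (i + 1 + 1) (basis t ht))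
        have hHt := hH i (i + 1) (i + 1 + 1) rfl rfl (basis t ht)
        rw [d_basis] at hdt
        have h1 : dL (i + 1) (i + 1 + 1) (Finsupp.linearCombination R (fun r => η r (i + 1))
            (diff dg x y t)) = Finsupp.linearCombination R (fun t => onTree f t (i + 1 + 1))
              (diff dg x y t) - Finsupp.linearCombination R (fun r => η r (i + 1 + 1))
                (Finsupp.linearCombination R (diff dg x y) (diff dg x y t)) := by
          refine Finsupp.linearMap_eq_of_single ((dL (i + 1) (i + 1 + 1)) ∘ₗ
            (Finsupp.linearCombination R (fun r => η r (i + 1))))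
            (Finsupp.linearCombination R (fun t => onTree f t (i + 1 + 1)) -
              (Finsupp.linearCombination R (fun r => η r (i + 1 + 1))) ∘ₗ
                (Finsupp.linearCombination R (diff dg x y))) _ fun r hr => ?_
          have hr' := cells_of_mem_support_diff ht hr
          simp only [LinearMap.comp_apply, LinearMap.sub_apply,
            Finsupp.linearCombination_single, one_smul]
          rw [(ih r hr (i + 1) hr').1, onTree_eq f r hr']
        have h2 : p (i + 1) (Finsupp.linearCombination R (fun r => η r (i + 1))
            (diff dg x y t)) = H (i + 1 + 1) (i + 1)
              ((cm dg A).d x y (i + 1) (i + 1 + 1) (basis t ht)) := by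
          rw [← linearCombination_onTree (L := fun _ => M (i + 1)) (fun j => H j (i + 1)), d_basis]
          refine Finsupp.linearMap_eq_of_single ((p (i + 1)) ∘ₗ
            (Finsupp.linearCombination R (fun r => η r (i + 1)))) _ _ fun r hr => ?_
          have hr' := cells_of_mem_support_diff ht hr
          rw [LinearMap.comp_apply, Finsupp.linearCombination_single, one_smul,
            Finsupp.linearCombination_single, one_smul, (ih r hr (i + 1) hr').2,
            onTree_eq _ r hr']
        -- The new value must have boundary `f t - η (d t)` and lie over `H t`. By `h1` and the
        -- vanishing of the squared differential this element is closed, and by `h2` and `hH` it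
        -- lies over the boundary of `H t`.
        refine (hp i (i + 1) (i + 1 + 1) rfl rfl (H (i + 1) i (basis t ht))
          (f (i + 1) (basis t ht) - Finsupp.linearCombination R (fun r => η r (i + 1))
            (diff dg x y t)) ?_ ?_).imp fun l hl _ => hl
        · rw [map_sub, hf _ _ _ rfl, h1, hdt, diff_diff x y t ht.1, map_zero, sub_zero, sub_self]
        · rw [map_sub, hHt, h2, add_sub_cancel_right]
      · exact ⟨0, fun h => absurd h ht⟩
  refine ⟨η, ?_⟩
  rintro t i _ _ rfl rfl ht
  exact key _ t (Nat.lt_succ_self _) i ht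

/-- Homotopies can be lifted along maps with the lifting property of surjective
quasi-isomorphisms. -/
theorem exists_homotopy (dL : ∀ i j, L i →ₗ[R] L j) (dM : ∀ i j, M i →ₗ[R] M j)
    (p : ∀ i, L i →ₗ[R] M i)
    (hp : ∀ i j k, i + 1 = j → j + 1 = k → ∀ (a : M i) (z : L j), dL j k z = 0 →
      p j z = dM i j a → ∃ l : L i, dL i j l = z ∧ p i l = a)
    (f : ∀ i, CmHom dg A x y i →ₗ[R] L i)
    (hf : ∀ i j v, i + 1 = j → dL i j (f i v) = f j ((cm dg A).d x y i j v))
    (H : ∀ i j, CmHom dg A x y i →ₗ[R] M j)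
    (hH : ∀ i j k, i + 1 = j → j + 1 = k → ∀ v, p j (f j v) =
      dM i j (H j i v) + H k j ((cm dg A).d x y j k v)) :
    ∃ h : ∀ i j, CmHom dg A x y i →ₗ[R] L j, ∀ i j k, i + 1 = j → j + 1 = k → ∀ v,
      f j v = dL i j (h j i v) + h k j ((cm dg A).d x y j k v) := by
  obtain ⟨η, hη⟩ := exists_homotopy_onTree dL dM p hp f hf H hH
  refine ⟨fun i j => Finsupp.linearCombination R (fun t => η t j) ∘ₗ Submodule.subtype _, ?_⟩
  rintro i _ _ rfl rfl v
  refine LinearMap.congr_fun (f := f (i + 1)) (g := (dL i (i + 1)) ∘ₗ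
    Finsupp.linearCombination R (fun t => η t i) ∘ₗ Submodule.subtype _ +
    (Finsupp.linearCombination R (fun t => η t (i + 1)) ∘ₗ Submodule.subtype _) ∘ₗ
    ((cm dg A).d x y (i + 1) (i + 1 + 1))) (cmHom_ext fun t ht => ?_) v
  have h1 : ((cm dg A).d x y (i + 1) (i + 1 + 1) (basis t ht)).1 = _ := d_basis t ht
  rw [LinearMap.add_apply, LinearMap.comp_apply, LinearMap.comp_apply, LinearMap.comp_apply,
    LinearMap.comp_apply, Submodule.subtype_apply, Submodule.subtype_apply, h1,
    linearCombination_basis, (hη t i _ _ rfl rfl ht).1, sub_add_cancel]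

end Homotopy

end AInfCat

-- Cofibrancy of the morphism complexes

namespace AInfCat

open CellTree

variable {R : Type u} [CommRing R]

section

variable {dg : Bool} {A : AInfCat R}

/-- The homotopy lifting over the zero complex: its hypothesis then says that cycles of the acyclic
target are boundaries. -/
theorem isKProjective_cm (x y : A.Obj) : ((cm dg A).homComplex x y).IsKProjective where
  nonempty_homotopy_zero {L} f hL := by
    obtain ⟨h, hh⟩ := exists_homotopy (dg := dg) (A := A) (x := x) (y := y)
      (L := fun i => L.X i) (M := fun _ => PUnit) (fun i j => (L.d i j).hom) (fun _ _ => 0)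
      (fun _ => 0)
      (fun i j k hij hjk a z hz _ => by
        have h1 := (L.exactAt_iff' i j k (ComplexShape.prev_eq' _ hij)
          (ComplexShape.next_eq' _ hjk)).1 (hL j)
        obtain ⟨l, hl⟩ := (ShortComplex.moduleCat_exact_iff _).1 h1 z hz
        exact ⟨l, hl, rfl⟩)
      (fun i => (f.f i).hom)
      (fun i j v _ => by
        have := congrArg (fun φ => φ.hom v) (f.comm i j)
        exact this)
      (fun _ _ => 0) (fun _ _ _ _ _ _ => rfl)
    let φ : ∀ i j, ((cm dg A).homComplex x y).X i ⟶ L.X j := fun i j => ModuleCat.ofHom (h i j)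
    refine ⟨{ hom := fun i j => if j + 1 = i then φ i j else 0
              zero := fun i j hij => if_neg hij
              comm := fun i => ?_ }⟩
    rw [dNext_eq _ (show (ComplexShape.up ℤ).Rel i (i + 1) from rfl),
      prevD_eq _ (show (ComplexShape.up ℤ).Rel (i - 1) i from sub_add_cancel i 1), if_pos rfl,
      if_pos (sub_add_cancel i 1), HomologicalComplex.zero_f, add_zero]
    ext v
    refine (hh (i - 1) i (i + 1) (sub_add_cancel i 1) rfl v).trans (add_comm _ _)

theorem hasCofibrantMorphisms_cm : (cm dg A).HasCofibrantMorphisms := fun x y =>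
  ⟨isKProjective_cm (A := A) x y, fun i =>
    Module.Projective.of_equiv (Finsupp.supportedEquivFinsupp (M := R) (R := R)
      (cells dg A x y i)).symm⟩

end

-- Cohomological identities and units

section Unit

variable {A : AInfCat R}

/-- The `A∞`-relation with two arguments. -/
theorem d_m₂ {x y z : A.Obj} {i j : ℤ} (g : A.Hom y z j) (f : A.Hom x y i) (k : ℤ)
    (hk : k = i + j) : A.d x z k (k + 1) (A.m₂ g f k) +
      (i - 1).negOnePow • A.m₂ (A.d y z j (j + 1) g) f (k + 1) +
        A.m₂ g (A.d x y i (i + 1) f) (k + 1) = 0 := by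
  subst hk
  have hr := A.rel ((Chain.single ⟨i, f⟩).cons ⟨j, g⟩) (i + j + 1)
  have h0 := A.m_zero (Chain.nil x) 2 ((Chain.single ⟨i, f⟩).cons ⟨j, g⟩) (i + j + 1)
  have h1 := A.m_zero (Chain.single ⟨i, f⟩) 2 (Chain.single ⟨j, g⟩) (i + j + 1)
  have h2 := A.m_zero ((Chain.single ⟨i, f⟩).cons ⟨j, g⟩) 2 (Chain.nil z) (i + j + 1)
  simp only [Chain.single, Chain.append] at h0 h1 h2
  simp [Chain.single, Chain.splits, Chain.append, A.m_nil, Chain.deg, Chain.length, h0, h1,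
    h2] at hr
  rw [show 0 + i + j + 2 - 2 = i + j by ring, show 0 + i + 2 - 1 = i + 1 by ring,
    show 0 + j + 2 - 1 = j + 1 by ring] at hr
  exact (add_comm _ _).trans hr

/-- The difference between the identity and the composition with `e` on the right. -/
def unitR {x : A.Obj} (e : A.Hom x x 0) (y : A.Obj) (i : ℤ) : A.Hom x y i →ₗ[R] A.Hom x y i :=
  LinearMap.id - A.slot (Chain.single ⟨0, e⟩) i (Chain.nil y) i

/-- The difference between the identity and the composition with `e` on the left. -/
def unitL {x : A.Obj} (e : A.Hom x x 0) (y : A.Obj) (i : ℤ) : A.Hom y x i →ₗ[R] A.Hom y x i :=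
  LinearMap.id - (i.negOnePow : ℤ) • A.slot (Chain.nil y) i (Chain.single ⟨0, e⟩) i

theorem unitR_apply {x : A.Obj} (e : A.Hom x x 0) (y : A.Obj) (i : ℤ) (f : A.Hom x y i) :
    unitR e y i f = f - A.m₂ f e i := rfl

theorem unitL_apply {x : A.Obj} (e : A.Hom x x 0) (y : A.Obj) (i : ℤ) (f : A.Hom y x i) :
    unitL e y i f = f - i.negOnePow • A.m₂ e f i := rfl

theorem m₂_zero_left {x y z : A.Obj} {i j : ℤ} (f : A.Hom x y i) (k : ℤ) :
    A.m₂ (0 : A.Hom y z j) f k = 0 :=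
  A.m_zero (Chain.single ⟨i, f⟩) j (Chain.nil z) k

theorem m₂_zero_right {x y z : A.Obj} {i j : ℤ} (g : A.Hom y z j) (k : ℤ) :
    A.m₂ g (0 : A.Hom x y i) k = 0 :=
  A.m_zero (Chain.nil x) i (Chain.single ⟨j, g⟩) k

theorem d_unitR {x : A.Obj} {e : A.Hom x x 0} (he : A.d x x 0 1 e = 0) (y : A.Obj) {i j : ℤ}
    (h : i + 1 = j) (f : A.Hom x y i) :
    A.d x y i j (unitR e y i f) = unitR e y j (A.d x y i j f) := by
  subst h
  have := d_m₂ f e i (by ring)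
  rw [show A.d x x 0 (0 + 1) e = 0 from he, m₂_zero_right, add_zero, zero_sub,
    Int.negOnePow_odd (-1) (by decide), Units.neg_smul, one_smul, add_neg_eq_zero] at this
  rw [unitR_apply, unitR_apply, map_sub, this]

/-- For closed `e` the map `m²(e, -)` anticommutes with the differential; the degree-dependent sign
in `unitL` turns it into a chain map. -/
theorem d_unitL {x : A.Obj} {e : A.Hom x x 0} (he : A.d x x 0 1 e = 0) (y : A.Obj) {i j : ℤ}
    (h : i + 1 = j) (f : A.Hom y x i) :
    A.d y x i j (unitL e y i f) = unitL e y j (A.d y x i j f) := by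
  subst h
  have := d_m₂ e f i (by ring)
  rw [show A.d x x 0 (0 + 1) e = 0 from he, m₂_zero_left, smul_zero, add_zero] at this
  rw [unitL_apply, unitL_apply, map_sub, Int.map_negOnePow_smul, eq_neg_of_add_eq_zero_left this,
    Int.negOnePow_add_one, smul_neg, Units.neg_smul]

variable {C B : AInfCat R} (G : StrictFunctor C B)

theorem StrictFunctor.map_unitR {x : C.Obj} (e : C.Hom x x 0) (y : C.Obj) (i : ℤ)
    (f : C.Hom x y i) :
    G.map x y i (unitR e y i f) = unitR (G.map x x 0 e) (G.obj y) i (G.map x y i f) := by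
  rw [unitR_apply, unitR_apply, map_sub]
  exact congrArg (G.map x y i f - ·) (G.map_m ((Chain.single ⟨0, e⟩).cons ⟨i, f⟩) i)

theorem StrictFunctor.map_unitL {x : C.Obj} (e : C.Hom x x 0) (y : C.Obj) (i : ℤ)
    (f : C.Hom y x i) :
    G.map y x i (unitL e y i f) = unitL (G.map x x 0 e) (G.obj y) i (G.map y x i f) := by
  rw [unitL_apply, unitL_apply, map_sub, Int.map_negOnePow_smul]
  exact congrArg (fun h => G.map y x i f - i.negOnePow • h)
    (G.map_m ((Chain.single ⟨i, f⟩).cons ⟨0, e⟩) i)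

variable {G}

theorem StrictFunctor.LiftsBoundaries.exists_cycle (hG : G.LiftsBoundaries) {x y : C.Obj} {i j : ℤ}
    (h : i + 1 = j) (b : B.Hom (G.obj x) (G.obj y) i) (hb : B.d _ _ i j b = 0) :
    ∃ c, C.d x y i j c = 0 ∧ G.map x y i c = b :=
  hG x y i j (j + 1) h rfl b 0 (map_zero _) (by rw [map_zero, hb])

/-- Closed test morphisms lift to closed ones. Surjectivity on objects is needed because an identity
is tested against all objects of `B`. -/
theorem StrictFunctor.LiftsBoundaries.isCohUnit_map (hG : G.LiftsBoundaries)
    (hs : Function.Surjective G.obj) {x : C.Obj} {e : C.Hom x x 0} (he : C.IsCohUnit e) :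
    B.IsCohUnit (G.map x x 0 e) := by
  obtain ⟨h0, h1, h2⟩ := he
  refine ⟨by rw [← G.map_d, h0, map_zero], ?_, ?_⟩
  · intro y k f hf
    obtain ⟨y, rfl⟩ := hs y
    obtain ⟨f, hf', rfl⟩ := hG.exists_cycle rfl f hf
    obtain ⟨h, hh⟩ := h1 y k f hf'
    refine ⟨G.map _ _ _ h, ?_⟩
    rw [← unitR_apply, ← G.map_unitR, unitR_apply, hh, G.map_d]
  · intro y k f hf
    obtain ⟨y, rfl⟩ := hs y
    obtain ⟨f, hf', rfl⟩ := hG.exists_cycle rfl f hf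
    obtain ⟨h, hh⟩ := h2 y k f hf'
    refine ⟨G.map _ _ _ h, ?_⟩
    rw [← unitL_apply, ← G.map_unitL, unitL_apply, hh, G.map_d]

/-- For closed `f`, its difference from its composite with `e` is a cycle whose image bounds; such a
cycle bounds already in `C`. -/
theorem StrictFunctor.LiftsBoundaries.isCohUnit_of_map (hG : G.LiftsBoundaries) {x : C.Obj}
    {e : C.Hom x x 0} (h0 : C.d x x 0 1 e = 0) (he : B.IsCohUnit (G.map x x 0 e)) :
    C.IsCohUnit e := by
  obtain ⟨-, h1, h2⟩ := he
  refine ⟨h0, ?_, ?_⟩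
  · intro y k f hf
    obtain ⟨h, hh⟩ := h1 (G.obj y) k (G.map x y k f) (by rw [← G.map_d, hf, map_zero])
    obtain ⟨l, hl, -⟩ := hG x y (k - 1) k (k + 1) (by ring) rfl h (unitR e y k f)
      (by rw [d_unitR h0 y rfl, hf, map_zero]) (by rw [G.map_unitR, unitR_apply, hh])
    exact ⟨l, hl.symm⟩
  · intro y k f hf
    obtain ⟨h, hh⟩ := h2 (G.obj y) k (G.map y x k f) (by rw [← G.map_d, hf, map_zero])
    obtain ⟨l, hl, -⟩ := hG y x (k - 1) k (k + 1) (by ring) rfl h (unitL e y k f)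
      (by rw [d_unitL h0 y rfl, hf, map_zero]) (by rw [G.map_unitL, unitL_apply, hh])
    exact ⟨l, hl.symm⟩

theorem StrictFunctor.LiftsBoundaries.isCohUnital (hG : G.LiftsBoundaries) (hB : B.IsCohUnital) :
    C.IsCohUnital := by
  intro x
  obtain ⟨e, he⟩ := hB (G.obj x)
  obtain ⟨c, hc, rfl⟩ := hG.exists_cycle (zero_add 1) e he.1
  exact ⟨c, hG.isCohUnit_of_map hc he⟩

variable {dg : Bool}

/-- Let `c` be a closed lift of the unit. The difference between the identity and composition with
`c` lies over the corresponding map of `A`, which is null-homotopic. That homotopy, precomposed with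
the projection, lifts by `exists_homotopy`. -/
theorem isUnital_cm (hA : dg = true → IsDG A) (h : A.IsUnital) : (cm dg A).IsUnital := by
  intro x
  have hG := liftsBoundaries_cmProj hA
  obtain ⟨e, he, h1, h2⟩ := h x
  obtain ⟨c, hc, rfl⟩ := hG.exists_cycle (zero_add 1) e he.1
  refine ⟨c, hG.isCohUnit_of_map hc he, fun y => ?_, fun y => ?_⟩
  · obtain ⟨H, hH⟩ := h1 y
    obtain ⟨h, hh⟩ := exists_homotopy (dg := dg) (A := A) (x := x) (y := y)
      (L := (cm dg A).Hom x y) (M := A.Hom x y) ((cm dg A).d x y) (A.d x y)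
      ((cmProj A hA).map x y) (hG x y) (unitR c y)
      (fun i j v hij => d_unitR hc y hij v) (fun i j => H i j ∘ₗ (cmProj A hA).map x y i)
      (by
        rintro i _ _ rfl rfl v
        refine ((cmProj A hA).map_unitR c y (i + 1) v).trans ?_
        have := hH (i + 1) ((cmProj A hA).map x y (i + 1) v)
        rw [add_sub_cancel_right] at this
        refine this.trans (congrArg
          (A.d x y i (i + 1) (H (i + 1) i _) + H (i + 1 + 1) (i + 1) ·) ?_)
        exact ((cmProj A hA).map_d x y (i + 1) (i + 1 + 1) v).symm)
    exact ⟨h, fun k f => hh (k - 1) k (k + 1) (sub_add_cancel k 1) rfl f⟩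
  · obtain ⟨H, hH⟩ := h2 y
    obtain ⟨h, hh⟩ := exists_homotopy (dg := dg) (A := A) (x := y) (y := x)
      (L := (cm dg A).Hom y x) (M := A.Hom y x) ((cm dg A).d y x) (A.d y x)
      ((cmProj A hA).map y x) (hG y x) (unitL c y)
      (fun i j v hij => d_unitL hc y hij v) (fun i j => H i j ∘ₗ (cmProj A hA).map y x i)
      (by
        rintro i _ _ rfl rfl v
        refine ((cmProj A hA).map_unitL c y (i + 1) v).trans ?_
        have := hH (i + 1) ((cmProj A hA).map y x (i + 1) v)
        rw [add_sub_cancel_right] at this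
        refine this.trans (congrArg
          (A.d y x i (i + 1) (H (i + 1) i _) + H (i + 1 + 1) (i + 1) ·) ?_)
        exact ((cmProj A hA).map_d y x (i + 1) (i + 1 + 1) v).symm)
    exact ⟨h, fun k f => hh (k - 1) k (k + 1) (sub_add_cancel k 1) rfl f⟩

/-- The image of a cohomological identity `e` is closed and lies over the image under `F` of the
projection of `e`, which is a cohomological identity; the projection reflects this. -/
theorem isCohUnital_cmMap (F : StrictFunctor A B) (hA : dg = true → IsDG A)
    (hB : dg = true → IsDG B) (hF : F.IsCohUnital) : (cmMap F hB).IsCohUnital := by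
  intro x e he
  refine (liftsBoundaries_cmProj hB).isCohUnit_of_map ?_ ?_
  · exact ((cmMap F hB).map_d x x 0 1 e).symm.trans ((congrArg _ he.1).trans (map_zero _))
  · have := hF _ _ ((liftsBoundaries_cmProj hA).isCohUnit_map (fun x => ⟨x, rfl⟩) he)
    exact (proj_cmMap F hB e).symm ▸ this

end Unit

-- Assembly in the two categories

section FullSubcategory

variable (R) in
/-- The semi-free resolution as an endofunctor of a full subcategory. -/
noncomputable def cmFunctor (dg : Bool) (P : ObjectProperty (AInfCat.{u} R))
    (h1 : ∀ A, P (cm dg A)) (h2 : ∀ A, P A → dg = true → IsDG A) :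
    P.FullSubcategory ⥤ P.FullSubcategory where
  obj A := ⟨cm dg A.obj, h1 A.obj⟩
  map {_ B} F := P.homMk (cmMap F.hom (h2 B.obj B.property))
  map_id A := ObjectProperty.hom_ext _ (cmMap_id (h2 A.obj A.property))
  map_comp {_ B C} F G := ObjectProperty.hom_ext _
    (cmMap_comp F.hom G.hom (h2 B.obj B.property) (h2 C.obj C.property))

variable (R) in
/-- The projection of the semi-free resolution as a natural transformation. -/
noncomputable def cmNatTrans (dg : Bool) (P : ObjectProperty (AInfCat.{u} R))
    (h1 : ∀ A, P (cm dg A)) (h2 : ∀ A, P A → dg = true → IsDG A) :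
    cmFunctor R dg P h1 h2 ⟶ 𝟭 P.FullSubcategory where
  app A := P.homMk (cmProj A.obj (h2 A.obj A.property))
  naturality A B F := ObjectProperty.hom_ext _
    (cmMap_comp_cmProj F.hom (h2 A.obj A.property) (h2 B.obj B.property))

end FullSubcategory

end AInfCat

theorem theoremB (R : Type u) [CommRing R] (P : ObjectProperty (AInfCat.{u} R))
    (hP : P = ⊤ ∨ P = AInfCat.IsDG) :
    ∃ (cm : P.FullSubcategory ⥤ P.FullSubcategory) (Ψ : cm ⟶ 𝟭 P.FullSubcategory),
      (∀ A : P.FullSubcategory,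
        (∃ h : (cm.obj A).obj.Obj = A.obj.Obj, ∀ x, (Ψ.app A).hom.obj x = cast h x) ∧
        (cm.obj A).obj.HasCofibrantMorphisms ∧
        (Ψ.app A).hom.IsQuasiEquivalence ∧
        (Ψ.app A).hom.SurjectiveOnMorphisms ∧
        (A.obj.IsCohUnital → (cm.obj A).obj.IsCohUnital ∧
          (Ψ.app A).hom.IsCohUnital) ∧
        (A.obj.IsUnital → (cm.obj A).obj.IsUnital)) ∧
      (∀ (A B : P.FullSubcategory) (F : A ⟶ B), A.obj.IsCohUnital → B.obj.IsCohUnital →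
        F.hom.IsCohUnital →
        (cm.map F).hom.IsCohUnital) ∧
      (∀ (A B C : P.FullSubcategory) (F : cm.obj A ⟶ B) (G : C ⟶ B),
        G.hom.IsQuasiEquivalence →
        G.hom.SurjectiveOnMorphisms →
        (∀ x, ∃ c, G.hom.obj c = F.hom.obj x) →
        ∃ F' : cm.obj A ⟶ C, F' ≫ G = F) := by
  -- The flag selects the free `A∞` construction or the free DG construction. Only the latter needs
  -- `A` to be DG, for evaluation in `A` to respect products.
  obtain ⟨dg, h1, h2⟩ : ∃ dg : Bool, (∀ A, P (AInfCat.cm dg A)) ∧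
      ∀ A, P A → dg = true → AInfCat.IsDG A := by
    rcases hP with rfl | rfl
    · exact ⟨false, fun _ => trivial, fun _ _ h => absurd h (by decide)⟩
    · exact ⟨true, fun A => AInfCat.isDG_cm A, fun _ h _ => h⟩
  refine ⟨AInfCat.cmFunctor R dg P h1 h2, AInfCat.cmNatTrans R dg P h1 h2, fun A => ?_, ?_, ?_⟩
  · have hG := AInfCat.liftsBoundaries_cmProj (h2 A.obj A.property)
    exact ⟨⟨rfl, fun _ => rfl⟩, AInfCat.hasCofibrantMorphisms_cm,
      ⟨hG.quasiIso, fun b => ⟨b, Or.inl rfl⟩⟩, hG.surjectiveOnMorphisms,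
      fun h => ⟨hG.isCohUnital h, fun _ _ he => hG.isCohUnit_map (fun x => ⟨x, rfl⟩) he⟩,
      AInfCat.isUnital_cm (h2 A.obj A.property)⟩
  · exact fun A B F _ _ hF =>
      AInfCat.isCohUnital_cmMap F.hom (h2 A.obj A.property) (h2 B.obj B.property) hF
  · intro A B C F G hG hs hF
    obtain ⟨F', hF'⟩ := AInfCat.exists_cm_lift (h2 C.obj C.property) F.hom G.hom
      (G.hom.liftsBoundaries hG.1 hs) hF
    exact ⟨P.homMk F', ObjectProperty.hom_ext _ hF'⟩
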